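/- Let $n\ge 2$. Let $\mathcal F(\mathbb C^n)$ be the space of complete flags $F=(F^0\subset F^1\subset\dots\subset F^n)$ in $\mathbb C^n$, $\dim F^j=j$, with its usual topology and Borel structure, and identify $P(\mathbb C^2)$ with $\partial\mathbb H^3$. Let $\mathrm{Vol}_{\mathbb H^3}:P(\mathbb C^2)^4\to\mathbb R$ be the signed hyperbolic volume of the ideal tetrahedron with the given vertices (positive on $(\infty,0,1,z)$ when $\operatorname{Im}z>0$) and $v_3=\max \mathrm{Vol}_{\mathbb H^3}$. For a finite-dimensional complex vector space $V$ and $x_0,\dots,x_3\in V$ put $\mathrm{Vol}(V;x_0,\dots,x_3)=\mathrm{Vol}_{\mathbb H^3}(\mathbb Cx_0,\dots,\mathbb Cx_3)$ (for any identification $V\cong\mathbb C^2$) if $\dim V=2$ and all $x_i\ne0$, and $0$ otherwise. For flags $F_0,\dots,F_3\in\mathcal F(\mathbb C^n)$ choose $v_i^{j}$ with $F_i^{j}=\mathbb Cv_i^{j}+F_i^{j-1}$ and set $$B_n(F_0,\dots,F_3)=\sum_{0\le j_0,\dots,j_3\le n-1}\mathrm{Vol}\Big(\frac{\langle F_0^{j_0+1},\dots,F_3^{j_3+1}\rangle}{\langle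 F_0^{j_0},\dots,F_3^{j_3}\rangle};v_0^{j_0+1},\dots,v_3^{j_3+1}\Big),$$ which does not depend on the choices. Call $(\xi_0,\dots,\xi_3)\in P(\mathbb C^2)^4$ maximal if $\mathrm{Vol}_{\mathbb H^3}(\xi_0,\dots,\xi_3)=v_3$ (equivalently, it is the vertex set of a positively oriented regular ideal simplex), and $(F_0,\dots,F_3)\in\mathcal F(\mathbb C^n)^4$ maximal if $B_n(F_0,\dots,F_3)=\tfrac16 n(n^2-1)v_3$. The group $\mathrm{PSL}(2,\mathbb C)$ acts simply transitively on the maximal $4$-tuples of points; "almost every" such $4$-tuple refers to the measure class of Haar measure transported by this action. Let $\varphi_n:P(\mathbb C^2)\to\mathcal F(\mathbb C^n)$ be the Veronese embedding: for $0\le i\le n$ the $(n-i)$-dimensional space of $\varphi_n([x:y])$ has as basis the vectors $$\Big(\underbrace{0,\dots,0}_{k},x^i,\tbinom i1x^{i-1}y,\dots,\tbinom i{i-1}xy^{i-1},y^i,0,\dots,0\Big)^T,\qquad 0\le k\le n-i-1.$$ **Theorem.** Let $\varphi:P(\mathbb C^2)\to\mathcal F(\mathbb C^n)$ be a measurable map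 sending almost every maximal $4$-tuple in $P(\mathbb C^2)$ to a maximal $4$-tuple in $\mathcal F(\mathbb C^n)$. Then there exists $g\in\mathrm{PSL}(n,\mathbb C)$ such that $\varphi=g\cdot\varphi_n$ almost everywhere on $P(\mathbb C^2)$ (with respect to the Lebesgue measure class). -/

import Mathlib

open scoped LinearAlgebra.Projectivization
open MeasureTheory

/-! ### The complex projective line `P(ℂ²)` -/

/-- The projective line `P(ℂ²)`, identified with the boundary of hyperbolic `3`-space. -/
abbrev PC2 : Type := ℙ ℂ (Fin 2 → ℂ)

/-- The quotient topology of `ℂ² ∖ {0} → P(ℂ²)`. -/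
noncomputable instance PC2.instTopologicalSpace : TopologicalSpace PC2 :=
  TopologicalSpace.coinduced (Projectivization.mk' ℂ) inferInstance

noncomputable instance PC2.instMeasurableSpace : MeasurableSpace PC2 := borel PC2

instance PC2.instBorelSpace : BorelSpace PC2 := ⟨rfl⟩

/-- The affine chart `z ↦ [z : 1]` of the projective line; it misses only the point `[1 : 0]`. -/
noncomputable def PC2.chart (z : ℂ) : PC2 :=
  Projectivization.mk ℂ ![z, 1] (fun h => one_ne_zero (congrFun h 1))

theorem PC2.continuous_chart : Continuous PC2.chart := by
  have h : Continuous (fun z : ℂ => (⟨![z, 1], fun h => one_ne_zero (congrFun h 1)⟩ :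
      {v : Fin 2 → ℂ // v ≠ 0})) := by
    refine Continuous.subtype_mk ?_ _
    refine continuous_pi fun i => ?_
    fin_cases i
    · exact continuous_id
    · exact continuous_const
  exact continuous_coinduced_rng.comp h

/-- Lebesgue measure on `P(ℂ²)`, that is, on `ℂ ⊂ ℂ ∪ {∞} = P(ℂ²)`. It lies in the smooth measure
class of the sphere, so "almost everywhere on `P(ℂ²)`" refers to it. -/
noncomputable def PC2.measure : Measure PC2 := Measure.map PC2.chart volume

/-! ### Signed hyperbolic volume of ideal tetrahedra -/

/-- The point of the unit sphere of `ℝ³` (the boundary of the projective ball model of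
hyperbolic space) given by a nonzero vector `(x, y)` of `ℂ²`:
`(2 Re (x ȳ), 2 Im (x ȳ), |x|² - |y|²) / (|x|² + |y|²)`. -/
noncomputable def sphereVec (v : Fin 2 → ℂ) : EuclideanSpace ℝ (Fin 3) :=
  (‖v 0‖ ^ 2 + ‖v 1‖ ^ 2)⁻¹ •
    !₂[2 * (v 0 * star (v 1)).re, 2 * (v 0 * star (v 1)).im, ‖v 0‖ ^ 2 - ‖v 1‖ ^ 2]

theorem sphereVec_smul (a : ℂ) (ha : a ≠ 0) (v : Fin 2 → ℂ) :
    sphereVec (a • v) = sphereVec v := by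
  have h : ‖a‖ ^ 2 ≠ 0 := pow_ne_zero 2 (norm_ne_zero_iff.mpr ha)
  have h1 : a * v 0 * star (a * v 1) = ((‖a‖ ^ 2 : ℝ) : ℂ) * (v 0 * star (v 1)) := by
    have := Complex.mul_conj' a
    rw [star_mul]
    push_cast
    rw [← this]
    simp only [RCLike.star_def]
    ring
  have h2 : (‖a * v 0‖ ^ 2 + ‖a * v 1‖ ^ 2)⁻¹ = (‖a‖ ^ 2)⁻¹ * (‖v 0‖ ^ 2 + ‖v 1‖ ^ 2)⁻¹ := by
    rw [norm_mul, norm_mul, ← mul_inv]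
    ring_nf
  have h3 : ‖a * v 0‖ ^ 2 - ‖a * v 1‖ ^ 2 = ‖a‖ ^ 2 * (‖v 0‖ ^ 2 - ‖v 1‖ ^ 2) := by
    rw [norm_mul, norm_mul]; ring
  unfold sphereVec
  simp only [Pi.smul_apply, smul_eq_mul]
  rw [h1, h2, h3, Complex.re_ofReal_mul, Complex.im_ofReal_mul]
  ext i
  fin_cases i <;> simp <;> field_simp

/-- The homeomorphism of `P(ℂ²)` with the unit sphere of `ℝ³`, for which the action of
`SL(2, ℂ)` extends to the ball by orientation-preserving isometries of the projective model. -/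
noncomputable def PC2.toSphere : PC2 → EuclideanSpace ℝ (Fin 3) :=
  Projectivization.lift (fun v => sphereVec v.1) (by
    rintro ⟨v, hv⟩ ⟨w, hw⟩ a (h : v = a • w)
    have ha : a ≠ 0 := by
      rintro rfl
      exact hv (by simpa using h)
    change sphereVec v = sphereVec w
    rw [h, sphereVec_smul a ha])

/-- The orientation sign of four points of `ℝ³`, zero when they are coplanar, normalised so that
the ideal points `(∞, 0, 1, z)` with `Im z > 0` have sign `1`. -/
noncomputable def orientSign (p : Fin 4 → EuclideanSpace ℝ (Fin 3)) : ℝ :=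
  (SignType.sign (Matrix.of fun i j : Fin 3 => p 0 j - p i.succ j).det : ℝ)

/-- The signed hyperbolic volume of the ideal tetrahedron with vertices `ξ 0, …, ξ 3`, computed
in the projective (Klein) model: geodesic simplices in the open unit ball of `ℝ³` are Euclidean
simplices, and the volume element of curvature `-1` is `dx / (1 - |x|²)²`. -/
noncomputable def volH3 (ξ : Fin 4 → PC2) : ℝ :=
  orientSign (fun i => (ξ i).toSphere) *
    ∫ x in convexHull ℝ (Set.range fun i => (ξ i).toSphere), ((1 - ‖x‖ ^ 2) ^ 2)⁻¹

/-- The volume `v₃` of a maximal ideal tetrahedron in hyperbolic `3`-space. -/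
noncomputable def v3 : ℝ := sSup (Set.range volH3)

/-- The extension of `volH3` to four vectors in a complex vector space `V`: it is
`volH3` of the lines spanned by the vectors (after any identification `V ≃ ℂ²`) if `V` is
`2`-dimensional and the vectors are nonzero, and `0` otherwise. -/
noncomputable def volConf (V : Type*) [AddCommGroup V] [Module ℂ V] [FiniteDimensional ℂ V]
    (x : Fin 4 → V) : ℝ :=
  open Classical in
  if h : Module.finrank ℂ V = 2 ∧ ∀ i, x i ≠ 0 then
    volH3 fun i => Projectivization.mk ℂ
      (LinearEquiv.ofFinrankEq (R := ℂ) V (Fin 2 → ℂ) (by simpa using h.1) (x i))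
      ((LinearEquiv.map_ne_zero_iff _).mpr (h.2 i))
  else 0

/-! ### Complete flags and the invariant `B_n` -/

/-- Complete flags `F⁰ ⊂ F¹ ⊂ … ⊂ Fⁿ` in `ℂⁿ`. -/
@[ext]
structure CompleteFlag (n : ℕ) where
  space : Fin (n + 1) → Submodule ℂ (Fin n → ℂ)
  mono : Monotone space
  finrank_space : ∀ j, Module.finrank ℂ (space j) = j

/-- Affine flags: a flag with vectors `v¹, …, vⁿ` such that `Fʲ = ℂ vʲ + Fʲ⁻¹`;
here `vec j` is `vʲ⁺¹`, for `0 ≤ j < n`. -/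
structure AffineFlag (n : ℕ) extends CompleteFlag n where
  vec : Fin n → (Fin n → ℂ)
  space_succ : ∀ j : Fin n, space j.succ = (ℂ ∙ vec j) ⊔ space j.castSucc

theorem AffineFlag.vec_mem {n : ℕ} (A : AffineFlag n) (j : Fin n) :
    A.vec j ∈ A.space j.succ := by
  rw [A.space_succ]
  exact Submodule.mem_sup_left (Submodule.mem_span_singleton_self _)

theorem CompleteFlag.exists_affineFlag {n : ℕ} (F : CompleteFlag n) :
    ∃ A : AffineFlag n, A.toCompleteFlag = F := by
  have h : ∀ j : Fin n, ∃ v : Fin n → ℂ, F.space j.succ = (ℂ ∙ v) ⊔ F.space j.castSucc := by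
    intro j
    have hle : F.space j.castSucc ≤ F.space j.succ := F.mono (Fin.castSucc_lt_succ).le
    have hlt : F.space j.castSucc < F.space j.succ := by
      refine lt_of_le_of_ne hle fun he => ?_
      have h1 := F.finrank_space j.castSucc
      have h2 := F.finrank_space j.succ
      rw [he] at h1
      simp at h1 h2
      omega
    obtain ⟨v, hv, hv'⟩ := SetLike.exists_of_lt hlt
    refine ⟨v, (Submodule.eq_of_le_of_finrank_le ?_ ?_).symm⟩
    · exact sup_le ((Submodule.span_singleton_le_iff_mem _ _).mpr hv) hle
    · have hlt' : F.space j.castSucc < (ℂ ∙ v) ⊔ F.space j.castSucc := by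
        refine lt_of_le_of_ne le_sup_right fun he => hv' ?_
        rw [he]
        exact Submodule.mem_sup_left (Submodule.mem_span_singleton_self _)
      have h3 := Submodule.finrank_lt_finrank_of_lt hlt'
      have h1 := F.finrank_space j.castSucc
      have h2 := F.finrank_space j.succ
      simp at h1 h2
      omega
  choose v hv using h
  exact ⟨⟨F, v, hv⟩, rfl⟩

/-- The sum over `0 ≤ j₀, …, j₃ ≤ n - 1` of the volumes of the configurations
`(v₀^{j₀+1}, …, v₃^{j₃+1})` in `⟨F₀^{j₀+1}, …, F₃^{j₃+1}⟩ / ⟨F₀^{j₀}, …, F₃^{j₃}⟩`. -/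
noncomputable def affineB {n : ℕ} (A : Fin 4 → AffineFlag n) : ℝ :=
  ∑ J : Fin 4 → Fin n,
    volConf
      ((⨆ i, (A i).space (J i).succ : Submodule ℂ (Fin n → ℂ)) ⧸
        (⨆ i, (A i).space (J i).castSucc : Submodule ℂ (Fin n → ℂ)).submoduleOf
          (⨆ i, (A i).space (J i).succ))
      (fun i => Submodule.Quotient.mk
        ⟨(A i).vec (J i), Submodule.mem_iSup_of_mem i ((A i).vec_mem (J i))⟩)

/-- The invariant `B_n` of four complete flags: the value of `affineB` on affine flags above them.
It does not depend on the choice of these, since the volume depends only on the lines spanned by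
the vectors. -/
noncomputable def borelB {n : ℕ} (F : Fin 4 → CompleteFlag n) : ℝ :=
  affineB fun i => (F i).exists_affineFlag.choose

/-! ### Topology of the flag manifold and action of `PSL(n, ℂ)` -/

/-- The orthogonal projection of `ℂⁿ` onto the subspace `Fʲ` of a flag, with the standard
Hermitian inner product. -/
noncomputable def CompleteFlag.proj {n : ℕ} (F : CompleteFlag n) (j : Fin (n + 1)) :
    EuclideanSpace ℂ (Fin n) →L[ℂ] EuclideanSpace ℂ (Fin n) :=
  ((F.space j).comap (WithLp.linearEquiv 2 ℂ (Fin n → ℂ)).toLinearMap).starProjection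

/-- The usual topology of the flag manifold, as a subspace of a product of Grassmannians, which
are embedded in spaces of matrices by `W ↦` orthogonal projection onto `W`. -/
noncomputable instance CompleteFlag.instTopologicalSpace (n : ℕ) :
    TopologicalSpace (CompleteFlag n) :=
  TopologicalSpace.induced CompleteFlag.proj inferInstance

noncomputable instance CompleteFlag.instMeasurableSpace (n : ℕ) :
    MeasurableSpace (CompleteFlag n) := borel _

instance CompleteFlag.instBorelSpace (n : ℕ) : BorelSpace (CompleteFlag n) := ⟨rfl⟩

/-- The action of `SL(n, ℂ)` on complete flags. -/
noncomputable instance CompleteFlag.instMulActionSL (n : ℕ) :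
    MulAction (Matrix.SpecialLinearGroup (Fin n) ℂ) (CompleteFlag n) where
  smul g F :=
    { space := fun j => (F.space j).map (Matrix.SpecialLinearGroup.toLin' g).toLinearMap
      mono := fun _ _ h => Submodule.map_mono (F.mono h)
      finrank_space := fun j => by
        rw [LinearEquiv.finrank_map_eq]
        exact F.finrank_space j }
  one_smul F := by
    refine CompleteFlag.ext (funext fun j => ?_)
    change (F.space j).map _ = _
    simp
  mul_smul g h F := by
    refine CompleteFlag.ext (funext fun j => ?_)
    change (F.space j).map _ = ((F.space j).map _).map _
    rw [← Submodule.map_comp]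
    congr 1
    refine LinearMap.ext fun v => ?_
    simp

theorem CompleteFlag.center_smul {n : ℕ} (g : Matrix.SpecialLinearGroup (Fin n) ℂ)
    (hg : g ∈ Subgroup.center (Matrix.SpecialLinearGroup (Fin n) ℂ)) (F : CompleteFlag n) :
    g • F = F := by
  obtain ⟨r, hr, hg⟩ := Matrix.SpecialLinearGroup.mem_center_iff.mp hg
  refine CompleteFlag.ext (funext fun j => ?_)
  change (F.space j).map _ = _
  have hle : (F.space j).map (Matrix.SpecialLinearGroup.toLin' g).toLinearMap ≤ F.space j := by
    rintro _ ⟨v, hv, rfl⟩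
    have h : (Matrix.SpecialLinearGroup.toLin' g).toLinearMap v = r • v := by
      change Matrix.toLin' g.1 v = r • v
      rw [← hg]
      ext l
      simp
    rw [h]
    exact (F.space j).smul_mem r hv
  refine Submodule.eq_of_le_of_finrank_eq hle ?_
  rw [LinearEquiv.finrank_map_eq]

/-- The action of `PSL(n, ℂ)`, the quotient of `SL(n, ℂ)` by its center, on complete flags. -/
noncomputable instance CompleteFlag.instMulActionPSL (n : ℕ) :
    MulAction (Matrix.ProjectiveSpecialLinearGroup (Fin n) ℂ) (CompleteFlag n) :=
  MulAction.compHom (CompleteFlag n)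
    (QuotientGroup.lift (Subgroup.center (Matrix.SpecialLinearGroup (Fin n) ℂ))
      (MulAction.toPermHom (Matrix.SpecialLinearGroup (Fin n) ℂ) (CompleteFlag n))
      (fun g hg => Equiv.ext fun F => CompleteFlag.center_smul g hg F))

theorem CompleteFlag.coe_smul {n : ℕ} (g : Matrix.SpecialLinearGroup (Fin n) ℂ)
    (F : CompleteFlag n) :
    (g : Matrix.ProjectiveSpecialLinearGroup (Fin n) ℂ) • F = g • F := rfl

/-! ### The Veronese embedding -/

/-- The vector `(0, …, 0, xⁱ, C(i,1) xⁱ⁻¹ y, …, C(i,i) yⁱ, 0, …, 0)` of `ℂⁿ` with `k` leading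
zeros, for `v = (x, y)`. -/
noncomputable def veroneseVec (n : ℕ) (v : Fin 2 → ℂ) (i k : ℕ) : Fin n → ℂ := fun l =>
  if k ≤ (l : ℕ) then
    (i.choose (l - k) : ℂ) * v 0 ^ (i - (l - k)) * v 1 ^ ((l : ℕ) - k)
  else 0

/-- The `m`-dimensional space of the Veronese flag, with basis the vectors `veroneseVec` for
`i = n - m` and `k = 0, …, m - 1`. -/
noncomputable def veroneseSpace (n : ℕ) (v : Fin 2 → ℂ) (m : ℕ) : Submodule ℂ (Fin n → ℂ) :=
  Submodule.span ℂ (Set.range fun k : Fin m => veroneseVec n v (n - m) k)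

theorem veroneseVec_smul (n : ℕ) (a : ℂ) (v : Fin 2 → ℂ) (i k : ℕ) :
    veroneseVec n (a • v) i k = a ^ i • veroneseVec n v i k := by
  ext l
  simp only [veroneseVec, Pi.smul_apply, smul_eq_mul]
  split_ifs with h
  · rcases le_or_gt ((l : ℕ) - k) i with h1 | h1
    · have h2 : a ^ i = a ^ (i - ((l : ℕ) - k)) * a ^ ((l : ℕ) - k) := by
        rw [← pow_add, Nat.sub_add_cancel h1]
      rw [h2, mul_pow, mul_pow]
      ring
    · simp [Nat.choose_eq_zero_of_lt h1]
  · simp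

theorem veroneseSpace_smul (n : ℕ) (a : ℂ) (ha : a ≠ 0) (v : Fin 2 → ℂ) (m : ℕ) :
    veroneseSpace n (a • v) m = veroneseSpace n v m := by
  have key : ∀ (b : ℂ) (w : Fin 2 → ℂ), veroneseSpace n (b • w) m ≤ veroneseSpace n w m := by
    intro b w
    refine Submodule.span_le.mpr ?_
    rintro _ ⟨k, rfl⟩
    change veroneseVec n (b • w) (n - m) k ∈ _
    rw [veroneseVec_smul]
    exact Submodule.smul_mem _ _ (Submodule.subset_span ⟨k, rfl⟩)
  refine le_antisymm (key a v) ?_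
  have h := key a⁻¹ (a • v)
  rwa [smul_smul, inv_mul_cancel₀ ha, one_smul] at h

theorem veroneseVec_succ (n : ℕ) (v : Fin 2 → ℂ) (i k : ℕ) :
    veroneseVec n v (i + 1) k = v 0 • veroneseVec n v i k + v 1 • veroneseVec n v i (k + 1) := by
  ext l
  simp only [veroneseVec, Pi.smul_apply, Pi.add_apply, smul_eq_mul]
  rcases lt_trichotomy (l : ℕ) k with h | h | h
  · have h1 : ¬ k ≤ (l : ℕ) := by omega
    have h2 : ¬ k + 1 ≤ (l : ℕ) := by omega
    simp [h1, h2]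
  · simp [h, pow_succ, mul_comm]
  · obtain ⟨e, he⟩ := Nat.exists_eq_add_of_lt h
    have h1 : k ≤ (l : ℕ) := by omega
    have h2 : k + 1 ≤ (l : ℕ) := by omega
    have h3 : (l : ℕ) - k = e + 1 := by omega
    have h4 : (l : ℕ) - (k + 1) = e := by omega
    rw [if_pos h1, if_pos h1, if_pos h2, h3, h4, Nat.add_sub_add_right, Nat.choose_succ_succ]
    rcases Nat.lt_or_ge e i with h5 | h5
    · have h6 : i - e = (i - (e + 1)) + 1 := by omega
      rw [h6]
      push_cast
      ring
    · rw [Nat.choose_eq_zero_of_lt (show i < e + 1 by omega)]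
      push_cast
      ring

theorem finrank_veroneseSpace (n : ℕ) (v : Fin 2 → ℂ) (hv : v ≠ 0) (m : ℕ) (hm : m ≤ n) :
    Module.finrank ℂ (veroneseSpace n v m) = m := by
  suffices h : LinearIndependent ℂ fun k : Fin m => veroneseVec n v (n - m) k by
    exact (finrank_span_eq_card h).trans (Fintype.card_fin m)
  have hv' : v 0 ≠ 0 ∨ v 1 ≠ 0 := by
    by_contra! h
    exact hv (by ext l; fin_cases l <;> simp [h.1, h.2])
  rcases hv' with hx | hy
  · let e : Fin m → Fin n := fun l => ⟨l, by omega⟩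
    refine LinearIndependent.of_comp (LinearMap.funLeft ℂ ℂ e) ?_
    let M : Matrix (Fin m) (Fin m) ℂ := Matrix.of fun k l => veroneseVec n v (n - m) k (e l)
    change LinearIndependent ℂ M.row
    refine Matrix.linearIndependent_rows_of_det_ne_zero (A := M) ?_
    rw [Matrix.det_of_isUpperTriangular]
    · refine Finset.prod_ne_zero_iff.mpr fun k _ => ?_
      simp [M, e, veroneseVec, hx]
    · intro k l (hkl : l < k)
      have h : ¬ (k : ℕ) ≤ (l : ℕ) := not_le.mpr hkl
      exact if_neg h
  · let e : Fin m → Fin n := fun l => ⟨l + (n - m), by omega⟩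
    refine LinearIndependent.of_comp (LinearMap.funLeft ℂ ℂ e) ?_
    let M : Matrix (Fin m) (Fin m) ℂ := Matrix.of fun k l => veroneseVec n v (n - m) k (e l)
    change LinearIndependent ℂ M.row
    refine Matrix.linearIndependent_rows_of_det_ne_zero (A := M) ?_
    rw [Matrix.det_of_isLowerTriangular]
    · refine Finset.prod_ne_zero_iff.mpr fun k _ => ?_
      simp [M, e, veroneseVec, hy]
    · intro k l (hkl : k < l)
      have h : n - m < (l : ℕ) + (n - m) - k := by
        have : (k : ℕ) < l := hkl
        omega
      simp [M, e, veroneseVec, Nat.choose_eq_zero_of_lt h]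

theorem veroneseSpace_mono (n : ℕ) (v : Fin 2 → ℂ) (m m' : ℕ) (h : m ≤ m') (h' : m' ≤ n) :
    veroneseSpace n v m ≤ veroneseSpace n v m' := by
  induction m', h using Nat.le_induction with
  | base => exact le_rfl
  | succ p hp ih =>
    refine (ih (by omega)).trans (Submodule.span_le.mpr ?_)
    rintro _ ⟨k, rfl⟩
    change veroneseVec n v (n - p) k ∈ _
    have h1 : n - p = (n - (p + 1)) + 1 := by omega
    rw [h1, veroneseVec_succ]
    refine Submodule.add_mem _ (Submodule.smul_mem _ _ (Submodule.subset_span ?_))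
      (Submodule.smul_mem _ _ (Submodule.subset_span ?_))
    · exact ⟨⟨k, by omega⟩, rfl⟩
    · exact ⟨⟨k + 1, by omega⟩, rfl⟩

/-- The Veronese flag of a nonzero vector of `ℂ²`. -/
noncomputable def veroneseFlag (n : ℕ) (v : Fin 2 → ℂ) (hv : v ≠ 0) : CompleteFlag n where
  space m := veroneseSpace n v m
  mono := fun _ m' h => veroneseSpace_mono n v _ _ h (Nat.lt_succ_iff.mp m'.2)
  finrank_space m := finrank_veroneseSpace n v hv m (Nat.lt_succ_iff.mp m.2)

/-- The Veronese embedding `φ_n : P(ℂ²) → 𝓕(ℂⁿ)`. -/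
noncomputable def veronese (n : ℕ) : PC2 → CompleteFlag n :=
  Projectivization.lift (fun v => veroneseFlag n v.1 v.2) (by
    rintro ⟨v, hv⟩ ⟨w, hw⟩ a (h : v = a • w)
    have ha : a ≠ 0 := by
      rintro rfl
      exact hv (by simpa using h)
    refine CompleteFlag.ext (funext fun m => ?_)
    change veroneseSpace n v m = veroneseSpace n w m
    rw [h, veroneseSpace_smul n a ha])

/-! ### Maximal `4`-tuples -/

/-- Maximal `4`-tuples of points, i.e. the vertices of positively oriented regular ideal
tetrahedra. -/
def IsMaximalPoints (ξ : Fin 4 → PC2) : Prop := volH3 ξ = v3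

/-- Maximal `4`-tuples of flags. -/
def IsMaximalFlags {n : ℕ} (F : Fin 4 → CompleteFlag n) : Prop :=
  borelB F = (n : ℝ) * ((n : ℝ) ^ 2 - 1) / 6 * v3

noncomputable instance SL2C.instMeasurableSpace :
    MeasurableSpace (Matrix.SpecialLinearGroup (Fin 2) ℂ) :=
  borel _

instance SL2C.instBorelSpace : BorelSpace (Matrix.SpecialLinearGroup (Fin 2) ℂ) := ⟨rfl⟩

instance SL2C.instLocallyCompactSpace :
    LocallyCompactSpace (Matrix.SpecialLinearGroup (Fin 2) ℂ) := by
  have : LocallyCompactSpace (Matrix (Fin 2) (Fin 2) ℂ) :=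
    inferInstanceAs (LocallyCompactSpace (Fin 2 → Fin 2 → ℂ))
  exact Matrix.SpecialLinearGroup.isClosedEmbedding_val.locallyCompactSpace

/-- A property holds for almost every maximal `4`-tuple of points. The group `PSL(2, ℂ)` acts
simply transitively on the maximal `4`-tuples, and the measure class on them is that of Haar measure
under the evaluation `g ↦ g η` at a maximal `4`-tuple `η` (the choice of `η` does not matter, and
neither does passing to the double cover `SL(2, ℂ)`). -/
def AlmostEveryMaximal (P : (Fin 4 → PC2) → Prop) : Prop :=
  ∀ η : Fin 4 → PC2, IsMaximalPoints η →
    ∀ᵐ g ∂(Measure.haar : Measure (Matrix.SpecialLinearGroup (Fin 2) ℂ)), P fun i => g • η i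

open scoped Pointwise

/-! Maximality of four flags is turned into a linear-algebraic condition rigid enough to be
propagated over a dense set of points.

Volume: up to a factor 4, the volume of an ideal tetrahedron is the Lebesgue measure of a truncated
cone, which depends only on determinants of pairs of vectors of ℂ² (`volH3_mk`). Cutting the cones
over two triangles inscribed in one circle shows that moving two dihedral angles towards each other
increases the volume (`angleVolume_smoothing`). Hence `v3` is positive and is attained exactly at
the cross-ratio `hexRoot` (`volH3_mk_le`, `v3_eq`).

Flags: a term of `borelB` can be positive only at a good index, where the quotient is a plane with
four distinct lines. Dimension increments embed the good indices into the solutions of d₀ + d₁ + d₂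
+ d₃ = n - 2, of which there are n(n² - 1)/6 (`card_goodIndices_le`). For a maximal tuple the bound
is attained and every positive term equals `v3`; the equality case (`goodIndices_eq`) places the
good indices on the layer ∑ J i = n - 2. So a maximal tuple is an `IsRegularTuple`: every quotient
of that layer is a plane configuration of cross-ratio `hexRoot`.

Rigidity: three lines and the cross-ratio determine the fourth, so a regular tuple is determined by
two flags and the line of a third (`IsRegularTuple.eq_of_eq`). An adapted basis makes all such data
linearly equivalent. Therefore regular tuples form one orbit (`IsRegularTuple.exists_linearEquiv`),
and an automorphism fixing three of the flags is a scalar (`IsRegularTuple.exists_smul`). Veronese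
flags are regular (`isRegularTuple_veroneseTuple`). So on each simplex with regular image φ agrees
with h φ_n for some automorphism h, and simplices sharing a face give the same action on flags.

Measure: by Fubini there is g in SL(2, ℂ) such that, for almost every t, all regular simplices with
vertices g∞ and g(t + p), p in ℚ(ω), have regular image. Walking through triangular lattices yields
one h for all of t + ℚ(ω) (`exists_mapEquiv_of_forall_isRegularTuple`). A Steinhaus argument puts
almost every point of the graph of φ ∘ g into the closure of the graph over t + ℚ(ω)
(`ae_ae_mem_closure`). The Veronese graph is closed, so φ ∘ g = h φ_n almost everywhere, and
equivariance of φ_n removes g. -/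

/-! ### Hyperbolic volume as the measure of a truncated cone -/

/-- In the coordinates (s, s x) Lebesgue measure is s³ ds dx, and the ray over x stays below the
hyperboloid as long as s²(1 - ‖x‖²) ≤ 1. The ray thus carries a quarter of the Klein volume density
at x. -/
theorem lintegral_Ioi_cube_indicator (c : ℝ) (hc : 0 < c) :
    ∫⁻ s in Set.Ioi (0 : ℝ), Set.indicator {s : ℝ | s ^ 2 * c ≤ 1}
      (fun s => ENNReal.ofReal (s ^ 3)) s = ENNReal.ofReal ((4 : ℝ)⁻¹ * (c ^ 2)⁻¹) := by
  have hsq : Real.sqrt c⁻¹ ^ 2 = c⁻¹ := Real.sq_sqrt (by positivity)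
  have hset : Set.Ioi (0 : ℝ) ∩ {s : ℝ | s ^ 2 * c ≤ 1} = Set.Ioc 0 (Real.sqrt c⁻¹) := by
    ext s
    simp only [Set.mem_inter_iff, Set.mem_Ioi, Set.mem_ofPred_eq, Set.mem_Ioc]
    refine and_congr_right fun hs => ?_
    rw [Real.le_sqrt hs.le (by positivity), ← le_div_iff₀ hc, one_div]
  have hm : MeasurableSet {s : ℝ | s ^ 2 * c ≤ 1} :=
    (isClosed_le (by fun_prop) continuous_const).measurableSet
  rw [← lintegral_indicator measurableSet_Ioi, Set.indicator_indicator, hset,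
    lintegral_indicator measurableSet_Ioc,
    ← ofReal_integral_eq_lintegral_ofReal]
  · rw [← intervalIntegral.integral_of_le (Real.sqrt_nonneg _), integral_pow]
    congr 1
    have : Real.sqrt c⁻¹ ^ (3 + 1) = (Real.sqrt c⁻¹ ^ 2) ^ 2 := by ring
    rw [this, hsq]
    norm_num
    ring
  · exact ((continuous_pow 3).integrableOn_Icc).mono_set Set.Ioc_subset_Icc_self
  · refine (ae_restrict_iff' measurableSet_Ioc).mpr (ae_of_all _ fun s hs => ?_)
    exact pow_nonneg hs.1.le 3

/-- The hyperbolic volume of a subset of the projective ball model, as the Lebesgue measure of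
the part of the cone over it below the unit hyperboloid. -/
theorem lintegral_klein_eq_cone (S : Set (EuclideanSpace ℝ (Fin 3))) (hS : MeasurableSet S)
    (hball : ∀ x ∈ S, ‖x‖ ≤ 1) :
    ∫⁻ x in S, ENNReal.ofReal ((1 - ‖x‖ ^ 2) ^ 2)⁻¹ =
      4 * volume {w : ℝ × EuclideanSpace ℝ (Fin 3) |
        0 < w.1 ∧ w.1⁻¹ • w.2 ∈ S ∧ w.1 ^ 2 - ‖w.2‖ ^ 2 ≤ 1} := by
  set C : Set (ℝ × EuclideanSpace ℝ (Fin 3)) := {w | 0 < w.1 ∧ w.1⁻¹ • w.2 ∈ S ∧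
    w.1 ^ 2 - ‖w.2‖ ^ 2 ≤ 1} with hC
  have hCm : MeasurableSet C := by
    refine (measurableSet_lt measurable_const measurable_fst).inter (MeasurableSet.inter ?_ ?_)
    · have hm : Measurable fun w : ℝ × EuclideanSpace ℝ (Fin 3) => w.1⁻¹ • w.2 :=
        measurable_fst.inv.smul measurable_snd
      exact hm hS
    · exact (isClosed_le (f := fun w : ℝ × EuclideanSpace ℝ (Fin 3) => w.1 ^ 2 - ‖w.2‖ ^ 2)
        (by fun_prop) continuous_const).measurableSet
  let T : ℝ → Set (EuclideanSpace ℝ (Fin 3)) := fun s => {x | s ^ 2 * (1 - ‖x‖ ^ 2) ≤ 1}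
  have hTm : ∀ s, MeasurableSet (T s) := fun s =>
    (isClosed_le (f := fun x : EuclideanSpace ℝ (Fin 3) => s ^ 2 * (1 - ‖x‖ ^ 2)) (by fun_prop)
      continuous_const).measurableSet
  -- The slice at height s is a dilate by s of part of S; the Jacobian is s³ in dimension three.
  have hslice : ∀ s : ℝ, volume (Prod.mk s ⁻¹' C) =
      Set.indicator (Set.Ioi 0) (fun s => ENNReal.ofReal (s ^ 3) * volume (S ∩ T s)) s := by
    intro s
    by_cases hs : 0 < s
    · rw [Set.indicator_of_mem (by exact hs)]
      have : Prod.mk s ⁻¹' C = s • (S ∩ T s) := by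
        ext y
        rw [Set.mem_smul_set_iff_inv_smul_mem₀ hs.ne']
        simp only [hC, Set.mem_preimage, Set.mem_ofPred_eq, Set.mem_inter_iff, T, hs, true_and,
          norm_smul, norm_inv, Real.norm_eq_abs, abs_of_pos hs]
        refine and_congr_right fun _ => ?_
        have : s ^ 2 * (1 - (s⁻¹ * ‖y‖) ^ 2) = s ^ 2 - ‖y‖ ^ 2 := by field_simp
        rw [this]
      rw [this, Measure.addHaar_smul]
      simp [abs_of_pos hs]
    · rw [Set.indicator_of_notMem (by exact hs)]
      have : Prod.mk s ⁻¹' C = ∅ := by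
        ext y; simp [hC, hs]
      rw [this, measure_empty]
  have hvol : volume C = ∫⁻ s in Set.Ioi (0 : ℝ), ∫⁻ x in S,
      Set.indicator {s : ℝ | s ^ 2 * (1 - ‖x‖ ^ 2) ≤ 1} (fun s => ENNReal.ofReal (s ^ 3)) s := by
    rw [Measure.volume_eq_prod, Measure.prod_apply hCm]
    simp_rw [hslice]
    rw [lintegral_indicator measurableSet_Ioi]
    refine lintegral_congr fun s => ?_
    have : ∀ x : EuclideanSpace ℝ (Fin 3), Set.indicator {s : ℝ | s ^ 2 * (1 - ‖x‖ ^ 2) ≤ 1}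
        (fun s => ENNReal.ofReal (s ^ 3)) s =
        Set.indicator (T s) (fun _ => ENNReal.ofReal (s ^ 3)) x := by
      intro x; simp only [Set.indicator, T, Set.mem_ofPred_eq]
    simp_rw [this]
    rw [lintegral_indicator (hTm s), lintegral_const, Measure.restrict_restrict (hTm s),
      Measure.restrict_apply_univ, Set.inter_comm]
  have hjm : Measurable (Function.uncurry fun (s : ℝ) (x : EuclideanSpace ℝ (Fin 3)) =>
      Set.indicator {s : ℝ | s ^ 2 * (1 - ‖x‖ ^ 2) ≤ 1} (fun s => ENNReal.ofReal (s ^ 3)) s) := by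
    have : (Function.uncurry fun (s : ℝ) (x : EuclideanSpace ℝ (Fin 3)) =>
        Set.indicator {s : ℝ | s ^ 2 * (1 - ‖x‖ ^ 2) ≤ 1} (fun s => ENNReal.ofReal (s ^ 3)) s) =
        Set.indicator {p : ℝ × EuclideanSpace ℝ (Fin 3) | p.1 ^ 2 * (1 - ‖p.2‖ ^ 2) ≤ 1}
          (fun p => ENNReal.ofReal (p.1 ^ 3)) := by
      ext ⟨s, x⟩; simp only [Function.uncurry, Set.indicator, Set.mem_ofPred_eq]
    rw [this]
    exact Measurable.indicator (by fun_prop) (measurableSet_le (by fun_prop) measurable_const)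
  rw [hvol, lintegral_lintegral_swap hjm.aemeasurable, ← lintegral_const_mul']
  swap
  · norm_num
  -- On the unit sphere the density has the default value 0 while the ray integral diverges; the
  -- sphere is null.
  have hsphere : ∀ᵐ x : EuclideanSpace ℝ (Fin 3), ‖x‖ ≠ 1 := by
    have := Measure.addHaar_sphere (volume : Measure (EuclideanSpace ℝ (Fin 3))) 0 1
    rw [measure_eq_zero_iff_ae_notMem] at this
    filter_upwards [this] with x hx
    simpa using hx
  refine lintegral_congr_ae ?_
  rw [Filter.EventuallyEq, ae_restrict_iff' hS]
  filter_upwards [hsphere] with x hx hxS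
  have h1 : ‖x‖ < 1 := lt_of_le_of_ne (hball x hxS) hx
  have h2 : 0 < 1 - ‖x‖ ^ 2 := by nlinarith [norm_nonneg x]
  rw [lintegral_Ioi_cube_indicator _ h2]
  rw [show (4 : ENNReal) = ENNReal.ofReal 4 by simp, ← ENNReal.ofReal_mul (by norm_num)]
  congr 1
  ring

/-- The part below the unit hyperboloid of the cone spanned by four lightlike vectors with Gram
matrix half of `g`, in the coordinates given by these vectors. -/
def simplexRegion (g01 g02 g03 g12 g13 g23 : ℝ) : Set (Fin 4 → ℝ) :=
  {s | (∀ i, 0 ≤ s i) ∧ g01 * (s 0 * s 1) + g02 * (s 0 * s 2) + g03 * (s 0 * s 3)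
    + g12 * (s 1 * s 2) + g13 * (s 1 * s 3) + g23 * (s 2 * s 3) ≤ 1}

/-- Lightlike lifts of points of the unit sphere, as rows of a matrix. -/
def liftMatrix (p : Fin 4 → EuclideanSpace ℝ (Fin 3)) : Matrix (Fin 4) (Fin 4) ℝ :=
  Matrix.of fun i => ![1, p i 0, p i 1, p i 2]

/-- Row operations on the lifts (1, pᵢ) leave the differences of the points, so the Jacobian of the
cone coordinates is, up to sign, the determinant that defines the orientation. -/
theorem det_liftMatrix (p : Fin 4 → EuclideanSpace ℝ (Fin 3)) :
    (liftMatrix p).det = - (Matrix.of fun i j : Fin 3 => p 0 j - p i.succ j).det := by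
  rw [Matrix.det_fin_three]
  simp [liftMatrix, Matrix.det_succ_row_zero, Fin.sum_univ_succ, Fin.succAbove]
  ring

theorem mem_convexHull_range_iff {E : Type*} [AddCommGroup E] [Module ℝ E] {ι : Type*} [Fintype ι]
    (p : ι → E) (x : E) : x ∈ convexHull ℝ (Set.range p) ↔
      ∃ w : ι → ℝ, (∀ i, 0 ≤ w i) ∧ ∑ i, w i = 1 ∧ ∑ i, w i • p i = x := by
  classical
  constructor
  · intro hx
    have h : convexHull ℝ (Set.range p) ⊆ {x | ∃ w : ι → ℝ, (∀ i, 0 ≤ w i) ∧ ∑ i, w i = 1 ∧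
        ∑ i, w i • p i = x} := by
      refine convexHull_min ?_ ?_
      · rintro _ ⟨i, rfl⟩
        exact ⟨Pi.single i 1, fun j => by by_cases h : j = i <;> simp [h],
          by simp, by simp [Pi.single_apply]⟩
      · rintro _ ⟨w, hw, hw1, rfl⟩ _ ⟨w', hw', hw1', rfl⟩ a b ha hb hab
        refine ⟨fun i => a * w i + b * w' i, fun i => ?_, ?_, ?_⟩
        · have := hw i; have := hw' i; positivity
        · rw [Finset.sum_add_distrib, ← Finset.mul_sum, ← Finset.mul_sum, hw1, hw1']; linarith
        · simp only [add_smul, mul_smul, Finset.sum_add_distrib, Finset.smul_sum]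
    exact h hx
  · rintro ⟨w, hw, hw1, rfl⟩
    exact (convex_convexHull ℝ _).sum_mem (fun i _ => hw i) hw1
      fun i _ => subset_convexHull ℝ _ ⟨i, rfl⟩

/-- The cone over the simplex is the image of the positive orthant under the matrix with the
lightlike lifts as columns; the Minkowski form pulls back to a form without squares. -/
theorem volume_cone_eq (p : Fin 4 → EuclideanSpace ℝ (Fin 3)) (hp : ∀ i, ‖p i‖ = 1) :
    volume {w : ℝ × EuclideanSpace ℝ (Fin 3) | 0 < w.1 ∧
        w.1⁻¹ • w.2 ∈ convexHull ℝ (Set.range p) ∧ w.1 ^ 2 - ‖w.2‖ ^ 2 ≤ 1} =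
      ENNReal.ofReal |(liftMatrix p).det| *
        volume (simplexRegion (‖p 0 - p 1‖ ^ 2) (‖p 0 - p 2‖ ^ 2) (‖p 0 - p 3‖ ^ 2)
          (‖p 1 - p 2‖ ^ 2) (‖p 1 - p 3‖ ^ 2) (‖p 2 - p 3‖ ^ 2)) := by
  set R := simplexRegion (‖p 0 - p 1‖ ^ 2) (‖p 0 - p 2‖ ^ 2) (‖p 0 - p 3‖ ^ 2)
          (‖p 1 - p 2‖ ^ 2) (‖p 1 - p 3‖ ^ 2) (‖p 2 - p 3‖ ^ 2) with hR
  set C := {w : ℝ × EuclideanSpace ℝ (Fin 3) | 0 < w.1 ∧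
        w.1⁻¹ • w.2 ∈ convexHull ℝ (Set.range p) ∧ w.1 ^ 2 - ‖w.2‖ ^ 2 ≤ 1} with hC
  let e : (Fin 4 → ℝ) ≃ᵐ ℝ × EuclideanSpace ℝ (Fin 3) :=
    (MeasurableEquiv.piFinSuccAbove (fun _ => ℝ) 0).trans
      ((MeasurableEquiv.refl ℝ).prodCongr (MeasurableEquiv.toLp 2 (Fin 3 → ℝ)))
  have he : MeasurePreserving e volume volume :=
    ((MeasurePreserving.id volume).prod (PiLp.volume_preserving_toLp (Fin 3))).comp
      (volume_preserving_piFinSuccAbove (fun _ => ℝ) 0)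
  let M := Matrix.toLin' (liftMatrix p).transpose
  have hMe : ∀ s, e (M s) = (∑ i, s i, ∑ i, s i • p i) := by
    intro s
    refine Prod.ext ?_ ?_
    · change (M s) 0 = _
      simp [M, liftMatrix, Matrix.mulVec, dotProduct]
    · ext k
      change (M s) k.succ = _
      fin_cases k <;>
        simp [M, liftMatrix, Matrix.mulVec, dotProduct, Finset.sum_apply, mul_comm]
  -- Since ‖pᵢ‖ = 1 the squares cancel, and the coefficient of sᵢ sⱼ is 2 - 2⟨pᵢ, pⱼ⟩ = ‖pᵢ - pⱼ‖².
  have hQ : ∀ s : Fin 4 → ℝ, (∑ i, s i) ^ 2 - ‖∑ i, s i • p i‖ ^ 2 =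
      ‖p 0 - p 1‖ ^ 2 * (s 0 * s 1) + ‖p 0 - p 2‖ ^ 2 * (s 0 * s 2)
      + ‖p 0 - p 3‖ ^ 2 * (s 0 * s 3) + ‖p 1 - p 2‖ ^ 2 * (s 1 * s 2)
      + ‖p 1 - p 3‖ ^ 2 * (s 1 * s 3) + ‖p 2 - p 3‖ ^ 2 * (s 2 * s 3) := by
    intro s
    have h1 : ∀ i, inner ℝ (p i) (p i) = 1 := fun i => by
      rw [real_inner_self_eq_norm_sq, hp]; norm_num
    simp only [← real_inner_self_eq_norm_sq, Fin.sum_univ_four, inner_add_left, inner_add_right,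
      inner_sub_left, inner_sub_right, real_inner_smul_left, real_inner_smul_right, h1]
    rw [real_inner_comm (p 0) (p 1), real_inner_comm (p 0) (p 2), real_inner_comm (p 0) (p 3),
      real_inner_comm (p 1) (p 2), real_inner_comm (p 1) (p 3), real_inner_comm (p 2) (p 3)]
    ring
  have hsub : e ⁻¹' C ⊆ M '' R := by
    intro w hw
    obtain ⟨h0, h1, h2⟩ : 0 < (e w).1 ∧ _ ∧ _ := hw
    obtain ⟨c, hc, hc1, hcs⟩ := (mem_convexHull_range_iff _ _).mp h1
    have hw : w = M ((e w).1 • c) := by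
      apply e.injective
      rw [hMe]
      refine Prod.ext ?_ ?_
      · simp [← Finset.mul_sum, hc1]
      · simp only [Pi.smul_apply, smul_eq_mul, mul_smul, ← Finset.smul_sum, hcs]
        rw [smul_inv_smul₀ h0.ne']
    refine ⟨(e w).1 • c, ⟨fun i => ?_, ?_⟩, hw.symm⟩
    · have := hc i
      simp only [Pi.smul_apply, smul_eq_mul]; positivity
    · rw [← hQ]
      rw [hw, hMe] at h2
      exact h2
  -- Only the apex is lost: it belongs to the image of the orthant but has height zero.
  have hsub' : M '' R \ {0} ⊆ e ⁻¹' C := by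
    rintro _ ⟨⟨s, ⟨hs0, hs1⟩, rfl⟩, hs⟩
    have hpos : 0 < ∑ i, s i := by
      refine lt_of_le_of_ne (Finset.sum_nonneg fun i _ => hs0 i) fun h => hs ?_
      have : s = 0 := by
        ext i
        exact (Finset.sum_eq_zero_iff_of_nonneg (fun i _ => hs0 i)).mp h.symm i (Finset.mem_univ _)
      simp [this]
    change e (M s) ∈ C
    rw [hMe]
    refine ⟨hpos, (mem_convexHull_range_iff _ _).mpr ⟨fun i => (∑ i, s i)⁻¹ * s i, fun i => ?_, ?_,
      ?_⟩, ?_⟩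
    · have := hs0 i; positivity
    · rw [← Finset.mul_sum, inv_mul_cancel₀ hpos.ne']
    · simp only [mul_smul, ← Finset.smul_sum]
    · simp only
      rw [hQ]
      exact hs1
  have himg : volume (e ⁻¹' C) = volume (M '' R) := by
    refine le_antisymm (measure_mono hsub) ?_
    rw [← measure_sdiff_null (measure_singleton (0 : Fin 4 → ℝ))]
    exact measure_mono hsub'
  rw [← he.measure_preimage_equiv, himg, Measure.addHaar_image_linearMap]
  simp [M]

theorem setIntegral_klein_simplex (p : Fin 4 → EuclideanSpace ℝ (Fin 3))
    (hp : ∀ i, ‖p i‖ = 1) :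
    ∫ x in convexHull ℝ (Set.range p), ((1 - ‖x‖ ^ 2) ^ 2)⁻¹ =
      4 * |(liftMatrix p).det| *
        (volume (simplexRegion (‖p 0 - p 1‖ ^ 2) (‖p 0 - p 2‖ ^ 2) (‖p 0 - p 3‖ ^ 2)
          (‖p 1 - p 2‖ ^ 2) (‖p 1 - p 3‖ ^ 2) (‖p 2 - p 3‖ ^ 2))).toReal := by
  have hcl : IsCompact (convexHull ℝ (Set.range p)) :=
    (Set.finite_range p).isCompact_convexHull ℝ
  have hball : ∀ x ∈ convexHull ℝ (Set.range p), ‖x‖ ≤ 1 := by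
    have : convexHull ℝ (Set.range p) ⊆ Metric.closedBall 0 1 := by
      refine convexHull_min ?_ (convex_closedBall 0 1)
      rintro _ ⟨i, rfl⟩
      simp [hp]
    intro x hx
    simpa using this hx
  rw [integral_eq_lintegral_of_nonneg_ae (ae_of_all _ fun x => by positivity)
    (by measurability), lintegral_klein_eq_cone _ hcl.isClosed.measurableSet hball,
    volume_cone_eq p hp]
  simp [ENNReal.toReal_mul, mul_assoc]

/-! ### Volume in terms of determinants of pairs of vectors -/

theorem norm_sq_add_norm_sq_pos (v : Fin 2 → ℂ) (hv : v ≠ 0) : 0 < ‖v 0‖ ^ 2 + ‖v 1‖ ^ 2 := by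
  by_contra! h
  have h0 : ‖v 0‖ ^ 2 = 0 := by nlinarith [sq_nonneg ‖v 0‖, sq_nonneg ‖v 1‖]
  have h1 : ‖v 1‖ ^ 2 = 0 := by nlinarith [sq_nonneg ‖v 0‖, sq_nonneg ‖v 1‖]
  refine hv (funext fun i => ?_)
  fin_cases i
  · simpa using h0
  · simpa using h1

theorem norm_sphereVec (v : Fin 2 → ℂ) (hv : v ≠ 0) : ‖sphereVec v‖ = 1 := by
  have h1 := (norm_sq_add_norm_sq_pos v hv).ne'
  have : ‖sphereVec v‖ ^ 2 = 1 := by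
    rw [EuclideanSpace.norm_sq_eq]
    simp only [sphereVec, Fin.sum_univ_three, PiLp.smul_apply, smul_eq_mul,
      Real.norm_eq_abs, sq_abs, Matrix.cons_val_zero, Matrix.cons_val_one, Matrix.cons_val]
    simp only [Complex.sq_norm, Complex.normSq_apply] at h1 ⊢
    simp only [RCLike.star_def, Complex.mul_re, Complex.mul_im, Complex.conj_re, Complex.conj_im]
    obtain ⟨n, hn⟩ : ∃ n, n = (v 0).re * (v 0).re + (v 0).im * (v 0).im +
      ((v 1).re * (v 1).re + (v 1).im * (v 1).im) := ⟨_, rfl⟩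
    rw [← hn] at h1 ⊢
    field_simp
    rw [hn]
    ring
  nlinarith [norm_nonneg (sphereVec v)]

/-- This makes the Gram matrix of the lifts, after rescaling, a function of the determinants of
pairs, which SL(2, ℂ) preserves. -/
theorem norm_sphereVec_sub_sq (v w : Fin 2 → ℂ) (hv : v ≠ 0) (hw : w ≠ 0) :
    ‖sphereVec v - sphereVec w‖ ^ 2 * ((‖v 0‖ ^ 2 + ‖v 1‖ ^ 2) * (‖w 0‖ ^ 2 + ‖w 1‖ ^ 2)) =
      4 * ‖v 0 * w 1 - v 1 * w 0‖ ^ 2 := by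
  have h1 := (norm_sq_add_norm_sq_pos v hv).ne'
  have h2 := (norm_sq_add_norm_sq_pos w hw).ne'
  rw [norm_sub_sq_real, norm_sphereVec v hv, norm_sphereVec w hw, PiLp.inner_apply]
  simp only [sphereVec, Fin.sum_univ_three, PiLp.smul_apply, smul_eq_mul,
    Matrix.cons_val_zero, Matrix.cons_val_one, Matrix.cons_val,
    RCLike.inner_apply, conj_trivial]
  simp only [Complex.sq_norm, Complex.normSq_apply] at h1 h2 ⊢
  simp only [RCLike.star_def, Complex.mul_re, Complex.mul_im, Complex.conj_re, Complex.conj_im,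
    Complex.sub_re, Complex.sub_im]
  obtain ⟨n, hn⟩ : ∃ n, n = (v 0).re * (v 0).re + (v 0).im * (v 0).im +
    ((v 1).re * (v 1).re + (v 1).im * (v 1).im) := ⟨_, rfl⟩
  obtain ⟨m, hm⟩ : ∃ n, n = (w 0).re * (w 0).re + (w 0).im * (w 0).im +
    ((w 1).re * (w 1).re + (w 1).im * (w 1).im) := ⟨_, rfl⟩
  rw [← hn] at h1 ⊢
  rw [← hm] at h2 ⊢
  field_simp
  rw [hn, hm]
  ring

/-- For distinct points the right side is a positive multiple of the imaginary part of the
cross-ratio, whose sign is therefore the orientation. -/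
theorem det_sphereVec_sub (v : Fin 4 → Fin 2 → ℂ) (hv : ∀ i, v i ≠ 0) :
    (Matrix.of fun i j : Fin 3 => sphereVec (v 0) j - sphereVec (v i.succ) j).det *
      ((‖v 0 0‖ ^ 2 + ‖v 0 1‖ ^ 2) * (‖v 1 0‖ ^ 2 + ‖v 1 1‖ ^ 2) * (‖v 2 0‖ ^ 2 + ‖v 2 1‖ ^ 2) *
        (‖v 3 0‖ ^ 2 + ‖v 3 1‖ ^ 2)) =
    8 * ((v 0 0 * v 2 1 - v 0 1 * v 2 0) * (v 1 0 * v 3 1 - v 1 1 * v 3 0) *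
      star ((v 0 0 * v 3 1 - v 0 1 * v 3 0) * (v 1 0 * v 2 1 - v 1 1 * v 2 0))).im := by
  have h0 := (norm_sq_add_norm_sq_pos _ (hv 0)).ne'
  have h1 := (norm_sq_add_norm_sq_pos _ (hv 1)).ne'
  have h2 := (norm_sq_add_norm_sq_pos _ (hv 2)).ne'
  have h3 := (norm_sq_add_norm_sq_pos _ (hv 3)).ne'
  have e1 : (Fin.succ 0 : Fin 4) = 1 := rfl
  have e2 : (Fin.succ 1 : Fin 4) = 2 := rfl
  have e3 : (Fin.succ 2 : Fin 4) = 3 := rfl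
  rw [Matrix.det_fin_three]
  simp only [Matrix.of_apply, e1, e2, e3, sphereVec, PiLp.smul_apply, smul_eq_mul,
    Matrix.cons_val_zero, Matrix.cons_val_one, Matrix.cons_val]
  simp only [Complex.sq_norm, Complex.normSq_apply] at h0 h1 h2 h3 ⊢
  simp only [RCLike.star_def, Complex.mul_re, Complex.mul_im, Complex.conj_re, Complex.conj_im,
    Complex.sub_re, Complex.sub_im]
  generalize (v 0 0).re = a0 at *
  generalize (v 0 0).im = b0 at *
  generalize (v 0 1).re = c0 at *
  generalize (v 0 1).im = d0 at *
  generalize (v 1 0).re = a1 at *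
  generalize (v 1 0).im = b1 at *
  generalize (v 1 1).re = c1 at *
  generalize (v 1 1).im = d1 at *
  generalize (v 2 0).re = a2 at *
  generalize (v 2 0).im = b2 at *
  generalize (v 2 1).re = c2 at *
  generalize (v 2 1).im = d2 at *
  generalize (v 3 0).re = a3 at *
  generalize (v 3 0).im = b3 at *
  generalize (v 3 1).re = c3 at *
  generalize (v 3 1).im = d3 at *
  obtain ⟨n0, hn0⟩ : ∃ n0, n0 = (a0 * a0 + b0 * b0 + (c0 * c0 + d0 * d0)) := ⟨_, rfl⟩
  obtain ⟨n1, hn1⟩ : ∃ n1, n1 = (a1 * a1 + b1 * b1 + (c1 * c1 + d1 * d1)) := ⟨_, rfl⟩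
  obtain ⟨n2, hn2⟩ : ∃ n2, n2 = (a2 * a2 + b2 * b2 + (c2 * c2 + d2 * d2)) := ⟨_, rfl⟩
  obtain ⟨n3, hn3⟩ : ∃ n3, n3 = (a3 * a3 + b3 * b3 + (c3 * c3 + d3 * d3)) := ⟨_, rfl⟩
  rw [← hn0] at h0 ⊢
  rw [← hn1] at h1 ⊢
  rw [← hn2] at h2 ⊢
  rw [← hn3] at h3 ⊢
  -- The inverse norms are cleared with opaque numerators first, so that no division is left in the
  -- polynomial identity in sixteen real variables.
  have key : ∀ x0 x1 x2 x3 y0 y1 y2 y3 z0 z1 z2 z3 : ℝ,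
    ((n0⁻¹ * x0 - n1⁻¹ * x1) * (n0⁻¹ * y0 - n2⁻¹ * y2) * (n0⁻¹ * z0 - n3⁻¹ * z3)
      - (n0⁻¹ * x0 - n1⁻¹ * x1) * (n0⁻¹ * z0 - n2⁻¹ * z2) * (n0⁻¹ * y0 - n3⁻¹ * y3)
      - (n0⁻¹ * y0 - n1⁻¹ * y1) * (n0⁻¹ * x0 - n2⁻¹ * x2) * (n0⁻¹ * z0 - n3⁻¹ * z3)
      + (n0⁻¹ * y0 - n1⁻¹ * y1) * (n0⁻¹ * z0 - n2⁻¹ * z2) * (n0⁻¹ * x0 - n3⁻¹ * x3)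
      + (n0⁻¹ * z0 - n1⁻¹ * z1) * (n0⁻¹ * x0 - n2⁻¹ * x2) * (n0⁻¹ * y0 - n3⁻¹ * y3)
      - (n0⁻¹ * z0 - n1⁻¹ * z1) * (n0⁻¹ * y0 - n2⁻¹ * y2) * (n0⁻¹ * x0 - n3⁻¹ * x3)) *
      (n0 * n1 * n2 * n3) =
      n3 * (x0 * (y1 * z2 - z1 * y2) - y0 * (x1 * z2 - z1 * x2) + z0 * (x1 * y2 - y1 * x2))
      - n2 * (x0 * (y1 * z3 - z1 * y3) - y0 * (x1 * z3 - z1 * x3) + z0 * (x1 * y3 - y1 * x3))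
      + n1 * (x0 * (y2 * z3 - z2 * y3) - y0 * (x2 * z3 - z2 * x3) + z0 * (x2 * y3 - y2 * x3))
      - n0 * (x1 * (y2 * z3 - z2 * y3) - y1 * (x2 * z3 - z2 * x3) + z1 * (x2 * y3 - y2 * x3))
      := by
    intro x0 x1 x2 x3 y0 y1 y2 y3 z0 z1 z2 z3
    field_simp
    ring
  rw [key, hn0, hn1, hn2, hn3]
  ring

theorem volume_image_matrix (M : Matrix (Fin 4) (Fin 4) ℝ) (S : Set (Fin 4 → ℝ)) :
    volume ((fun s => M.mulVec s) '' S) = ENNReal.ofReal |M.det| * volume S := by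
  have := Measure.addHaar_image_linearMap (volume : Measure (Fin 4 → ℝ)) (Matrix.toLin' M) S
  rw [LinearMap.det_toLin'] at this
  exact this

/-- Changing the lightlike representatives by positive factors multiplies the Gram entries by cᵢ cⱼ
and the coordinates by a diagonal matrix. -/
theorem volume_simplexRegion_scale (g01 g02 g03 g12 g13 g23 : ℝ) (c : Fin 4 → ℝ)
    (hc : ∀ i, 0 < c i) :
    volume (simplexRegion g01 g02 g03 g12 g13 g23) =
      ENNReal.ofReal (c 0 * c 1 * c 2 * c 3) *
        volume (simplexRegion (g01 * (c 0 * c 1)) (g02 * (c 0 * c 2)) (g03 * (c 0 * c 3))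
          (g12 * (c 1 * c 2)) (g13 * (c 1 * c 3)) (g23 * (c 2 * c 3))) := by
  have h := volume_image_matrix (Matrix.diagonal c) (simplexRegion (g01 * (c 0 * c 1))
    (g02 * (c 0 * c 2)) (g03 * (c 0 * c 3)) (g12 * (c 1 * c 2)) (g13 * (c 1 * c 3))
    (g23 * (c 2 * c 3)))
  rw [Matrix.det_diagonal, Fin.prod_univ_four, abs_of_pos] at h
  swap
  · have := hc 0; have := hc 1; have := hc 2; have := hc 3
    positivity
  rw [← h]
  congr 1
  ext s
  constructor
  · rintro ⟨h1, h2⟩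
    have h0 := (hc 0).ne'; have h1' := (hc 1).ne'; have h2' := (hc 2).ne'; have h3 := (hc 3).ne'
    refine ⟨fun i => (c i)⁻¹ * s i, ⟨fun i => ?_, ?_⟩, ?_⟩
    · have := hc i; have := h1 i; positivity
    · refine le_of_eq_of_le ?_ h2
      field_simp
    · ext i
      have := (hc i).ne'
      simp only [Matrix.mulVec_diagonal]
      field_simp
  · rintro ⟨t, ⟨h1, h2⟩, rfl⟩
    simp only [simplexRegion, Set.mem_ofPred_eq, Matrix.mulVec_diagonal]
    refine ⟨fun i => mul_nonneg (hc i).le (h1 i), le_of_eq_of_le ?_ h2⟩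
    ring

/-- The signed volume of an ideal tetrahedron in terms of the determinants of pairs of vectors of
`ℂ²` representing its vertices. -/
theorem volH3_mk (v : Fin 4 → Fin 2 → ℂ) (hv : ∀ i, v i ≠ 0) :
    volH3 (fun i => Projectivization.mk ℂ (v i) (hv i)) =
      2 * ((v 0 0 * v 2 1 - v 0 1 * v 2 0) * (v 1 0 * v 3 1 - v 1 1 * v 3 0) *
      star ((v 0 0 * v 3 1 - v 0 1 * v 3 0) * (v 1 0 * v 2 1 - v 1 1 * v 2 0))).im *
      (volume (simplexRegion (‖v 0 0 * v 1 1 - v 0 1 * v 1 0‖ ^ 2)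
        (‖v 0 0 * v 2 1 - v 0 1 * v 2 0‖ ^ 2) (‖v 0 0 * v 3 1 - v 0 1 * v 3 0‖ ^ 2)
        (‖v 1 0 * v 2 1 - v 1 1 * v 2 0‖ ^ 2) (‖v 1 0 * v 3 1 - v 1 1 * v 3 0‖ ^ 2)
        (‖v 2 0 * v 3 1 - v 2 1 * v 3 0‖ ^ 2))).toReal := by
  have hD := det_sphereVec_sub v hv
  set D := (Matrix.of fun i j : Fin 3 => sphereVec (v 0) j - sphereVec (v i.succ) j).det with hDdef
  set n : Fin 4 → ℝ := fun i => ‖v i 0‖ ^ 2 + ‖v i 1‖ ^ 2 with hn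
  have hnpos : ∀ i, 0 < n i := fun i => norm_sq_add_norm_sq_pos _ (hv i)
  have hg : ∀ i j, ‖sphereVec (v i) - sphereVec (v j)‖ ^ 2 * (n i / 2 * (n j / 2)) =
      ‖v i 0 * v j 1 - v i 1 * v j 0‖ ^ 2 := by
    intro i j
    have := norm_sphereVec_sub_sq (v i) (v j) (hv i) (hv j)
    simp only [hn]
    linarith
  -- Scaling by half of the squared norms turns squared chords into squared absolute values of
  -- determinants.
  have hvol := volume_simplexRegion_scale (‖sphereVec (v 0) - sphereVec (v 1)‖ ^ 2)
    (‖sphereVec (v 0) - sphereVec (v 2)‖ ^ 2) (‖sphereVec (v 0) - sphereVec (v 3)‖ ^ 2)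
    (‖sphereVec (v 1) - sphereVec (v 2)‖ ^ 2) (‖sphereVec (v 1) - sphereVec (v 3)‖ ^ 2)
    (‖sphereVec (v 2) - sphereVec (v 3)‖ ^ 2) (fun i => n i / 2) (fun i => by
      have := hnpos i; positivity)
  simp only [hg] at hvol
  have hL := det_liftMatrix (fun i => sphereVec (v i))
  rw [← hDdef] at hL
  change (SignType.sign D : ℝ) * ∫ x in convexHull ℝ (Set.range fun i => sphereVec (v i)),
    ((1 - ‖x‖ ^ 2) ^ 2)⁻¹ = _
  by_cases h0 : D = 0
  · rw [h0, zero_mul] at hD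
    have : ((v 0 0 * v 2 1 - v 0 1 * v 2 0) * (v 1 0 * v 3 1 - v 1 1 * v 3 0) *
      star ((v 0 0 * v 3 1 - v 0 1 * v 3 0) * (v 1 0 * v 2 1 - v 1 1 * v 2 0))).im = 0 := by
      linarith
    rw [this, h0]
    simp
  · rw [setIntegral_klein_simplex _ (fun i => norm_sphereVec _ (hv i)),
      hL, hvol, ENNReal.toReal_mul, ENNReal.toReal_ofReal, abs_neg]
    · have h1 : (SignType.sign D : ℝ) * |D| = D := sign_mul_abs D
      have h2 : D * (n 0 * n 1 * n 2 * n 3) = 8 * _ := hD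
      generalize (volume (simplexRegion _ _ _ _ _ _)).toReal = V
      generalize (SignType.sign D : ℝ) = σ at h1 ⊢
      clear_value n
      linear_combination (4 * (n 0 / 2 * (n 1 / 2) * (n 2 / 2) * (n 3 / 2)) * V) * h1 +
        (V / 4) * h2
    · have := hnpos 0; have := hnpos 1; have := hnpos 2; have := hnpos 3
      positivity

/-! ### Cones with one vertex at infinity: cutting and comparing -/

/-- The sublevel set of a quadratic form in the positive orthant whose zeroth vector is lightlike and
pairs to `1` with the others, two of which are lightlike. -/
def coneRegion (g12 g13 g23 c : ℝ) : Set (Fin 4 → ℝ) :=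
  {s | (∀ i, 0 ≤ s i) ∧ s 0 * (s 1 + s 2 + s 3) + g12 * (s 1 * s 2) + g13 * (s 1 * s 3)
    + g23 * (s 2 * s 3) + c * s 3 ^ 2 ≤ 1}

theorem measurableSet_coneRegion (g12 g13 g23 c : ℝ) :
    MeasurableSet (coneRegion g12 g13 g23 c) := by
  have h1 : IsClosed {s : Fin 4 → ℝ | ∀ i, 0 ≤ s i} := isClosed_Ici (a := (0 : Fin 4 → ℝ))
  have h2 : IsClosed {s : Fin 4 → ℝ | s 0 * (s 1 + s 2 + s 3) + g12 * (s 1 * s 2)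
      + g13 * (s 1 * s 3) + g23 * (s 2 * s 3) + c * s 3 ^ 2 ≤ 1} :=
    isClosed_le (by fun_prop) continuous_const
  exact (h1.inter h2).measurableSet

theorem coneRegion_zero (g12 g13 g23 : ℝ) :
    coneRegion g12 g13 g23 0 = simplexRegion 1 1 1 g12 g13 g23 := by
  ext s
  simp only [coneRegion, simplexRegion, Set.mem_ofPred_eq]
  refine and_congr_right fun _ => ?_
  ring_nf

theorem coneRegion_mono {g12 g13 g23 c g12' g13' g23' c' : ℝ} (h12 : g12 ≤ g12') (h13 : g13 ≤ g13')
    (h23 : g23 ≤ g23') (hc : c ≤ c') : coneRegion g12' g13' g23' c' ⊆ coneRegion g12 g13 g23 c := by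
  rintro s ⟨h0, h1⟩
  refine ⟨h0, le_trans ?_ h1⟩
  have := h0 1; have := h0 2; have := h0 3
  gcongr

/-- The matrix diag(k⁻¹, k, k, k) keeps all pairings with the zeroth vector and has determinant k²;
geometrically it is a homothety of ℂ fixing infinity. -/
theorem volume_coneRegion_scale (g12 g13 g23 c : ℝ) (k : ℝ) (hk : 0 < k) :
    volume (coneRegion g12 g13 g23 c) = ENNReal.ofReal (k ^ 2) *
      volume (coneRegion (g12 * k ^ 2) (g13 * k ^ 2) (g23 * k ^ 2) (c * k ^ 2)) := by
  have h := volume_image_matrix (Matrix.diagonal ![k⁻¹, k, k, k])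
    (coneRegion (g12 * k ^ 2) (g13 * k ^ 2) (g23 * k ^ 2) (c * k ^ 2))
  rw [Matrix.det_diagonal, Fin.prod_univ_four] at h
  have e : |![k⁻¹, k, k, k] 0 * ![k⁻¹, k, k, k] 1 * ![k⁻¹, k, k, k] 2 * ![k⁻¹, k, k, k] 3| =
      k ^ 2 := by
    simp [hk.ne', abs_of_pos hk, pow_two]
  rw [e] at h
  rw [← h]
  congr 1
  ext s
  constructor
  · rintro ⟨h1, h2⟩
    refine ⟨![k * s 0, k⁻¹ * s 1, k⁻¹ * s 2, k⁻¹ * s 3], ⟨fun i => ?_, ?_⟩, ?_⟩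
    · have := h1 i
      fin_cases i <;> simp at this ⊢ <;> positivity
    · refine le_of_eq_of_le ?_ h2
      simp
      field_simp
    · ext i
      simp only [Matrix.mulVec_diagonal]
      fin_cases i <;> simp <;> field_simp
  · rintro ⟨t, ⟨h1, h2⟩, rfl⟩
    simp only [coneRegion, Set.mem_ofPred_eq, Matrix.mulVec_diagonal]
    refine ⟨fun i => mul_nonneg ?_ (h1 i), le_of_eq_of_le ?_ h2⟩
    · fin_cases i <;> simp <;> positivity
    · simp
      field_simp

theorem volume_coneRegion_swap (g12 g13 g23 c : ℝ) :
    volume (coneRegion g12 g13 g23 c) = volume (coneRegion g12 g23 g13 c) := by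
  have h := volume_measurePreserving_piCongrLeft (fun _ : Fin 4 => ℝ) (Equiv.swap 1 2)
  rw [← h.measure_preimage_equiv]
  congr 1
  ext s
  have e : ∀ i, (MeasurableEquiv.piCongrLeft (fun _ : Fin 4 => ℝ) (Equiv.swap 1 2)) s i =
      s (Equiv.swap 1 2 i) := fun i => by
    have := Equiv.piCongrLeft_apply_apply (fun _ : Fin 4 => ℝ) (Equiv.swap 1 2) s
      (Equiv.swap 1 2 i)
    rwa [Equiv.swap_apply_self] at this
  simp only [coneRegion, Set.mem_preimage, Set.mem_ofPred_eq, e]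
  have e0 : Equiv.swap (1 : Fin 4) 2 0 = 0 := by decide
  have e3 : Equiv.swap (1 : Fin 4) 2 3 = 3 := by decide
  rw [Equiv.swap_apply_left, Equiv.swap_apply_right, e0, e3]
  refine and_congr ⟨fun h i => ?_, fun h i => h _⟩ ?_
  · simpa using h (Equiv.swap 1 2 i)
  · ring_nf

theorem volume_coneRegion_swap' (g12 g13 g23 : ℝ) :
    volume (coneRegion g12 g13 g23 0) = volume (coneRegion g13 g12 g23 0) := by
  have h := volume_measurePreserving_piCongrLeft (fun _ : Fin 4 => ℝ) (Equiv.swap 2 3)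
  rw [← h.measure_preimage_equiv]
  congr 1
  ext s
  have e : ∀ i, (MeasurableEquiv.piCongrLeft (fun _ : Fin 4 => ℝ) (Equiv.swap 2 3)) s i =
      s (Equiv.swap 2 3 i) := fun i => by
    have := Equiv.piCongrLeft_apply_apply (fun _ : Fin 4 => ℝ) (Equiv.swap 2 3) s
      (Equiv.swap 2 3 i)
    rwa [Equiv.swap_apply_self] at this
  simp only [coneRegion, Set.mem_preimage, Set.mem_ofPred_eq, e]
  have e0 : Equiv.swap (2 : Fin 4) 3 0 = 0 := by decide
  have e3 : Equiv.swap (2 : Fin 4) 3 1 = 1 := by decide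
  rw [Equiv.swap_apply_left, Equiv.swap_apply_right, e0, e3]
  refine and_congr ⟨fun h i => ?_, fun h i => h _⟩ ?_
  · simpa using h (Equiv.swap 2 3 i)
  · ring_nf

/-- Cutting a simplex along a plane through two vertices and a point of the opposite edge. -/
theorem volume_coneRegion_split (g12 g13 g23 : ℝ) (b m : ℝ) (hb : 0 < b) (hm : 0 < m)
    (hbm : b + m = 1) :
    volume (coneRegion g12 g13 g23 0) =
      ENNReal.ofReal m * volume (coneRegion g12 (b * g12 + m * g13) (m * g23) (b * m * g23)) +
      ENNReal.ofReal b * volume (coneRegion g13 (b * g12 + m * g13) (b * g23) (b * m * g23)) := by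
  -- With p = b v₂ + m v₃, the pieces are spanned by v₀, v₁, v₂, p and by v₀, v₁, v₃, p. As b + m =
  -- 1, p still pairs to 1 with v₀, and its own norm produces the coefficient b m g23 of the square.
  let M1 : Matrix (Fin 4) (Fin 4) ℝ := !![1, 0, 0, 0; 0, 1, 0, 0; 0, 0, 1, b; 0, 0, 0, m]
  let M2 : Matrix (Fin 4) (Fin 4) ℝ := !![1, 0, 0, 0; 0, 1, 0, 0; 0, 0, 0, b; 0, 0, 1, m]
  have d1 : |M1.det| = m := by
    simp [M1, Matrix.det_succ_row_zero, Fin.sum_univ_succ, Fin.succAbove, abs_of_pos hm]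
  have d2 : |M2.det| = b := by
    simp [M2, Matrix.det_succ_row_zero, Fin.sum_univ_succ, Fin.succAbove, abs_of_pos hb]
  have a1 : ∀ s, M1.mulVec s = ![s 0, s 1, s 2 + b * s 3, m * s 3] := by
    intro s
    ext i
    fin_cases i <;> simp [M1, Matrix.mulVec, dotProduct, Fin.sum_univ_succ]
  have a2 : ∀ s, M2.mulVec s = ![s 0, s 1, b * s 3, s 2 + m * s 3] := by
    intro s
    ext i
    fin_cases i <;> simp [M2, Matrix.mulVec, dotProduct, Fin.sum_univ_succ]
  have h1 := volume_image_matrix M1 (coneRegion g12 (b * g12 + m * g13) (m * g23) (b * m * g23))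
  have h2 := volume_image_matrix M2 (coneRegion g13 (b * g12 + m * g13) (b * g23) (b * m * g23))
  rw [d1] at h1
  rw [d2] at h2
  simp only [a1] at h1
  simp only [a2] at h2
  -- The pieces lie on the two sides of the hyperplane b s₃ = m s₂ and overlap only in a null set.
  let H : Set (Fin 4 → ℝ) := {s | b * s 3 ≤ m * s 2}
  have hH : MeasurableSet H := (isClosed_le (by fun_prop) (by fun_prop)).measurableSet
  have hbm' : b = 1 - m := by linarith
  have i1 : (fun s : Fin 4 → ℝ => ![s 0, s 1, s 2 + b * s 3, m * s 3]) ''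
      (coneRegion g12 (b * g12 + m * g13) (m * g23) (b * m * g23)) =
      coneRegion g12 g13 g23 0 ∩ H := by
    ext s
    constructor
    · rintro ⟨t, ⟨ht, ht'⟩, rfl⟩
      have := ht 0; have := ht 1; have := ht 2; have := ht 3
      refine ⟨⟨fun i => ?_, ?_⟩, ?_⟩
      · fin_cases i <;> simp <;> positivity
      · refine le_of_eq_of_le ?_ ht'
        simp
        rw [hbm']
        ring
      · simp only [H, Set.mem_ofPred_eq, Matrix.cons_val]
        nlinarith [mul_nonneg hm.le (ht 2)]
    · rintro ⟨⟨ht, ht'⟩, hs⟩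
      simp only [H, Set.mem_ofPred_eq] at hs
      have := ht 0; have := ht 1; have := ht 2; have := ht 3
      refine ⟨![s 0, s 1, s 2 - b * (m⁻¹ * s 3), m⁻¹ * s 3], ⟨fun i => ?_, ?_⟩, ?_⟩
      · fin_cases i <;> simp <;> try positivity
        rw [← mul_assoc, mul_comm b, mul_assoc, inv_mul_le_iff₀ hm]
        exact hs
      · refine le_of_eq_of_le ?_ ht'
        simp
        rw [hbm']
        field_simp
        ring
      · ext i
        fin_cases i <;> simp [hm.ne']
  have i2 : (fun s : Fin 4 → ℝ => ![s 0, s 1, b * s 3, s 2 + m * s 3]) ''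
      (coneRegion g13 (b * g12 + m * g13) (b * g23) (b * m * g23)) =ᵐ[volume]
      (coneRegion g12 g13 g23 0 \ H : Set _) := by
    have hnull : volume {s : Fin 4 → ℝ | b * s 3 = m * s 2} = 0 := by
      let f : (Fin 4 → ℝ) →ₗ[ℝ] ℝ := b • LinearMap.proj 3 - m • LinearMap.proj 2
      have hf : {s : Fin 4 → ℝ | b * s 3 = m * s 2} = (LinearMap.ker f : Set (Fin 4 → ℝ)) := by
        ext s
        simp [f, sub_eq_zero]
      rw [hf]
      refine Measure.addHaar_submodule _ _ fun h => ?_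
      have : f (Pi.single 3 1) = 0 := by
        rw [← LinearMap.mem_ker, h]; trivial
      simp [f] at this
      exact hb.ne' this
    rw [measure_eq_zero_iff_ae_notMem] at hnull
    refine Filter.eventuallyEq_set.mpr ?_
    filter_upwards [hnull] with s hs
    constructor
    · rintro ⟨t, ⟨ht, ht'⟩, rfl⟩
      have := ht 0; have := ht 1; have := ht 2; have := ht 3
      refine ⟨⟨fun i => ?_, ?_⟩, ?_⟩
      · fin_cases i <;> simp <;> positivity
      · refine le_of_eq_of_le ?_ ht'
        simp
        rw [hbm']
        ring
      · simp only [H, Set.mem_ofPred_eq, Matrix.cons_val, not_le] at hs ⊢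
        refine lt_of_le_of_ne ?_ (Ne.symm hs)
        nlinarith [mul_nonneg hb.le (ht 2)]
    · rintro ⟨⟨ht, ht'⟩, hs⟩
      simp only [H, Set.mem_ofPred_eq, not_le] at hs
      have := ht 0; have := ht 1; have := ht 2; have := ht 3
      refine ⟨![s 0, s 1, s 3 - m * (b⁻¹ * s 2), b⁻¹ * s 2], ⟨fun i => ?_, ?_⟩, ?_⟩
      · fin_cases i <;> simp <;> try positivity
        rw [← mul_assoc, mul_comm m, mul_assoc, inv_mul_le_iff₀ hb]
        exact hs.le
      · refine le_of_eq_of_le ?_ ht'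
        simp
        have : m = 1 - b := by linarith
        rw [this]
        field_simp
        ring
      · ext i
        fin_cases i <;> simp [hb.ne']
  rw [← measure_inter_add_sdiff _ hH, ← measure_congr i2, ← i1, h1, h2]

theorem isOpen_pos_pi : IsOpen {s : Fin 4 → ℝ | ∀ i, 0 < s i} := by
  have : {s : Fin 4 → ℝ | ∀ i, 0 < s i} = Set.univ.pi fun _ => Set.Ioi 0 := by
    ext s; simp
  rw [this]
  exact isOpen_set_pi Set.finite_univ fun _ _ => isOpen_Ioi

theorem volume_coneRegion_pos {g12 g13 g23 c : ℝ} (h12 : 0 ≤ g12) (h13 : 0 ≤ g13)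
    (h23 : 0 ≤ g23) (hc : 0 ≤ c) : 0 < volume (coneRegion g12 g13 g23 c) := by
  let S : Set (Fin 4 → ℝ) := {s | ∀ i, 0 < s i} ∩ {s | s 0 * (s 1 + s 2 + s 3) + g12 * (s 1 * s 2)
    + g13 * (s 1 * s 3) + g23 * (s 2 * s 3) + c * s 3 ^ 2 < 1}
  have hS : IsOpen S := isOpen_pos_pi.inter (isOpen_lt (by fun_prop) continuous_const)
  refine lt_of_lt_of_le (hS.measure_pos volume ?_)
    (measure_mono (fun s hs => ⟨fun i => (hs.1 i).le, hs.2.le⟩))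
  refine ⟨fun _ => (4 + g12 + g13 + g23 + c)⁻¹, fun i => by positivity, ?_⟩
  have : (4 + g12 + g13 + g23 + c)⁻¹ * (4 + g12 + g13 + g23 + c) = 1 :=
    inv_mul_cancel₀ (by positivity)
  have h1 : 0 < (4 + g12 + g13 + g23 + c)⁻¹ := by positivity
  have h2 : (4 + g12 + g13 + g23 + c)⁻¹ ≤ 1 := inv_le_one_of_one_le₀ (by linarith)
  simp only [Set.mem_ofPred_eq]
  nlinarith

theorem lintegral_Ioi_one_inv_cube_lt_top (g : ℝ) :
    ∫⁻ x in Set.Ioi (1 : ℝ), ENNReal.ofReal ((g * x)⁻¹ ^ 3) < ⊤ := by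
  have h := (integrableOn_Ioi_rpow_of_lt (show (-3 : ℝ) < -1 by norm_num) one_pos).const_mul
    (g⁻¹ ^ 3)
  have h' : IntegrableOn (fun x : ℝ => (g * x)⁻¹ ^ 3) (Set.Ioi 1) := by
    refine IntegrableOn.congr_fun h (fun x hx => ?_) measurableSet_Ioi
    have hx : (0 : ℝ) < x := lt_trans one_pos hx
    rw [Real.rpow_neg hx.le, mul_inv, mul_pow, inv_pow x, ← Real.rpow_natCast x 3]
    norm_num
  exact Integrable.lintegral_lt_top h'

/-- All six products of distinct coordinates occur with coefficient at least some g > 0. If x is the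
largest coordinate, the others are at most x and at most 1/(g x), so slices have volume at most 1
for x ≤ 1 and (g x)⁻³ beyond, which is integrable. -/
theorem volume_coneRegion_lt_top {g12 g13 g23 c : ℝ} (h12 : 0 < g12) (h13 : 0 < g13)
    (h23 : 0 < g23) (hc : 0 ≤ c) : volume (coneRegion g12 g13 g23 c) < ⊤ := by
  obtain ⟨g, hg, hg1, hg12, hg13, hg23⟩ : ∃ g : ℝ, 0 < g ∧ g ≤ 1 ∧ g ≤ g12 ∧ g ≤ g13 ∧ g ≤ g23 :=
    ⟨min (min 1 g12) (min g13 g23), by positivity, (min_le_left _ _).trans (min_le_left _ _),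
      (min_le_left _ _).trans (min_le_right _ _), (min_le_right _ _).trans (min_le_left _ _),
      (min_le_right _ _).trans (min_le_right _ _)⟩
  let B : Set (ℝ × (Fin 3 → ℝ)) := {w | 0 ≤ w.1 ∧ ∀ j, 0 ≤ w.2 j ∧ w.2 j ≤ w.1 ∧
    g * w.1 * w.2 j ≤ 1}
  have hBm : MeasurableSet B := by
    have : IsClosed B := by
      simp only [B, Set.ofPred_and, Set.ofPred_forall]
      refine (isClosed_le continuous_const (by fun_prop)).inter (isClosed_iInter fun j => ?_)
      exact (isClosed_le continuous_const (by fun_prop)).inter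
        ((isClosed_le (by fun_prop) (by fun_prop)).inter
          (isClosed_le (by fun_prop) continuous_const))
    exact this.measurableSet
  have hB : volume B < ⊤ := by
    rw [Measure.volume_eq_prod, Measure.prod_apply hBm]
    have hle : ∀ x : ℝ, volume (Prod.mk x ⁻¹' B) ≤ Set.indicator (Set.Icc 0 1) 1 x +
        Set.indicator (Set.Ioi 1) (fun x => ENNReal.ofReal ((g * x)⁻¹ ^ 3)) x := by
      intro x
      by_cases h0 : 0 ≤ x
      · rcases le_or_gt x 1 with h1 | h1
        · rw [Set.indicator_of_mem (show x ∈ Set.Icc (0 : ℝ) 1 from ⟨h0, h1⟩)]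
          refine le_trans (measure_mono (t := Set.Icc (0 : Fin 3 → ℝ) 1) ?_) ?_
          · rintro y ⟨_, hy⟩
            exact ⟨fun j => (hy j).1, fun j => (hy j).2.1.trans h1⟩
          · rw [Real.volume_Icc_pi]
            simp
        · rw [Set.indicator_of_mem (show x ∈ Set.Ioi (1 : ℝ) from h1)]
          refine le_trans (measure_mono
            (t := Set.Icc (0 : Fin 3 → ℝ) (fun _ => (g * x)⁻¹)) ?_) ?_
          · rintro y ⟨_, hy⟩
            refine ⟨fun j => (hy j).1, fun j => ?_⟩
            have hgx : 0 < g * x := by positivity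
            rw [← one_div, le_div_iff₀ hgx, mul_comm]
            exact (hy j).2.2
          · rw [Real.volume_Icc_pi]
            have hgx : 0 < g * x := by positivity
            refine le_add_left (le_of_eq ?_)
            rw [ENNReal.ofReal_pow (inv_nonneg.mpr hgx.le)]
            simp
      · have : Prod.mk x ⁻¹' B = ∅ := by
          ext y; simp only [B, Set.mem_preimage, Set.mem_ofPred_eq]; tauto
        rw [this, measure_empty]
        exact zero_le
    refine lt_of_le_of_lt (lintegral_mono hle) ?_
    rw [lintegral_add_left (by exact measurable_one.indicator measurableSet_Icc),
      lintegral_indicator measurableSet_Icc, lintegral_indicator measurableSet_Ioi]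
    refine ENNReal.add_lt_top.mpr ⟨?_, lintegral_Ioi_one_inv_cube_lt_top g⟩
    simp
  have hsub : coneRegion g12 g13 g23 c ⊆
      ⋃ i : Fin 4, (MeasurableEquiv.piFinSuccAbove (fun _ => ℝ) i) ⁻¹' B := by
    rintro s ⟨hs0, hs⟩
    obtain ⟨i, hi⟩ := Finite.exists_max s
    refine Set.mem_iUnion.mpr ⟨i, hs0 i, fun j => ⟨hs0 _, hi _, ?_⟩⟩
    have hpair : ∀ i j : Fin 4, i ≠ j → g * s i * s j ≤ 1 := by
      have p01 := mul_nonneg (hs0 0) (hs0 1)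
      have p02 := mul_nonneg (hs0 0) (hs0 2)
      have p03 := mul_nonneg (hs0 0) (hs0 3)
      have p12 := mul_nonneg (hs0 1) (hs0 2)
      have p13 := mul_nonneg (hs0 1) (hs0 3)
      have p23 := mul_nonneg (hs0 2) (hs0 3)
      have p33 := mul_nonneg hc (sq_nonneg (s 3))
      have q12 := mul_le_mul_of_nonneg_right hg12 p12
      have q13 := mul_le_mul_of_nonneg_right hg13 p13
      have q23 := mul_le_mul_of_nonneg_right hg23 p23
      have q01 := mul_le_mul_of_nonneg_right hg1 p01
      have q02 := mul_le_mul_of_nonneg_right hg1 p02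
      have q03 := mul_le_mul_of_nonneg_right hg1 p03
      have r12 := mul_nonneg hg.le p12
      have r13 := mul_nonneg hg.le p13
      have r23 := mul_nonneg hg.le p23
      have r01 := mul_nonneg hg.le p01
      have r02 := mul_nonneg hg.le p02
      have r03 := mul_nonneg hg.le p03
      intro i j hij
      fin_cases i <;> fin_cases j <;> first | exact absurd rfl hij | (simp; linarith)
    exact hpair i _ (Fin.succAbove_ne i j).symm
  refine lt_of_le_of_lt (measure_mono hsub) (lt_of_le_of_lt (measure_iUnion_fintype_le _ _) ?_)
  refine ENNReal.sum_lt_top.mpr fun i _ => ?_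
  rw [(volume_preserving_piFinSuccAbove (fun _ => ℝ) i).measure_preimage_equiv]
  exact hB

/-- On the diagonal (√x, …, √x) the forms take the values m x < m' x, with m and m' the sums of all
coefficients. A choice of x between 1/m' and 1/m gives a nonempty open set in the difference, and
finiteness makes the inequality strict. -/
theorem volume_coneRegion_strictAnti {g12 g13 g23 c g12' g13' g23' c' : ℝ} (h12 : g12 ≤ g12')
    (h13 : g13 ≤ g13') (h23 : g23 ≤ g23') (hc : c < c')
    (p12 : 0 < g12) (p13 : 0 < g13) (p23 : 0 < g23) (pc : 0 < c) :
    volume (coneRegion g12' g13' g23' c') < volume (coneRegion g12 g13 g23 c) := by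
  have hsub := coneRegion_mono h12 h13 h23 hc.le
  have hfin := ((measure_mono hsub).trans_lt
    (volume_coneRegion_lt_top p12 p13 p23 pc.le)).ne
  rw [← measure_sdiff_add_inter (coneRegion g12 g13 g23 c) (measurableSet_coneRegion g12' g13' g23' c'),
    Set.inter_eq_self_of_subset_right hsub]
  rw [add_comm]
  refine ENNReal.lt_add_right hfin (ne_of_gt ?_)
  let S : Set (Fin 4 → ℝ) := {s | ∀ i, 0 < s i} ∩ ({s | s 0 * (s 1 + s 2 + s 3) + g12 * (s 1 * s 2)
    + g13 * (s 1 * s 3) + g23 * (s 2 * s 3) + c * s 3 ^ 2 < 1} ∩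
    {s | 1 < s 0 * (s 1 + s 2 + s 3) + g12' * (s 1 * s 2)
    + g13' * (s 1 * s 3) + g23' * (s 2 * s 3) + c' * s 3 ^ 2})
  have hS : IsOpen S := isOpen_pos_pi.inter ((isOpen_lt (by fun_prop) continuous_const).inter
    (isOpen_lt continuous_const (by fun_prop)))
  refine lt_of_lt_of_le (hS.measure_pos volume ?_)
    (measure_mono (fun s hs => ⟨⟨fun i => (hs.1 i).le, hs.2.1.le⟩, fun h => ?_⟩))
  · set m := 3 + g12 + g13 + g23 + c with hm
    set m' := 3 + g12' + g13' + g23' + c' with hm'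
    have hmm : m < m' := by linarith
    have hmp : 0 < m := by positivity
    obtain ⟨x, hx1, hx2⟩ := exists_between (one_div_lt_one_div_of_lt hmp hmm)
    have hx0 : 0 < x := lt_trans (by have := hmp.trans hmm; positivity) hx1
    have hsq : Real.sqrt x ^ 2 = x := Real.sq_sqrt hx0.le
    refine ⟨fun _ => Real.sqrt x, fun i => Real.sqrt_pos.mpr hx0, ?_, ?_⟩
    · rw [lt_div_iff₀ hmp] at hx2
      simp only [Set.mem_ofPred_eq]
      nlinarith
    · rw [div_lt_iff₀ (hmp.trans hmm)] at hx1
      simp only [Set.mem_ofPred_eq]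
      nlinarith
  · exact absurd h.2 (not_le.mpr hs.2.2)

/-! ### The equilateral triangle maximises the volume -/

/-- The volume of the part below the hyperboloid, for a simplex with one vertex at infinity and the
other ones at pairwise Euclidean distances `a`, `b`, `c`. -/
noncomputable def sideVolume (a b c : ℝ) : ℝ :=
  (volume (coneRegion (a ^ 2) (b ^ 2) (c ^ 2) 0)).toReal

/-- Picture a quadrilateral Q₁Q₂Q₃Q₄ inscribed in a circle, with consecutive sides `A`, `P`, `Y`,
`Z` and diagonals Q₂Q₄ = `U`, Q₁Q₃ = `W` meeting at E. Then `h3` is Ptolemy's relation, and `h1`,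
`h2` are those of the rearranged sides. Cut Q₁Q₂Q₄ and Q₁Q₂Q₃ at E: the piece Q₁Q₂E is common, while
Q₁Q₄E and Q₂Q₃E are similar with ratio `Z` : `P`. The coefficient of the square is the power of E,
the same in both. After enlarging the piece at `P` to the size of the other, its form has the larger
coefficients and hence its cone the smaller volume. The prefactors are the areas up to a constant.
-/
theorem sideVolume_smoothing {A P Y Z U W T : ℝ} (hA : 0 < A) (hP : 0 < P) (hY : 0 < Y) (hZ : 0 < Z)
    (hU : 0 < U) (hW : 0 < W) (hT : 0 < T) (h1 : P * A + Z * Y = T * U) (h2 : Z * A + P * Y = T * W)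
    (h3 : A * Y + P * Z = U * W) (hPZ : P < Z) :
    A * P * W * sideVolume A P W < A * Z * U * sideVolume A Z U := by
  -- E divides Q₂Q₄ in the ratio P A : Z Y and Q₁Q₃ in the ratio Z A : P Y; `h1` and `h2` make the
  -- weights sum to 1.
  have e1 := volume_coneRegion_split (A ^ 2) (Z ^ 2) (U ^ 2) (Z * Y / (T * U)) (P * A / (T * U))
    (by positivity) (by positivity) (by rw [← add_div, add_comm, h1]; field_simp)
  have e2 := volume_coneRegion_split (A ^ 2) (P ^ 2) (W ^ 2) (P * Y / (T * W)) (Z * A / (T * W))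
    (by positivity) (by positivity) (by rw [← add_div, add_comm, h2]; field_simp)
  have c1 : Z * Y / (T * U) * A ^ 2 + P * A / (T * U) * Z ^ 2 = Z * A * W / T := by
    field_simp
    linear_combination h3
  have c2 : P * Y / (T * W) * A ^ 2 + Z * A / (T * W) * P ^ 2 = P * A * U / T := by
    field_simp
    linear_combination h3
  have c3 : Z * Y / (T * U) * (P * A / (T * U)) * U ^ 2 = Z * Y * P * A / T ^ 2 := by
    field_simp
  have c4 : P * Y / (T * W) * (Z * A / (T * W)) * W ^ 2 = Z * Y * P * A / T ^ 2 := by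
    field_simp
  have c5 : P * A / (T * U) * U ^ 2 = P * A * U / T := by field_simp
  have c6 : Z * A / (T * W) * W ^ 2 = Z * A * W / T := by field_simp
  have c7 : Z * Y / (T * U) * U ^ 2 = Z * Y * U / T := by field_simp
  have c8 : P * Y / (T * W) * W ^ 2 = P * Y * W / T := by field_simp
  rw [c1, c3, c5, c7] at e1
  rw [c2, c4, c6, c8, volume_coneRegion_swap _ (P * A * U / T)] at e2
  have e3 := volume_coneRegion_scale (P ^ 2) (P * A * U / T) (P * Y * W / T)
    (Z * Y * P * A / T ^ 2) (Z / P) (by positivity)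
  have hlt := volume_coneRegion_strictAnti (g12 := Z ^ 2) (g13 := Z * A * W / T)
    (g23 := Z * Y * U / T) (c := Z * Y * P * A / T ^ 2) (g12' := P ^ 2 * (Z / P) ^ 2)
    (g13' := P * A * U / T * (Z / P) ^ 2) (g23' := P * Y * W / T * (Z / P) ^ 2)
    (c' := Z * Y * P * A / T ^ 2 * (Z / P) ^ 2) (by field_simp; rfl) ?_ ?_ ?_
    (by positivity) (by positivity) (by positivity) (by positivity)
  · have f1 : volume (coneRegion (Z ^ 2) (Z * A * W / T) (Z * Y * U / T) (Z * Y * P * A / T ^ 2)) ≠ ⊤ :=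
      (volume_coneRegion_lt_top (by positivity) (by positivity) (by positivity)
        (by positivity)).ne
    have f2 : volume (coneRegion (A ^ 2) (Z * A * W / T) (P * A * U / T) (Z * Y * P * A / T ^ 2)) ≠ ⊤ :=
      (volume_coneRegion_lt_top (by positivity) (by positivity) (by positivity)
        (by positivity)).ne
    have hlt' := (ENNReal.toReal_lt_toReal hlt.ne_top f1).mpr hlt
    simp only [sideVolume]
    rw [e1, e2, e3]
    rw [ENNReal.toReal_add (ENNReal.mul_ne_top ENNReal.ofReal_ne_top f2)
      (ENNReal.mul_ne_top ENNReal.ofReal_ne_top f1),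
      ENNReal.toReal_add (ENNReal.mul_ne_top ENNReal.ofReal_ne_top f2)
      (ENNReal.mul_ne_top ENNReal.ofReal_ne_top (ENNReal.mul_ne_top ENNReal.ofReal_ne_top
        hlt.ne_top))]
    simp only [ENNReal.toReal_mul]
    rw [ENNReal.toReal_ofReal (by positivity), ENNReal.toReal_ofReal (by positivity),
      ENNReal.toReal_ofReal (by positivity), ENNReal.toReal_ofReal (by positivity),
      ENNReal.toReal_ofReal (by positivity)]
    generalize (volume (coneRegion (A ^ 2) _ _ _)).toReal = v0
    generalize (volume (coneRegion (Z ^ 2) _ _ _)).toReal = v1 at hlt' ⊢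
    generalize (volume (coneRegion _ _ _ _)).toReal = v2 at hlt' ⊢
    have r1 : A * P * W * (Z * A / (T * W) * v0 + P * Y / (T * W) * ((Z / P) ^ 2 * v2)) =
      A ^ 2 * P * Z / T * v0 + A * Z ^ 2 * Y / T * v2 := by
      field_simp
    have r2 : A * Z * U * (P * A / (T * U) * v0 + Z * Y / (T * U) * v1) =
      A ^ 2 * P * Z / T * v0 + A * Z ^ 2 * Y / T * v1 := by
      field_simp
    rw [r1, r2]
    have : 0 < A * Z ^ 2 * Y / T := by positivity
    nlinarith
  · have : 0 ≤ Z * U - P * W := by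
      have : T * (Z * U - P * W) = (Z ^ 2 - P ^ 2) * Y := by linear_combination P * h2 - Z * h1
      have h' : 0 < (Z ^ 2 - P ^ 2) * Y := mul_pos (by nlinarith) hY
      rw [← this] at h'
      exact (pos_of_mul_pos_right h' hT.le).le
    have e : P * A * U / T * (Z / P) ^ 2 - Z * A * W / T = Z * A / (P * T) * (Z * U - P * W) := by
      field_simp
    have : 0 ≤ Z * A / (P * T) * (Z * U - P * W) := by positivity
    linarith
  · have : 0 ≤ Z * W - P * U := by
      have : T * (Z * W - P * U) = (Z ^ 2 - P ^ 2) * A := by linear_combination P * h1 - Z * h2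
      have h' : 0 < (Z ^ 2 - P ^ 2) * A := mul_pos (by nlinarith) hA
      rw [← this] at h'
      exact (pos_of_mul_pos_right h' hT.le).le
    have e : P * Y * W / T * (Z / P) ^ 2 - Z * Y * U / T = Z * Y / (P * T) * (Z * W - P * U) := by
      field_simp
    have : 0 ≤ Z * Y / (P * T) * (Z * W - P * U) := by positivity
    linarith
  · have h' : 1 < (Z / P) ^ 2 := by
      have : 1 < Z / P := (one_lt_div hP).mpr hPZ
      nlinarith
    have : 0 < Z * Y * P * A / T ^ 2 := by positivity
    nlinarith

theorem sideVolume_swap (a b c : ℝ) : sideVolume a b c = sideVolume a c b := by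
  simp only [sideVolume]
  rw [volume_coneRegion_swap]

theorem sideVolume_swap' (a b c : ℝ) : sideVolume a b c = sideVolume b a c := by
  simp only [sideVolume]
  rw [volume_coneRegion_swap']

theorem sideVolume_scale (a b c k : ℝ) (hk : 0 < k) :
    sideVolume a b c = k ^ 2 * sideVolume (k * a) (k * b) (k * c) := by
  simp only [sideVolume]
  rw [volume_coneRegion_scale _ _ _ _ k hk, ENNReal.toReal_mul,
    ENNReal.toReal_ofReal (by positivity), zero_mul]
  simp only [mul_pow, mul_comm]

/-- Half of the volume of the ideal tetrahedron with dihedral angles `α`, `β`, `γ`. -/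
noncomputable def angleVolume (α β γ : ℝ) : ℝ :=
  Real.sin α * Real.sin β * Real.sin γ * sideVolume (Real.sin α) (Real.sin β) (Real.sin γ)

theorem angleVolume_swap (α β γ : ℝ) : angleVolume α β γ = angleVolume α γ β := by
  simp only [angleVolume]
  rw [sideVolume_swap]
  ring

theorem angleVolume_swap' (α β γ : ℝ) : angleVolume α β γ = angleVolume β α γ := by
  simp only [angleVolume]
  rw [sideVolume_swap']
  ring

/-- In a circle of diameter one, chords are the sines of inscribed angles, and g, x, y, z fill the
circle. The Ptolemy relations become trigonometric identities once sin g is replaced by sin (x + y +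
z). -/
theorem angleVolume_smoothing {g x y z : ℝ} (hg : 0 < g) (hx : 0 < x) (hy : 0 < y)
    (hxz : x < z) (hsum : g + x + y + z = Real.pi) :
    angleVolume g x (y + z) < angleVolume g z (x + y) := by
  have hgs : Real.sin g = Real.sin (x + y + z) := by
    rw [← Real.sin_pi_sub]; congr 1; linarith
  have hpos : ∀ t, 0 < t → t < Real.pi → 0 < Real.sin t := fun t => Real.sin_pos_of_pos_of_lt_pi
  refine sideVolume_smoothing (T := Real.sin (x + z)) (Y := Real.sin y) (hpos _ hg (by linarith))
    (hpos _ hx (by linarith))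
    (hpos _ hy (by linarith)) (hpos _ (by linarith) (by linarith)) (hpos _ (by linarith) (by linarith))
    (hpos _ (by linarith) (by linarith)) (hpos _ (by linarith) (by linarith)) ?_ ?_ ?_ ?_
  · rw [hgs]
    simp only [Real.sin_add, Real.cos_add]
    have := Real.sin_sq_add_cos_sq x
    have := Real.sin_sq_add_cos_sq y
    have := Real.sin_sq_add_cos_sq z
    grind
  · rw [hgs]
    simp only [Real.sin_add, Real.cos_add]
    have := Real.sin_sq_add_cos_sq x
    have := Real.sin_sq_add_cos_sq y
    have := Real.sin_sq_add_cos_sq z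
    grind
  · rw [hgs]
    simp only [Real.sin_add, Real.cos_add]
    have := Real.sin_sq_add_cos_sq x
    have := Real.sin_sq_add_cos_sq y
    have := Real.sin_sq_add_cos_sq z
    grind
  · have h1 : 0 < Real.sin ((z - x) / 2) := hpos _ (by linarith) (by linarith)
    have h2 : 0 < Real.cos ((z + x) / 2) :=
      Real.cos_pos_of_mem_Ioo ⟨by linarith, by linarith⟩
    have := Real.sin_sub_sin z x
    have := mul_pos h1 h2
    linarith

/-- This is the smoothing move with y = x' - x and z = w'. -/
theorem angleVolume_lt_of_closer {g x w x' w' : ℝ} (hg : 0 < g) (hx : 0 < x) (hxx : x < x')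
    (hxw : x < w') (hsum : x + w = x' + w') (hpi : g + x + w = Real.pi) :
    angleVolume g x w < angleVolume g x' w' := by
  have := angleVolume_smoothing (y := x' - x) hg hx (by linarith) hxw (by linarith)
  rw [show x' - x + w' = w by linarith, show x + (x' - x) = x' by ring] at this
  rwa [angleVolume_swap g x']

/-- Two moves suffice: with g fixed, bring one angle to π/3; then balance the other two, whose sum
is now 2π/3. -/
theorem angleVolume_le_aux {g x w : ℝ} (hg : 0 < g) (hx : x < Real.pi / 3) (hw : Real.pi / 3 < w)
    (hx0 : 0 < x) (hsum : g + x + w = Real.pi) :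
    angleVolume g x w < angleVolume (Real.pi / 3) (Real.pi / 3) (Real.pi / 3) := by
  have h1 : angleVolume g x w < angleVolume g (Real.pi / 3) (x + w - Real.pi / 3) :=
    angleVolume_lt_of_closer hg hx0 hx (by linarith) (by ring) hsum
  refine lt_of_lt_of_le h1 ?_
  rw [angleVolume_swap']
  have hs : g + (x + w - Real.pi / 3) = Real.pi / 3 + Real.pi / 3 := by linarith
  have hpi := Real.pi_pos
  rcases lt_trichotomy g (Real.pi / 3) with h | h | h
  · exact (angleVolume_lt_of_closer (by positivity) hg h h hs (by linarith)).le
  · rw [h] at hs ⊢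
    rw [show x + w - Real.pi / 3 = Real.pi / 3 by linarith]
  · rw [angleVolume_swap]
    exact (angleVolume_lt_of_closer (by positivity) (by linarith) (by linarith) (by linarith)
      (by linarith) (by linarith)).le

theorem angleVolume_lt_equilateral {a b c : ℝ} (ha : 0 < a) (hb : 0 < b) (hc : 0 < c)
    (hsum : a + b + c = Real.pi)
    (hne : ¬ (a = Real.pi / 3 ∧ b = Real.pi / 3 ∧ c = Real.pi / 3)) :
    angleVolume a b c < angleVolume (Real.pi / 3) (Real.pi / 3) (Real.pi / 3) := by
  by_cases h1 : a < Real.pi / 3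
  · by_cases h2 : Real.pi / 3 < b
    · rw [angleVolume_swap, angleVolume_swap']
      exact angleVolume_le_aux hc h1 h2 ha (by linarith)
    · rw [angleVolume_swap']
      exact angleVolume_le_aux hb h1 (by linarith) ha (by linarith)
  · by_cases h2 : b < Real.pi / 3
    · by_cases h3 : Real.pi / 3 < a
      · rw [angleVolume_swap, angleVolume_swap', angleVolume_swap]
        exact angleVolume_le_aux hc h2 h3 hb (by linarith)
      · exact angleVolume_le_aux ha h2 (by linarith) hb (by linarith)
    · by_cases h3 : c < Real.pi / 3
      · by_cases h4 : Real.pi / 3 < a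
        · rw [angleVolume_swap', angleVolume_swap]
          exact angleVolume_le_aux hb h3 h4 hc (by linarith)
        · rw [angleVolume_swap]
          exact angleVolume_le_aux ha h3 (by linarith) hc (by linarith)
      · exact absurd ⟨by linarith, by linarith, by linarith⟩ hne

/-- The primitive sixth root of unity `exp (π i / 3)`, as apex of an equilateral triangle with
base `0`, `1`. -/
noncomputable def hexRoot : ℂ := ⟨1 / 2, Real.sqrt 3 / 2⟩

theorem hexRoot_sq : hexRoot ^ 2 = hexRoot - 1 := by
  have h : Real.sqrt 3 * Real.sqrt 3 = 3 := Real.mul_self_sqrt (by norm_num)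
  apply Complex.ext
  · simp [hexRoot, pow_two]; linarith
  · simp [hexRoot, pow_two]; ring

theorem norm_hexRoot : ‖hexRoot‖ = 1 := by
  have h : Real.sqrt 3 * Real.sqrt 3 = 3 := Real.mul_self_sqrt (by norm_num)
  have : ‖hexRoot‖ ^ 2 = 1 := by
    rw [Complex.sq_norm, Complex.normSq_apply]; simp [hexRoot]; linarith
  nlinarith [norm_nonneg hexRoot]

theorem norm_one_sub_hexRoot : ‖1 - hexRoot‖ = 1 := by
  have h : Real.sqrt 3 * Real.sqrt 3 = 3 := Real.mul_self_sqrt (by norm_num)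
  have : ‖1 - hexRoot‖ ^ 2 = 1 := by
    rw [Complex.sq_norm, Complex.normSq_apply]; simp [hexRoot]; linarith
  nlinarith [norm_nonneg (1 - hexRoot)]

theorem hexRoot_im_pos : 0 < hexRoot.im := by
  simp [hexRoot]

theorem eq_hexRoot {z : ℂ} (hz : 0 < z.im) (h1 : ‖z‖ = 1) (h2 : ‖1 - z‖ = 1) : z = hexRoot := by
  have h1' : ‖z‖ ^ 2 = 1 := by rw [h1]; norm_num
  have h2' : ‖1 - z‖ ^ 2 = 1 := by rw [h2]; norm_num
  rw [Complex.sq_norm, Complex.normSq_apply] at h1' h2'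
  simp at h2'
  have hre : z.re = 1 / 2 := by nlinarith
  apply Complex.ext
  · simp [hexRoot, hre]
  · simp only [hexRoot]
    rw [hre] at h1'
    have : Real.sqrt 3 = 2 * z.im := by
      rw [show (3 : ℝ) = (2 * z.im) ^ 2 by nlinarith]
      exact Real.sqrt_sq (by linarith)
    linarith

/-- These are the angles at z, 1 and 0 of the triangle 0, 1, z, and the equations are the law of
sines; α is opposite to the side of length 1. -/
theorem exists_angles {z : ℂ} (hz : 0 < z.im) : ∃ α β γ : ℝ, 0 < α ∧ 0 < β ∧ 0 < γ ∧
    α + β + γ = Real.pi ∧ Real.sin α = z.im / (‖z‖ * ‖1 - z‖) ∧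
    Real.sin β = z.im / (‖z‖ * ‖1 - z‖) * ‖z‖ ∧
    Real.sin γ = z.im / (‖z‖ * ‖1 - z‖) * ‖1 - z‖ := by
  have hz0 : z ≠ 0 := by rintro rfl; simp at hz
  have hz1 : z - 1 ≠ 0 := by
    intro h; have := congrArg Complex.im h; simp at this; exact hz.ne' this
  have hn0 := norm_pos_iff.mpr hz0
  have hn1 := norm_pos_iff.mpr hz1
  have harg : ∀ w : ℂ, 0 < w.im → 0 < w.arg ∧ w.arg < Real.pi := by
    intro w hw
    refine ⟨lt_of_le_of_ne (Complex.arg_nonneg_iff.mpr hw.le) fun h => ?_, ?_⟩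
    · exact hw.ne' (Complex.arg_eq_zero_iff.mp h.symm).2
    · exact Complex.arg_lt_pi_iff.mpr (Or.inr hw.ne')
  have hz1im : 0 < (z - 1).im := by simpa using hz
  obtain ⟨a1, a2⟩ := harg z hz
  obtain ⟨b1, b2⟩ := harg (z - 1) hz1im
  have hs : Real.sin ((z - 1).arg - z.arg) = z.im / (‖z‖ * ‖1 - z‖) := by
    rw [Real.sin_sub, Complex.sin_arg, Complex.sin_arg, Complex.cos_arg hz0, Complex.cos_arg hz1,
      norm_sub_rev 1 z]
    simp only [Complex.sub_re, Complex.sub_im, Complex.one_re, Complex.one_im]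
    field_simp
    ring
  refine ⟨(z - 1).arg - z.arg, Real.pi - (z - 1).arg, z.arg, ?_, by linarith, a1, by ring, hs, ?_, ?_⟩
  · by_contra! h
    have := Real.sin_nonpos_of_nonpos_of_neg_pi_le h (by linarith)
    rw [hs] at this
    have : 0 < z.im / (‖z‖ * ‖1 - z‖) := by
      rw [norm_sub_rev 1 z]; positivity
    linarith
  · rw [Real.sin_pi_sub, Complex.sin_arg, norm_sub_rev 1 z]
    simp
    field_simp
  · rw [Complex.sin_arg, norm_sub_rev 1 z]
    field_simp

/-- Rescaling the triangle by k = sin α makes its circumdiameter 1, and the resulting factor k² Im z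
is the product of the three sines. -/
theorem im_mul_sideVolume {z : ℂ} (hz : 0 < z.im) {α β γ : ℝ}
    (hα : Real.sin α = z.im / (‖z‖ * ‖1 - z‖)) (hβ : Real.sin β = z.im / (‖z‖ * ‖1 - z‖) * ‖z‖)
    (hγ : Real.sin γ = z.im / (‖z‖ * ‖1 - z‖) * ‖1 - z‖) :
    z.im * sideVolume 1 ‖z‖ ‖1 - z‖ = angleVolume α β γ := by
  have hz0 : z ≠ 0 := by rintro rfl; simp at hz
  have hz1 : 1 - z ≠ 0 := by
    intro h; have := congrArg Complex.im h; simp at this; exact hz.ne' this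
  have hn0 := norm_pos_iff.mpr hz0
  have hn1 := norm_pos_iff.mpr hz1
  rw [← hα] at hβ hγ
  rw [sideVolume_scale _ _ _ (z.im / (‖z‖ * ‖1 - z‖)) (by positivity), mul_one, ← hα, ← hβ, ← hγ]
  simp only [angleVolume]
  rw [← mul_assoc]
  congr 1
  rw [hβ, hγ, hα]
  field_simp

theorem im_mul_sideVolume_le {z : ℂ} (hz : 0 < z.im) :
    z.im * sideVolume 1 ‖z‖ ‖1 - z‖ ≤ hexRoot.im * sideVolume 1 1 1 ∧
      (z.im * sideVolume 1 ‖z‖ ‖1 - z‖ = hexRoot.im * sideVolume 1 1 1 → z = hexRoot) := by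
  have hex : hexRoot.im * sideVolume 1 1 1 =
      angleVolume (Real.pi / 3) (Real.pi / 3) (Real.pi / 3) := by
    have := im_mul_sideVolume hexRoot_im_pos (α := Real.pi / 3) (β := Real.pi / 3)
      (γ := Real.pi / 3)
    simp only [norm_hexRoot, norm_one_sub_hexRoot, mul_one, div_one, Real.sin_pi_div_three] at this
    simpa [hexRoot] using this
  obtain ⟨α, β, γ, h1, h2, h3, hs, hα, hβ, hγ⟩ := exists_angles hz
  rw [hex, im_mul_sideVolume hz hα hβ hγ]
  by_cases h : α = Real.pi / 3 ∧ β = Real.pi / 3 ∧ γ = Real.pi / 3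
  · obtain ⟨rfl, rfl, rfl⟩ := h
    refine ⟨le_rfl, fun _ => ?_⟩
    have hp : Real.sin (Real.pi / 3) ≠ 0 := by rw [Real.sin_pi_div_three]; positivity
    rw [← hα] at hβ hγ
    exact eq_hexRoot hz (by simpa [hp] using hβ.symm) (by simpa [hp] using hγ.symm)
  · have := angleVolume_lt_equilateral h1 h2 h3 hs h
    exact ⟨this.le, fun h' => absurd h' this.ne⟩

/-! ### The maximal volume and the tetrahedra attaining it -/

/-- This is the normalisation to the vertices ∞, 0, 1, z: the hypothesis `hz` makes z the
cross-ratio, and Plücker's relation gives z - 1 as the companion ratio. -/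
theorem volH3_mk_eq_sideVolume (v : Fin 4 → Fin 2 → ℂ) (hv : ∀ i, v i ≠ 0)
    {d01 d02 d03 d12 d13 d23 z : ℂ} (h01 : d01 = v 0 0 * v 1 1 - v 0 1 * v 1 0)
    (h02 : d02 = v 0 0 * v 2 1 - v 0 1 * v 2 0) (h03 : d03 = v 0 0 * v 3 1 - v 0 1 * v 3 0)
    (h12 : d12 = v 1 0 * v 2 1 - v 1 1 * v 2 0) (h13 : d13 = v 1 0 * v 3 1 - v 1 1 * v 3 0)
    (h23 : d23 = v 2 0 * v 3 1 - v 2 1 * v 3 0)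
    (n01 : d01 ≠ 0) (n02 : d02 ≠ 0) (n03 : d03 ≠ 0) (n12 : d12 ≠ 0)
    (hz : d02 * d13 = z * (d03 * d12)) :
    volH3 (fun i => Projectivization.mk ℂ (v i) (hv i)) =
      2 * (z.im * sideVolume 1 ‖z‖ ‖1 - z‖) := by
  have hz' : d01 * d23 = (z - 1) * (d03 * d12) := by
    rw [sub_mul, one_mul, ← hz, h01, h02, h03, h12, h13, h23]
    ring
  rw [volH3_mk, ← h01, ← h02, ← h03, ← h12, ← h13, ← h23, hz]
  have him : (z * (d03 * d12) * star (d03 * d12)).im = ‖d03 * d12‖ ^ 2 * z.im := by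
    rw [mul_assoc, RCLike.star_def, Complex.mul_conj', ← Complex.ofReal_pow, mul_comm,
      Complex.im_ofReal_mul]
  rw [him]
  have p01 := norm_pos_iff.mpr n01
  have p02 := norm_pos_iff.mpr n02
  have p03 := norm_pos_iff.mpr n03
  have p12 := norm_pos_iff.mpr n12
  have e1 : ‖d02‖ * ‖d13‖ = ‖z‖ * (‖d03‖ * ‖d12‖) := by
    rw [← norm_mul, hz, norm_mul, norm_mul]
  have e2 : ‖d01‖ * ‖d23‖ = ‖1 - z‖ * (‖d03‖ * ‖d12‖) := by
    rw [← norm_mul, hz', norm_mul, norm_mul, norm_sub_rev]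
  have e1' : ‖d13‖ = ‖z‖ * (‖d03‖ * ‖d12‖) / ‖d02‖ := by
    rw [← e1]; field_simp
  have e2' : ‖d23‖ = ‖1 - z‖ * (‖d03‖ * ‖d12‖) / ‖d01‖ := by
    rw [← e2]; field_simp
  -- The scale factors make v₀ pair to 1 with v₁, v₂, v₃, and v₁ pair to 1 with v₂; the two
  -- remaining entries are then ‖z‖² and ‖1 - z‖².
  have hscale := volume_simplexRegion_scale (‖d01‖ ^ 2) (‖d02‖ ^ 2) (‖d03‖ ^ 2) (‖d12‖ ^ 2)
    (‖d13‖ ^ 2) (‖d23‖ ^ 2) ![‖d12‖ / (‖d01‖ * ‖d02‖), ‖d02‖ / (‖d01‖ * ‖d12‖),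
      ‖d01‖ / (‖d02‖ * ‖d12‖), ‖d01‖ * ‖d02‖ / (‖d12‖ * ‖d03‖ ^ 2)] (fun i => by
        fin_cases i <;> simp <;> positivity)
  simp only [Matrix.cons_val_zero, Matrix.cons_val_one, Matrix.cons_val] at hscale
  have f01 : ‖d01‖ ^ 2 * (‖d12‖ / (‖d01‖ * ‖d02‖) * (‖d02‖ / (‖d01‖ * ‖d12‖))) = 1 := by
    field_simp
  have f02 : ‖d02‖ ^ 2 * (‖d12‖ / (‖d01‖ * ‖d02‖) * (‖d01‖ / (‖d02‖ * ‖d12‖))) = 1 := by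
    field_simp
  have f03 : ‖d03‖ ^ 2 * (‖d12‖ / (‖d01‖ * ‖d02‖) *
    (‖d01‖ * ‖d02‖ / (‖d12‖ * ‖d03‖ ^ 2))) = 1 := by field_simp
  have f12 : ‖d12‖ ^ 2 * (‖d02‖ / (‖d01‖ * ‖d12‖) * (‖d01‖ / (‖d02‖ * ‖d12‖))) = 1 ^ 2 := by
    field_simp
  have f13 : ‖d13‖ ^ 2 * (‖d02‖ / (‖d01‖ * ‖d12‖) *
    (‖d01‖ * ‖d02‖ / (‖d12‖ * ‖d03‖ ^ 2))) = ‖z‖ ^ 2 := by rw [e1']; field_simp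
  have f23 : ‖d23‖ ^ 2 * (‖d01‖ / (‖d02‖ * ‖d12‖) *
    (‖d01‖ * ‖d02‖ / (‖d12‖ * ‖d03‖ ^ 2))) = ‖1 - z‖ ^ 2 := by rw [e2']; field_simp
  rw [f01, f02, f03, f12, f13, f23, ← coneRegion_zero] at hscale
  rw [hscale, ENNReal.toReal_mul, ENNReal.toReal_ofReal (by positivity), norm_mul]
  change _ * (_ * sideVolume _ _ _) = _
  field_simp

theorem sideVolume_pos {a b c : ℝ} (ha : 0 < a) (hb : 0 < b) (hc : 0 < c) :
    0 < sideVolume a b c :=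
  ENNReal.toReal_pos (volume_coneRegion_pos (by positivity) (by positivity) (by positivity)
    le_rfl).ne' (volume_coneRegion_lt_top (by positivity) (by positivity) (by positivity)
    le_rfl).ne

/-- Degenerate quadruples and cross-ratios outside the open upper half-plane give volume at most 0,
below the positive bound; the rest is `im_mul_sideVolume_le`. -/
theorem volH3_mk_le (v : Fin 4 → Fin 2 → ℂ) (hv : ∀ i, v i ≠ 0)
    {d01 d02 d03 d12 d13 : ℂ} (h01 : d01 = v 0 0 * v 1 1 - v 0 1 * v 1 0)
    (h02 : d02 = v 0 0 * v 2 1 - v 0 1 * v 2 0) (h03 : d03 = v 0 0 * v 3 1 - v 0 1 * v 3 0)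
    (h12 : d12 = v 1 0 * v 2 1 - v 1 1 * v 2 0) (h13 : d13 = v 1 0 * v 3 1 - v 1 1 * v 3 0) :
    volH3 (fun i => Projectivization.mk ℂ (v i) (hv i)) ≤ 2 * (hexRoot.im * sideVolume 1 1 1) ∧
    (volH3 (fun i => Projectivization.mk ℂ (v i) (hv i)) = 2 * (hexRoot.im * sideVolume 1 1 1) →
      d01 ≠ 0 ∧ d02 ≠ 0 ∧ d03 ≠ 0 ∧ d12 ≠ 0 ∧ d02 * d13 = hexRoot * (d03 * d12)) := by
  have hpos : 0 < 2 * (hexRoot.im * sideVolume 1 1 1) := by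
    have := hexRoot_im_pos
    have := sideVolume_pos one_pos one_pos one_pos
    positivity
  have hnp : volH3 (fun i => Projectivization.mk ℂ (v i) (hv i)) ≤ 0 →
      volH3 (fun i => Projectivization.mk ℂ (v i) (hv i)) ≤ 2 * (hexRoot.im * sideVolume 1 1 1) ∧
      (volH3 (fun i => Projectivization.mk ℂ (v i) (hv i)) = 2 * (hexRoot.im * sideVolume 1 1 1) →
      d01 ≠ 0 ∧ d02 ≠ 0 ∧ d03 ≠ 0 ∧ d12 ≠ 0 ∧ d02 * d13 = hexRoot * (d03 * d12)) :=
    fun h => ⟨by linarith, fun h' => by linarith⟩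
  have hplu : d02 * d13 = d01 * (v 2 0 * v 3 1 - v 2 1 * v 3 0) + d03 * d12 := by
    rw [h01, h02, h03, h12, h13]; ring
  have hreal : ∀ w : ℂ, (w * star w).im = 0 := fun w => by
    rw [RCLike.star_def, Complex.mul_conj]; exact Complex.ofReal_im _
  have hvol := volH3_mk v hv
  rw [← h02, ← h03, ← h12, ← h13] at hvol
  by_cases n01 : d01 = 0
  · refine hnp ?_
    -- If d01 vanishes, Plücker's relation gives d02 d13 = d03 d12, and a number times its own
    -- conjugate is real.
    rw [hvol, hplu, n01, zero_mul, zero_add, hreal]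
    simp
  by_cases n02 : d02 = 0
  · refine hnp ?_
    rw [hvol, n02]
    simp
  by_cases n03 : d03 = 0
  · refine hnp ?_
    rw [hvol, n03]
    simp
  by_cases n12 : d12 = 0
  · refine hnp ?_
    rw [hvol, n12]
    simp
  have hz : d02 * d13 = d02 * d13 / (d03 * d12) * (d03 * d12) := by field_simp
  have hvz := volH3_mk_eq_sideVolume v hv h01 h02 h03 h12 h13 rfl n01 n02 n03 n12 hz
  generalize d02 * d13 / (d03 * d12) = z at hz hvz
  rcases le_or_gt z.im 0 with him | him
  · refine hnp ?_
    rw [hvz]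
    have := mul_nonpos_of_nonpos_of_nonneg him
      (show 0 ≤ sideVolume 1 ‖z‖ ‖1 - z‖ from ENNReal.toReal_nonneg)
    linarith
  · obtain ⟨k1, k2⟩ := im_mul_sideVolume_le him
    rw [hvz]
    refine ⟨by linarith, fun h => ⟨n01, n02, n03, n12, ?_⟩⟩
    rw [hz, k2 (by linarith)]

theorem volH3_le (ξ : Fin 4 → PC2) : volH3 ξ ≤ 2 * (hexRoot.im * sideVolume 1 1 1) := by
  have := (volH3_mk_le (fun i => (ξ i).rep) (fun i => (ξ i).rep_nonzero) rfl rfl rfl rfl rfl).1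
  simpa only [Projectivization.mk_rep] using this

theorem vec2_one_ne_zero (z : ℂ) : (![z, 1] : Fin 2 → ℂ) ≠ 0 := fun h => one_ne_zero (congrFun h 1)

theorem vec2_infty_ne_zero : (![1, 0] : Fin 2 → ℂ) ≠ 0 := fun h => one_ne_zero (congrFun h 0)

/-- The vertices `∞, 0, 1, exp (π i / 3)` of a regular ideal tetrahedron. -/
noncomputable def regularVec : Fin 4 → Fin 2 → ℂ := ![![1, 0], ![0, 1], ![1, 1], ![hexRoot, 1]]

theorem regularVec_ne_zero (i : Fin 4) : regularVec i ≠ 0 := by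
  fin_cases i
  · exact vec2_infty_ne_zero
  all_goals exact vec2_one_ne_zero _

theorem volH3_regular : volH3 (fun i => Projectivization.mk ℂ (regularVec i) (regularVec_ne_zero i)) =
    2 * (hexRoot.im * sideVolume 1 1 1) := by
  rw [volH3_mk_eq_sideVolume regularVec regularVec_ne_zero (d01 := 1) (d02 := 1) (d03 := 1)
    (d12 := -1) (d13 := -hexRoot) (z := hexRoot) _ _ _ _ _ rfl, norm_hexRoot, norm_one_sub_hexRoot]
  all_goals simp [regularVec]

theorem v3_eq : v3 = 2 * (hexRoot.im * sideVolume 1 1 1) :=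
  IsGreatest.csSup_eq ⟨⟨_, volH3_regular⟩, by rintro _ ⟨ξ, rfl⟩; exact volH3_le ξ⟩

theorem volH3_le_v3 (ξ : Fin 4 → PC2) : volH3 ξ ≤ v3 := v3_eq ▸ volH3_le ξ

theorem v3_pos : 0 < v3 := by
  rw [v3_eq]
  have := hexRoot_im_pos
  have := sideVolume_pos one_pos one_pos one_pos
  positivity

/-- Vectors representing the vertices of a maximal simplex are, up to scalars, of the form
`x, y, x + y, ω x + y`. -/
theorem exists_basis_of_volH3_eq_v3 (v : Fin 4 → Fin 2 → ℂ) (hv : ∀ i, v i ≠ 0)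
    (h : volH3 (fun i => Projectivization.mk ℂ (v i) (hv i)) = v3) :
    ∃ (c : Fin 4 → ℂ) (x y : Fin 2 → ℂ), (∀ i, c i ≠ 0) ∧ x 0 * y 1 - x 1 * y 0 ≠ 0 ∧
      v 0 = c 0 • x ∧ v 1 = c 1 • y ∧ v 2 = c 2 • (x + y) ∧ v 3 = c 3 • (hexRoot • x + y) := by
  rw [v3_eq] at h
  obtain ⟨n01, n02, n03, n12, hz⟩ := (volH3_mk_le v hv rfl rfl rfl rfl rfl).2 h
  generalize hd01 : v 0 0 * v 1 1 - v 0 1 * v 1 0 = d01 at n01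
  generalize hd02 : v 0 0 * v 2 1 - v 0 1 * v 2 0 = d02 at n02 hz
  generalize hd03 : v 0 0 * v 3 1 - v 0 1 * v 3 0 = d03 at n03 hz
  generalize hd12 : v 1 0 * v 2 1 - v 1 1 * v 2 0 = d12 at n12 hz
  -- The scalars come from Cramer's rule d01 v₂ = -d12 v₀ + d02 v₁; once x + y represents the third
  -- vertex, the cross-ratio fixes the fourth.
  refine ⟨![-d01 / d12, d01 / d02, 1, d03 / d02], (-d12 / d01) • v 0, (d02 / d01) • v 1,
    fun i => ?_, ?_, ?_, ?_, ?_, ?_⟩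
  · fin_cases i <;> simp [*]
  · have : ((-d12 / d01) • v 0) 0 * ((d02 / d01) • v 1) 1 -
      ((-d12 / d01) • v 0) 1 * ((d02 / d01) • v 1) 0 = -(d12 * d02) / d01 := by
      simp only [Pi.smul_apply, smul_eq_mul]
      field_simp
      linear_combination -hd01
    rw [this]
    exact div_ne_zero (neg_ne_zero.mpr (mul_ne_zero n12 n02)) n01
  · simp only [smul_smul, Matrix.cons_val_zero]
    rw [show -d01 / d12 * (-d12 / d01) = 1 by field_simp, one_smul]
  · simp only [smul_smul, Matrix.cons_val_one, Matrix.cons_val_zero]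
    rw [show d01 / d02 * (d02 / d01) = 1 by field_simp, one_smul]
  · have key : d01 • v 2 = (-d12) • v 0 + d02 • v 1 := by
      ext i
      fin_cases i <;> simp [← hd01, ← hd12, ← hd02] <;> ring
    simp only [Matrix.cons_val, one_smul]
    rw [← inv_smul_smul₀ n01 (v 2), key, smul_add, smul_smul, smul_smul]
    simp only [div_eq_inv_mul]
  · have key : (d01 * d02) • v 3 = (-(hexRoot * (d03 * d12))) • v 0 + (d02 * d03) • v 1 := by
      rw [← hz]
      ext i
      fin_cases i <;> simp [← hd01, ← hd02, ← hd03] <;> ring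
    simp only [Matrix.cons_val]
    rw [← inv_smul_smul₀ (mul_ne_zero n01 n02) (v 3), key]
    simp only [smul_add, smul_smul]
    congr 2
    · field_simp
    · field_simp

/-! ### Counting the good indices of four flags -/

section FlagTuples

variable {K V : Type*} [Field K] [AddCommGroup V] [Module K V]

/-- The span of the spaces `F i (J i)` of four filtrations. -/
def flagSup (F : Fin 4 → ℕ → Submodule K V) (J : Fin 4 → ℕ) : Submodule K V := ⨆ i, F i (J i)

/-- Four complete flags, indexed by `ℕ` and constant from the dimension `n` on. -/
structure IsFlagTuple (n : ℕ) (F : Fin 4 → ℕ → Submodule K V) : Prop where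
  mono : ∀ i, Monotone (F i)
  finrank_eq : ∀ i j, j ≤ n → Module.finrank K (F i j) = j

/-- The index `J` is good when the four next vectors of the flags induce pairwise independent
vectors of a plane in the quotient by `flagSup F J`. -/
def IsGoodIndex (F : Fin 4 → ℕ → Submodule K V) (J : Fin 4 → ℕ) : Prop :=
  (∀ i k, i ≠ k → ¬ F i (J i + 1) ≤ flagSup F (J + Pi.single k 1)) ∧
  (∀ i k l, i ≠ k → F l (J l + 1) ≤ flagSup F (J + Pi.single i 1 + Pi.single k 1))

variable {F : Fin 4 → ℕ → Submodule K V} {n : ℕ}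

theorem le_flagSup (F : Fin 4 → ℕ → Submodule K V) (J : Fin 4 → ℕ) (i : Fin 4) :
    F i (J i) ≤ flagSup F J := le_iSup (fun i => F i (J i)) i

theorem flagSup_mono (hF : ∀ i, Monotone (F i)) {J J' : Fin 4 → ℕ} (h : J ≤ J') :
    flagSup F J ≤ flagSup F J' := iSup_mono fun i => hF i (h i)

theorem flagSup_comp (σ : Equiv.Perm (Fin 4)) (J : Fin 4 → ℕ) :
    flagSup (F ∘ σ) (J ∘ σ) = flagSup F J := σ.iSup_comp (g := fun i => F i (J i))

theorem add_comp_perm (σ : Equiv.Perm (Fin 4)) (J L : Fin 4 → ℕ) :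
    (J + L) ∘ σ = J ∘ σ + L ∘ σ := rfl

theorem single_comp_perm (σ : Equiv.Perm (Fin 4)) (k : Fin 4) :
    (Pi.single k 1 : Fin 4 → ℕ) = Pi.single (σ k) 1 ∘ σ := by
  ext i
  simp [Pi.single_apply]

theorem IsGoodIndex.comp (σ : Equiv.Perm (Fin 4)) {J : Fin 4 → ℕ} (h : IsGoodIndex F J) :
    IsGoodIndex (F ∘ σ) (J ∘ σ) := by
  refine ⟨fun i k hik => ?_, fun i k l hik => ?_⟩
  · rw [single_comp_perm σ k]
    rw [← add_comp_perm, flagSup_comp]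
    exact h.1 _ _ (σ.injective.ne hik)
  · rw [single_comp_perm σ k, single_comp_perm σ i]
    rw [← add_comp_perm, ← add_comp_perm, flagSup_comp]
    exact h.2 _ _ _ (σ.injective.ne hik)

theorem IsFlagTuple.comp (σ : Equiv.Perm (Fin 4)) (h : IsFlagTuple n F) :
    IsFlagTuple n (F ∘ σ) :=
  ⟨fun i => h.mono (σ i), fun i => h.finrank_eq (σ i)⟩

theorem add_single_le {J L : Fin 4 → ℕ} (h : J ≤ L) {i : Fin 4} (hi : J i < L i) :
    J + Pi.single i 1 ≤ L := by
  intro m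
  by_cases hm : m = i
  · subst hm
    simpa using hi
  · simpa [hm] using h m

/-- Distinct comparable good indices differ in every coordinate. -/
theorem IsGoodIndex.lt_of_le_of_ne (hF : ∀ i, Monotone (F i)) {J J' : Fin 4 → ℕ}
    (hJ : IsGoodIndex F J) (hJ' : IsGoodIndex F J') (hle : J ≤ J') (hne : J ≠ J') (l : Fin 4) :
    J l < J' l := by
  by_contra hl
  have hl : J l = J' l := le_antisymm (hle l) (not_lt.mp hl)
  obtain ⟨i, hi⟩ : ∃ i, J i < J' i := by
    by_contra! h
    exact hne (le_antisymm hle h)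
  have hil : l ≠ i := by rintro rfl; omega
  obtain ⟨k, hki, hkl⟩ : ∃ k : Fin 4, k ≠ i ∧ k ≠ l := by
    clear * -
    revert i l; decide
  -- Goodness of J puts the next space of F l into the sum at J + eᵢ + eₖ, which lies in the sum at
  -- J' + eᵢ or at J' + eₖ; since J l = J' l, this contradicts goodness of J'.
  have h2 := hJ.2 i k l hki.symm
  rw [hl] at h2
  rcases (hle k).lt_or_eq with hk | hk
  · refine hJ'.1 l i hil (h2.trans (flagSup_mono hF ?_))
    refine le_trans (add_single_le (add_single_le hle hi) ?_) (le_add_of_nonneg_right zero_le)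
    simpa [hki] using hk
  · exact hJ'.1 l k hkl.symm (h2.trans (flagSup_mono hF
      (add_le_add_left (add_single_le hle hi) _)))

theorem IsGoodIndex.not_le {J : Fin 4 → ℕ} (hF : ∀ i, Monotone (F i)) (hJ : IsGoodIndex F J)
    (i : Fin 4) : ¬ F i (J i + 1) ≤ flagSup F J := by
  obtain ⟨k, hk⟩ : ∃ k : Fin 4, i ≠ k := by revert i; decide
  exact fun h => hJ.1 i k hk (h.trans (flagSup_mono hF (le_add_of_nonneg_right (zero_le))))

/-- The dimension of the sum of the first spaces of four flags. -/
noncomputable def flagDim (F : Fin 4 → ℕ → Submodule K V) (J : Fin 4 → ℕ) : ℕ :=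
  Module.finrank K (flagSup F J)

section Finite

variable [FiniteDimensional K V]

theorem flagDim_mono (hF : ∀ i, Monotone (F i)) {J J' : Fin 4 → ℕ} (h : J ≤ J') :
    flagDim F J ≤ flagDim F J' := Submodule.finrank_mono (flagSup_mono hF h)

theorem flagDim_lt (hF : ∀ i, Monotone (F i)) {J J' : Fin 4 → ℕ} (h : J ≤ J') (i : Fin 4)
    (hi : ¬ F i (J' i) ≤ flagSup F J) : flagDim F J < flagDim F J' :=
  Submodule.finrank_lt_finrank_of_lt (lt_of_le_of_ne (flagSup_mono hF h)
    fun he => hi (he ▸ le_flagSup F J' i))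

theorem IsGoodIndex.flagDim_add_two_le (hF : ∀ i, Monotone (F i)) {J : Fin 4 → ℕ}
    (hJ : IsGoodIndex F J) : flagDim F J + 2 ≤ Module.finrank K V := by
  have h1 : flagDim F J < flagDim F (J + Pi.single 0 1) :=
    flagDim_lt hF (le_add_of_nonneg_right (zero_le)) 0 (by simpa using hJ.not_le hF 0)
  have h2 : flagDim F (J + Pi.single 0 1) < flagDim F (J + Pi.single 0 1 + Pi.single 1 1) :=
    flagDim_lt hF (le_add_of_nonneg_right (zero_le)) 1 (by
      simpa using hJ.1 1 0 (by decide))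
  have h3 : flagDim F (J + Pi.single 0 1 + Pi.single 1 1) ≤ Module.finrank K V :=
    Submodule.finrank_le _
  omega

theorem flagDim_add_single_le (hF : IsFlagTuple n F) (J : Fin 4 → ℕ) (i : Fin 4) (hi : J i = 0)
    (m : ℕ) (hm : m ≤ n) : flagDim F (J + Pi.single i m) ≤ flagDim F J + m := by
  have h : flagSup F (J + Pi.single i m) ≤ flagSup F J ⊔ F i m := by
    refine iSup_le fun k => ?_
    by_cases hk : k = i
    · subst hk
      simp [hi]
    · simp only [Pi.add_apply, Pi.single_eq_of_ne hk, add_zero]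
      exact (le_flagSup F J k).trans le_sup_left
  refine (Submodule.finrank_mono h).trans ((Submodule.finrank_add_le_finrank_add_finrank _ _).trans ?_)
  rw [hF.finrank_eq i m hm]
  rfl

end Finite

/-- The good indices, all of whose coordinates are smaller than `n`. -/
noncomputable def goodIndices (n : ℕ) (F : Fin 4 → ℕ → Submodule K V) : Finset (Fin 4 → ℕ) :=
  open Classical in
  (Fintype.piFinset fun _ => Finset.range n).filter (IsGoodIndex F)

theorem mem_goodIndices {J : Fin 4 → ℕ} :
    J ∈ goodIndices n F ↔ (∀ i, J i < n) ∧ IsGoodIndex F J := by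
  simp [goodIndices]

theorem goodIndices_comp (σ : Equiv.Perm (Fin 4)) (J : Fin 4 → ℕ) :
    J ∘ σ ∈ goodIndices n (F ∘ σ) ↔ J ∈ goodIndices n F := by
  rw [mem_goodIndices, mem_goodIndices]
  refine and_congr ⟨fun h i => ?_, fun h i => h _⟩ ⟨fun h => ?_, fun h => h.comp σ⟩
  · simpa using h (σ.symm i)
  · have := h.comp σ.symm
    simpa [Function.comp_assoc] using this

/-- The increments of the dimensions of the spans of the spaces of the flags `3`, `2`, `1`. -/
noncomputable def dimIncrements (n : ℕ) (F : Fin 4 → ℕ → Submodule K V) (J : Fin 4 → ℕ) :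
    Fin 4 → ℕ :=
  ![n - 2 - flagDim F ![0, J 1, J 2, J 3],
    flagDim F ![0, J 1, J 2, J 3] - flagDim F ![0, 0, J 2, J 3],
    flagDim F ![0, 0, J 2, J 3] - J 3, J 3]

variable [FiniteDimensional K V]

theorem flagDim_three (hF : IsFlagTuple n F) (m : ℕ) (hm : m ≤ n) : flagDim F ![0, 0, 0, m] = m := by
  have h : ∀ i, F i 0 = ⊥ := fun i => by
    rw [← Submodule.finrank_eq_zero (R := K), hF.finrank_eq i 0 (Nat.zero_le _)]
  have : flagSup F ![0, 0, 0, m] = F 3 m := by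
    refine le_antisymm (iSup_le fun i => ?_) (le_flagSup F ![0, 0, 0, m] 3)
    fin_cases i <;> simp [h]
  rw [flagDim, this, hF.finrank_eq 3 m hm]

theorem vec_le {J : Fin 4 → ℕ} {a b c d : ℕ} (h0 : a ≤ J 0) (h1 : b ≤ J 1) (h2 : c ≤ J 2)
    (h3 : d ≤ J 3) : ![a, b, c, d] ≤ J := by
  intro i
  fin_cases i <;> assumption

/-- Adding the flags one at a time, F i (J i) raises the dimension by at most J i; the last bound
leaves room for the plane quotient. -/
theorem dims_of_good (hF : IsFlagTuple n F) (hV : Module.finrank K V = n) {J : Fin 4 → ℕ}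
    (hJn : ∀ i, J i < n) (hJ : IsGoodIndex F J) :
    J 3 ≤ flagDim F ![0, 0, J 2, J 3] ∧
    flagDim F ![0, 0, J 2, J 3] ≤ J 3 + J 2 ∧
    flagDim F ![0, 0, J 2, J 3] ≤ flagDim F ![0, J 1, J 2, J 3] ∧
    flagDim F ![0, J 1, J 2, J 3] ≤ flagDim F ![0, 0, J 2, J 3] + J 1 ∧
    flagDim F ![0, J 1, J 2, J 3] + 2 ≤ n := by
  have h3 := flagDim_three hF (J 3) (hJn 3).le
  refine ⟨?_, ?_, ?_, ?_, ?_⟩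
  · rw [← h3]
    refine flagDim_mono hF.mono (vec_le ?_ ?_ ?_ ?_) <;> simp [h3]
  · have := flagDim_add_single_le hF ![0, 0, 0, J 3] 2 (by simp) (J 2) (hJn 2).le
    rw [h3] at this
    convert this using 2
    ext i; fin_cases i <;> simp
  · exact flagDim_mono hF.mono (vec_le (by simp) (by simp) (by simp) (by simp))
  · have := flagDim_add_single_le hF ![0, 0, J 2, J 3] 1 (by simp) (J 1) (hJn 1).le
    convert this using 2
    ext i; fin_cases i <;> simp
  · rw [← hV]
    refine le_trans ?_ (hJ.flagDim_add_two_le hF.mono)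
    have := flagDim_mono hF.mono (show ![0, J 1, J 2, J 3] ≤ J from
      vec_le (by simp) le_rfl le_rfl le_rfl)
    omega

theorem dimIncrements_mem (hF : IsFlagTuple n F) (hV : Module.finrank K V = n) {J : Fin 4 → ℕ}
    (hJ : J ∈ goodIndices n F) :
    dimIncrements n F J ∈ Finset.piAntidiag Finset.univ (n - 2) := by
  rw [mem_goodIndices] at hJ
  obtain ⟨h1, h2, h3, h4, h5⟩ := dims_of_good hF hV hJ.1 hJ.2
  rw [Finset.mem_piAntidiag]
  refine ⟨?_, fun _ _ => Finset.mem_univ _⟩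
  rw [Fin.sum_univ_four]
  simp only [dimIncrements, Matrix.cons_val_zero, Matrix.cons_val_one, Matrix.cons_val]
  omega

/-- J 3 is read off directly. At a good index the next vector of each flag is new, so the dimension
grows strictly with J 2, and then with J 1, which recovers both. Two good indices differing at most
in coordinate 0 are comparable and agree elsewhere, hence are equal. -/
theorem dimIncrements_injOn (hF : IsFlagTuple n F) (hV : Module.finrank K V = n) :
    Set.InjOn (dimIncrements n F) (goodIndices n F) := by
  have key : ∀ J ∈ goodIndices n F, ∀ J' ∈ goodIndices n F,
      dimIncrements n F J = dimIncrements n F J' → ∀ i : Fin 4, J i ≤ J' i := by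
    intro J hJ J' hJ' heq
    rw [mem_goodIndices] at hJ hJ'
    obtain ⟨h1, h2, h3, h4, h5⟩ := dims_of_good hF hV hJ.1 hJ.2
    obtain ⟨h1', h2', h3', h4', h5'⟩ := dims_of_good hF hV hJ'.1 hJ'.2
    have e3 : J 3 = J' 3 := congrFun heq 3
    have e2 : flagDim F ![0, 0, J 2, J 3] - J 3 = flagDim F ![0, 0, J' 2, J' 3] - J' 3 :=
      congrFun heq 2
    have e1 : flagDim F ![0, J 1, J 2, J 3] - flagDim F ![0, 0, J 2, J 3] =
      flagDim F ![0, J' 1, J' 2, J' 3] - flagDim F ![0, 0, J' 2, J' 3] := congrFun heq 1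
    have key2 : ∀ L L' : Fin 4 → ℕ, IsGoodIndex F L → L 3 = L' 3 → L 2 < L' 2 →
        flagDim F ![0, 0, L 2, L 3] < flagDim F ![0, 0, L' 2, L' 3] := by
      intro L L' hL e3 hlt
      refine flagDim_lt hF.mono (vec_le (by simp) (by simp) (by simpa using hlt.le) (by simp [e3])) 2
        fun h => hL.not_le hF.mono 2 (((hF.mono 2) hlt).trans (h.trans
          (flagSup_mono hF.mono (vec_le (by simp) (by simp) le_rfl le_rfl))))
    have key1 : ∀ L L' : Fin 4 → ℕ, IsGoodIndex F L → L 3 = L' 3 → L 2 = L' 2 → L 1 < L' 1 →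
        flagDim F ![0, L 1, L 2, L 3] < flagDim F ![0, L' 1, L' 2, L' 3] := by
      intro L L' hL e3 e2 hlt
      refine flagDim_lt hF.mono (vec_le (by simp) (by simpa using hlt.le) (by simp [e2])
        (by simp [e3])) 1
        fun h => hL.not_le hF.mono 1 (((hF.mono 1) hlt).trans (h.trans
          (flagSup_mono hF.mono (vec_le (by simp) le_rfl le_rfl le_rfl))))
    have e2' : J 2 = J' 2 := by
      rcases lt_trichotomy (J 2) (J' 2) with h | h | h
      · have := key2 J J' hJ.2 e3 h; omega
      · exact h
      · have := key2 J' J hJ'.2 e3.symm h; omega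
    rw [e2', e3] at e1 h3
    have e1' : J 1 = J' 1 := by
      rcases lt_trichotomy (J 1) (J' 1) with h | h | h
      · have := key1 J J' hJ.2 e3 e2' h
        rw [e2', e3] at this; omega
      · exact h
      · have := key1 J' J hJ'.2 e3.symm e2'.symm h
        rw [e2', e3] at this; omega
    have e0 : J 0 ≤ J' 0 := by
      by_contra! h
      have := hJ'.2.lt_of_le_of_ne hF.mono hJ.2 (fun i => by fin_cases i <;> simp <;> omega)
        (fun h' => by rw [h'] at h; exact lt_irrefl _ h) 1
      omega
    intro i
    fin_cases i <;> simp <;> omega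
  intro J hJ J' hJ' heq
  exact le_antisymm (key J hJ J' hJ' heq) (key J' hJ' J hJ heq.symm)

theorem card_goodIndices_le (hF : IsFlagTuple n F) (hV : Module.finrank K V = n) :
    (goodIndices n F).card ≤ (Finset.piAntidiag (Finset.univ : Finset (Fin 4)) (n - 2)).card :=
  Finset.card_le_card_of_injOn _ (fun _ hJ => dimIncrements_mem hF hV hJ)
    (dimIncrements_injOn hF hV)

theorem sum_piAntidiag_comm (m : ℕ) (i k : Fin 4) :
    ∑ d ∈ Finset.piAntidiag (Finset.univ : Finset (Fin 4)) m, d i =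
      ∑ d ∈ Finset.piAntidiag (Finset.univ : Finset (Fin 4)) m, d k := by
  refine Finset.sum_nbij' (fun d => d ∘ Equiv.swap i k) (fun d => d ∘ Equiv.swap i k) ?_ ?_ ?_ ?_ ?_
  · intro d hd
    rw [Finset.mem_piAntidiag] at hd ⊢
    exact ⟨(Equiv.sum_comp (Equiv.swap i k) d).trans hd.1, fun _ _ => Finset.mem_univ _⟩
  · intro d hd
    rw [Finset.mem_piAntidiag] at hd ⊢
    exact ⟨(Equiv.sum_comp (Equiv.swap i k) d).trans hd.1, fun _ _ => Finset.mem_univ _⟩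
  · intro d _; ext; simp
  · intro d _; ext; simp
  · intro d _; simp

omit [FiniteDimensional K V] in
theorem exists_goodIndices_comp (σ : Equiv.Perm (Fin 4)) {J : Fin 4 → ℕ}
    (hJ : J ∈ goodIndices n (F ∘ σ)) : ∃ L, ∃ _ : L ∈ goodIndices n F, L ∘ σ = J := by
  have e : (J ∘ σ.symm) ∘ σ = J := by
    rw [Function.comp_assoc, Equiv.symm_comp_self, Function.comp_id]
  exact ⟨J ∘ σ.symm, (goodIndices_comp σ _).mp (e.symm ▸ hJ), e⟩

omit [FiniteDimensional K V] in
theorem card_goodIndices_comp (σ : Equiv.Perm (Fin 4)) :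
    (goodIndices n (F ∘ σ)).card = (goodIndices n F).card :=
  (Finset.card_bij (fun J _ => J ∘ σ) (fun J hJ => (goodIndices_comp σ J).mpr hJ)
    (fun _ _ _ _ h => σ.surjective.injective_comp_right h)
    (fun _ hJ => exists_goodIndices_comp σ hJ)).symm

theorem sum_dimIncrements (hF : IsFlagTuple n F) (hV : Module.finrank K V = n)
    (hcard : (Finset.piAntidiag (Finset.univ : Finset (Fin 4)) (n - 2)).card ≤
      (goodIndices n F).card) (i : Fin 4) :
    ∑ J ∈ goodIndices n F, dimIncrements n F J i =
      ∑ d ∈ Finset.piAntidiag (Finset.univ : Finset (Fin 4)) (n - 2), d i := by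
  have himg : (goodIndices n F).image (dimIncrements n F) =
      Finset.piAntidiag (Finset.univ : Finset (Fin 4)) (n - 2) := by
    refine Finset.eq_of_subset_of_card_le ?_ ?_
    · exact Finset.image_subset_iff.mpr fun J hJ => dimIncrements_mem hF hV hJ
    · rwa [Finset.card_image_of_injOn (dimIncrements_injOn hF hV)]
  rw [← himg, Finset.sum_image (dimIncrements_injOn hF hV)]

/-- The last increment is the coordinate J 3 itself, so its sum is known when the count is maximal;
permuting the flags moves any coordinate to the last place. -/
theorem sum_goodIndices (hF : IsFlagTuple n F) (hV : Module.finrank K V = n)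
    (hcard : (Finset.piAntidiag (Finset.univ : Finset (Fin 4)) (n - 2)).card ≤
      (goodIndices n F).card) (i : Fin 4) :
    ∑ J ∈ goodIndices n F, J i =
      ∑ d ∈ Finset.piAntidiag (Finset.univ : Finset (Fin 4)) (n - 2), d 3 := by
  have h := sum_dimIncrements (F := F ∘ Equiv.swap i 3) (hF.comp _) hV
    (by rwa [card_goodIndices_comp]) 3
  rw [← h]
  refine Finset.sum_bij (fun J _ => J ∘ Equiv.swap i 3) ?_ ?_ ?_ ?_
  · exact fun J hJ => (goodIndices_comp _ J).mpr hJ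
  · exact fun J _ J' _ h => (Equiv.swap i 3).surjective.injective_comp_right h
  · exact fun _ hJ => exists_goodIndices_comp _ hJ
  · intro J _
    simp [dimIncrements]

/-- The increments are bounded by the coordinates, and both have the same sum over the good indices,
so they agree term by term. -/
theorem dimIncrements_eq (hF : IsFlagTuple n F) (hV : Module.finrank K V = n)
    (hcard : (Finset.piAntidiag (Finset.univ : Finset (Fin 4)) (n - 2)).card ≤
      (goodIndices n F).card)
    {J : Fin 4 → ℕ} (hJ : J ∈ goodIndices n F) :
    flagDim F ![0, J 1, J 2, J 3] = J 1 + J 2 + J 3 ∧ J 1 + J 2 + J 3 ≤ n - 2 ∧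
      dimIncrements n F J = ![n - 2 - (J 1 + J 2 + J 3), J 1, J 2, J 3] := by
  have h2 : ∀ J ∈ goodIndices n F, dimIncrements n F J 2 = J 2 := by
    refine (Finset.sum_eq_sum_iff_of_le fun J hJ => ?_).mp ?_
    · obtain ⟨h1, h2, h3, h4, h5⟩ := dims_of_good hF hV (mem_goodIndices.mp hJ).1
        (mem_goodIndices.mp hJ).2
      simp only [dimIncrements, Matrix.cons_val]
      omega
    · rw [sum_dimIncrements hF hV hcard, sum_goodIndices hF hV hcard]
      exact sum_piAntidiag_comm _ _ _
  have h1 : ∀ J ∈ goodIndices n F, dimIncrements n F J 1 = J 1 := by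
    refine (Finset.sum_eq_sum_iff_of_le fun J hJ => ?_).mp ?_
    · obtain ⟨h1, h2, h3, h4, h5⟩ := dims_of_good hF hV (mem_goodIndices.mp hJ).1
        (mem_goodIndices.mp hJ).2
      simp only [dimIncrements, Matrix.cons_val_one, Matrix.cons_val_zero]
      omega
    · rw [sum_dimIncrements hF hV hcard, sum_goodIndices hF hV hcard]
      exact sum_piAntidiag_comm _ _ _
  have e2 := h2 J hJ
  have e1 := h1 J hJ
  obtain ⟨k1, k2, k3, k4, k5⟩ := dims_of_good hF hV (mem_goodIndices.mp hJ).1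
        (mem_goodIndices.mp hJ).2
  have e1' := e1
  have e2' := e2
  simp only [dimIncrements, Matrix.cons_val_one, Matrix.cons_val_zero, Matrix.cons_val] at e1' e2'
  have e0 : flagDim F ![0, J 1, J 2, J 3] = J 1 + J 2 + J 3 := by omega
  refine ⟨e0, by omega, ?_⟩
  ext i
  fin_cases i
  · simp [dimIncrements, e0]
  · exact e1
  · exact e2
  · rfl

theorem exists_goodIndex (hF : IsFlagTuple n F) (hV : Module.finrank K V = n)
    (hcard : (Finset.piAntidiag (Finset.univ : Finset (Fin 4)) (n - 2)).card ≤
      (goodIndices n F).card)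
    {a b c : ℕ} (habc : a + b + c ≤ n - 2) :
    ∃ J ∈ goodIndices n F, J 1 = a ∧ J 2 = b ∧ J 3 = c := by
  have himg : (goodIndices n F).image (dimIncrements n F) =
      Finset.piAntidiag (Finset.univ : Finset (Fin 4)) (n - 2) := by
    refine Finset.eq_of_subset_of_card_le ?_ ?_
    · exact Finset.image_subset_iff.mpr fun J hJ => dimIncrements_mem hF hV hJ
    · rwa [Finset.card_image_of_injOn (dimIncrements_injOn hF hV)]
  have hmem : ![n - 2 - (a + b + c), a, b, c] ∈
      Finset.piAntidiag (Finset.univ : Finset (Fin 4)) (n - 2) := by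
    rw [Finset.mem_piAntidiag]
    refine ⟨?_, fun _ _ => Finset.mem_univ _⟩
    rw [Fin.sum_univ_four]
    simp only [Matrix.cons_val_zero, Matrix.cons_val_one, Matrix.cons_val]
    omega
  rw [← himg, Finset.mem_image] at hmem
  obtain ⟨J, hJ, hJe⟩ := hmem
  rw [(dimIncrements_eq hF hV hcard hJ).2.2] at hJe
  exact ⟨J, hJ, congrFun hJe 1, congrFun hJe 2, congrFun hJe 3⟩

omit [FiniteDimensional K V] in
theorem eq_of_mem_goodIndices (hF : IsFlagTuple n F) {J J' : Fin 4 → ℕ}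
    (hJ : J ∈ goodIndices n F) (hJ' : J' ∈ goodIndices n F) (h1 : J 1 = J' 1) (h2 : J 2 = J' 2)
    (h3 : J 3 = J' 3) : J = J' := by
  have key : ∀ L ∈ goodIndices n F, ∀ L' ∈ goodIndices n F, L 1 = L' 1 → L 2 = L' 2 →
      L 3 = L' 3 → L 0 ≤ L' 0 → L = L' := by
    intro L hL L' hL' h1 h2 h3 h0
    by_contra hne
    have := (mem_goodIndices.mp hL).2.lt_of_le_of_ne hF.mono (mem_goodIndices.mp hL').2
      (fun i => by fin_cases i <;> simp <;> omega) hne 1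
    omega
  rcases le_total (J 0) (J' 0) with h | h
  · exact key J hJ J' hJ' h1 h2 h3 h
  · exact (key J' hJ' J hJ h1.symm h2.symm h3.symm h).symm

theorem eq_sub_of_strictAntiOn {R : ℕ} {f : ℕ → ℕ} (h0 : f 0 ≤ R)
    (hf : ∀ i < R, f (i + 1) < f i) {i : ℕ} (hi : i ≤ R) : f i + i = R := by
  have h1 : ∀ i ≤ R, f i + i ≤ R := by
    intro i
    induction i with
    | zero => intro _; simpa using h0
    | succ k ih =>
      intro hk
      have := ih (by omega)
      have := hf k (by omega)
      omega
  have h2 : ∀ j ≤ R, j ≤ f (R - j) := by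
    intro j
    induction j with
    | zero => intro _; exact Nat.zero_le _
    | succ k ih =>
      intro hk
      have := ih (by omega)
      have := hf (R - (k + 1)) (by omega)
      rw [show R - (k + 1) + 1 = R - k by omega] at this
      omega
  have := h1 i hi
  have := h2 (R - i) (by omega)
  rw [show R - (R - i) = i by omega] at this
  omega

/-- Fix J 2 and J 3 and put R = n - 2 - (J 2 + J 3). For each i ≤ R there is a good index with J 1 =
i, and its J 0 decreases strictly in i, since otherwise two good indices would be comparable while
sharing a coordinate. A strictly decreasing sequence of R + 1 naturals starting at most at R is R -
i. -/
theorem sum_of_mem_goodIndices (hF : IsFlagTuple n F) (hV : Module.finrank K V = n)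
    (hcard : (Finset.piAntidiag (Finset.univ : Finset (Fin 4)) (n - 2)).card ≤
      (goodIndices n F).card)
    {J : Fin 4 → ℕ} (hJ : J ∈ goodIndices n F) : J 0 + J 1 + J 2 + J 3 = n - 2 := by
  have hle := (dimIncrements_eq hF hV hcard hJ).2.1
  have hex : ∀ i, ∃ L, i ≤ n - 2 - (J 2 + J 3) → L ∈ goodIndices n F ∧ L 1 = i ∧ L 2 = J 2 ∧
      L 3 = J 3 := by
    intro i
    by_cases hi : i ≤ n - 2 - (J 2 + J 3)
    · obtain ⟨L, hL, h⟩ := exists_goodIndex hF hV hcard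
        (show i + J 2 + J 3 ≤ n - 2 by omega)
      exact ⟨L, fun _ => ⟨hL, h⟩⟩
    · exact ⟨0, fun h => absurd h hi⟩
  choose L hL using hex
  have hfin := eq_sub_of_strictAntiOn (R := n - 2 - (J 2 + J 3)) (f := fun i => L i 0) ?_ ?_
    (i := J 1) (by omega)
  · obtain ⟨h0, h1, h2, h3⟩ := hL (J 1) (by omega)
    have := eq_of_mem_goodIndices hF h0 hJ h1 h2 h3
    simp only [this] at hfin
    omega
  · obtain ⟨h0, h1, h2, h3⟩ := hL 0 (by omega)
    -- Exchanging flags 0 and 1 gives J 0 + J 2 + J 3 ≤ n - 2, the bound on the first term of the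
    -- sequence.
    have := (dimIncrements_eq (F := F ∘ Equiv.swap 0 1) (hF.comp _) hV
      (by rwa [card_goodIndices_comp]) ((goodIndices_comp (Equiv.swap 0 1) _).mpr h0)).2.1
    have e2 : (Equiv.swap 0 1 : Equiv.Perm (Fin 4)) 2 = 2 := by decide
    have e3 : (Equiv.swap 0 1 : Equiv.Perm (Fin 4)) 3 = 3 := by decide
    simp only [Function.comp_apply, Equiv.swap_apply_right, e2, e3, h2, h3] at this
    omega
  · intro i hi
    obtain ⟨h0, h1, h2, h3⟩ := hL i hi.le
    obtain ⟨h0', h1', h2', h3'⟩ := hL (i + 1) hi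
    by_contra! hlt
    have := (mem_goodIndices.mp h0).2.lt_of_le_of_ne hF.mono (mem_goodIndices.mp h0').2
      (fun m => by fin_cases m <;> simp <;> omega) (fun h => by rw [h] at h1; omega) 2
    omega

/-- If the number of good indices is maximal, then they are those of the generic situation. -/
theorem goodIndices_eq (hF : IsFlagTuple n F) (hV : Module.finrank K V = n)
    (hcard : (Finset.piAntidiag (Finset.univ : Finset (Fin 4)) (n - 2)).card ≤
      (goodIndices n F).card) :
    goodIndices n F = Finset.piAntidiag (Finset.univ : Finset (Fin 4)) (n - 2) := by
  refine Finset.eq_of_subset_of_card_le (fun J hJ => ?_) hcard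
  rw [Finset.mem_piAntidiag, Fin.sum_univ_four]
  exact ⟨sum_of_mem_goodIndices hF hV hcard hJ, fun _ _ => Finset.mem_univ _⟩

end FlagTuples

/-! ### Rigidity of regular tuples -/

section Rigidity

variable {K V : Type*} [Field K] [AddCommGroup V] [Module K V]

theorem Submodule.mem_sup_span_singleton_iff {W : Submodule K V} {x y : V} :
    x ∈ W ⊔ (K ∙ y) ↔ ∃ c : K, x - c • y ∈ W := by
  rw [Submodule.mem_sup]
  constructor
  · rintro ⟨w, hw, z, hz, rfl⟩
    obtain ⟨c, rfl⟩ := Submodule.mem_span_singleton.mp hz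
    exact ⟨c, by simpa using hw⟩
  · rintro ⟨c, hc⟩
    exact ⟨_, hc, c • y, Submodule.smul_mem _ _ (Submodule.mem_span_singleton_self y), by abel⟩

theorem Submodule.sup_span_singleton_eq_of_sub_mem {W : Submodule K V} {x y : V} {c : K}
    (hc : c ≠ 0) (h : x - c • y ∈ W) : W ⊔ (K ∙ x) = W ⊔ (K ∙ y) := by
  refine le_antisymm (sup_le le_sup_left ?_) (sup_le le_sup_left ?_)
  · rw [Submodule.span_singleton_le_iff_mem]
    exact Submodule.mem_sup_span_singleton_iff.mpr ⟨c, h⟩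
  · rw [Submodule.span_singleton_le_iff_mem]
    refine Submodule.mem_sup_span_singleton_iff.mpr ⟨c⁻¹, ?_⟩
    have := W.smul_mem (-c⁻¹) h
    rwa [smul_sub, smul_smul, neg_mul, inv_mul_cancel₀ hc, neg_smul, neg_smul, one_smul,
      sub_neg_eq_add, neg_add_eq_sub] at this

/-- Four spaces containing `W` that induce in the quotient by `W` four lines of a plane with
cross-ratio `ω`: the lines of `e`, `f`, `e + f` and `ω e + f`. -/
def IsRegQuad (ω : K) (W : Submodule K V) (L : Fin 4 → Submodule K V) : Prop :=
  ∃ e f : V, (∀ a b : K, a • e + b • f ∈ W → a = 0 ∧ b = 0) ∧ L 0 = W ⊔ (K ∙ e) ∧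
    L 1 = W ⊔ (K ∙ f) ∧ L 2 = W ⊔ (K ∙ (e + f)) ∧ L 3 = W ⊔ (K ∙ (ω • e + f))

variable {ω : K} {W : Submodule K V} {L L' : Fin 4 → Submodule K V}

/-- The common lines L 0 and L 1 give e' ≡ l e and f' ≡ m f modulo W. A third common line forces l =
m, after which all four lines coincide. -/
theorem IsRegQuad.eq_of_eq (hω : ω ≠ 0) (h : IsRegQuad ω W L) (h' : IsRegQuad ω W L')
    (h0 : L 0 = L' 0) (h1 : L 1 = L' 1) (h23 : L 2 = L' 2 ∨ L 3 = L' 3) : L = L' := by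
  obtain ⟨e, f, hef, e0, e1, e2, e3⟩ := h
  obtain ⟨e', f', hef', e0', e1', e2', e3'⟩ := h'
  obtain ⟨l, hl⟩ : ∃ c : K, e' - c • e ∈ W := by
    rw [← Submodule.mem_sup_span_singleton_iff, ← e0, h0, e0']
    exact Submodule.mem_sup_right (Submodule.mem_span_singleton_self _)
  obtain ⟨m, hm⟩ : ∃ c : K, f' - c • f ∈ W := by
    rw [← Submodule.mem_sup_span_singleton_iff, ← e1, h1, e1']
    exact Submodule.mem_sup_right (Submodule.mem_span_singleton_self _)
  have hl0 : l ≠ 0 := by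
    rintro rfl
    exact one_ne_zero (hef' 1 0 (by simpa using hl)).1
  have hlm : l = m := by
    rcases h23 with h2 | h3
    · obtain ⟨c, hc⟩ : ∃ c : K, e + f - c • (e' + f') ∈ W := by
        rw [← Submodule.mem_sup_span_singleton_iff, ← e2', ← h2, e2]
        exact Submodule.mem_sup_right (Submodule.mem_span_singleton_self _)
      have := hef (1 - c * l) (1 - c * m) (by
        have := W.add_mem hc (W.add_mem (W.smul_mem c hl) (W.smul_mem c hm))
        convert this using 1
        module)
      have h1 : c * l = c * m := by rw [← sub_eq_zero.mp this.1, ← sub_eq_zero.mp this.2]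
      refine mul_left_cancel₀ ?_ h1
      rintro rfl
      simp at this
    · obtain ⟨c, hc⟩ : ∃ c : K, ω • e + f - c • (ω • e' + f') ∈ W := by
        rw [← Submodule.mem_sup_span_singleton_iff, ← e3', ← h3, e3]
        exact Submodule.mem_sup_right (Submodule.mem_span_singleton_self _)
      have := hef (ω * (1 - c * l)) (1 - c * m) (by
        have := W.add_mem hc (W.add_mem (W.smul_mem (c * ω) hl) (W.smul_mem c hm))
        convert this using 1
        module)
      have h1 : c * l = c * m := by
        rw [← sub_eq_zero.mp ((mul_eq_zero.mp this.1).resolve_left hω), ← sub_eq_zero.mp this.2]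
      refine mul_left_cancel₀ ?_ h1
      rintro rfl
      simp at this
  subst hlm
  funext i
  fin_cases i
  · exact h0
  · exact h1
  · change L 2 = L' 2
    rw [e2, e2']
    refine (Submodule.sup_span_singleton_eq_of_sub_mem hl0 ?_).symm
    convert W.add_mem hl hm using 1
    module
  · change L 3 = L' 3
    rw [e3, e3']
    refine (Submodule.sup_span_singleton_eq_of_sub_mem hl0 ?_).symm
    convert W.add_mem (W.smul_mem ω hl) hm using 1
    module

theorem IsRegQuad.not_le (hω : ω ≠ 0) (h : IsRegQuad ω W L) :
    ¬ L 1 ≤ L 2 ∧ ¬ L 1 ≤ L 3 ∧ ¬ L 2 ≤ L 0 ∧ ¬ L 2 ≤ L 1 := by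
  obtain ⟨e, f, hef, e0, e1, e2, e3⟩ := h
  have key : ∀ {x y : V}, W ⊔ (K ∙ x) ≤ W ⊔ (K ∙ y) → ∃ c : K, x - c • y ∈ W := fun h =>
    Submodule.mem_sup_span_singleton_iff.mp
      (h (Submodule.mem_sup_right (Submodule.mem_span_singleton_self _)))
  rw [e0, e1, e2, e3]
  refine ⟨fun h => ?_, fun h => ?_, fun h => ?_, fun h => ?_⟩
  · obtain ⟨c, hc⟩ := key h
    have := hef (-c) (1 - c) (by convert hc using 1; module)
    rw [neg_eq_zero] at this
    simp [this.1] at this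
  · obtain ⟨c, hc⟩ := key h
    have := hef (-(c * ω)) (1 - c) (by convert hc using 1; module)
    rw [neg_eq_zero, mul_eq_zero, or_iff_left hω] at this
    simp [this.1] at this
  · obtain ⟨c, hc⟩ := key h
    exact one_ne_zero (hef (1 - c) 1 (by convert hc using 1; module)).2
  · obtain ⟨c, hc⟩ := key h
    exact one_ne_zero (hef 1 (1 - c) (by convert hc using 1; module)).1

theorem IsRegQuad.finrank_eq [FiniteDimensional K V] (h : IsRegQuad ω W L) :
    Module.finrank K (L 0) = Module.finrank K W + 1 ∧
    Module.finrank K (L 1) = Module.finrank K W + 1 ∧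
    Module.finrank K ↥(L 0 ⊔ L 1) = Module.finrank K W + 2 := by
  obtain ⟨e, f, hef, e0, e1, -, -⟩ := h
  have he : e ∉ W := fun h => one_ne_zero (hef 1 0 (by simpa using h)).1
  have hf : f ∉ W := fun h => one_ne_zero (hef 0 1 (by simpa using h)).2
  have hf' : f ∉ W ⊔ (K ∙ e) := fun h => by
    obtain ⟨c, hc⟩ := Submodule.mem_sup_span_singleton_iff.mp h
    exact one_ne_zero (hef (-c) 1 (by convert hc using 1; module)).2
  rw [e0, e1]
  refine ⟨Submodule.finrank_sup_span_singleton he, Submodule.finrank_sup_span_singleton hf, ?_⟩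
  rw [← sup_sup_distrib_left, ← sup_assoc, Submodule.finrank_sup_span_singleton hf',
    Submodule.finrank_sup_span_singleton he]

theorem Submodule.comap_sup_span_singleton {V' : Type*} [AddCommGroup V'] [Module K V']
    (π : V →ₗ[K] V') (W : Submodule K V') (x : V) :
    (W ⊔ (K ∙ π x)).comap π = W.comap π ⊔ (K ∙ x) := by
  ext z
  rw [Submodule.mem_comap, Submodule.mem_sup_span_singleton_iff,
    Submodule.mem_sup_span_singleton_iff]
  simp

theorem IsRegQuad.comap {V' : Type*} [AddCommGroup V'] [Module K V'] {π : V →ₗ[K] V'}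
    (hπ : Function.Surjective π) {W : Submodule K V'} {L : Fin 4 → Submodule K V'}
    (h : IsRegQuad ω W L) : IsRegQuad ω (W.comap π) (fun i => (L i).comap π) := by
  obtain ⟨e, f, hef, e0, e1, e2, e3⟩ := h
  obtain ⟨e, rfl⟩ := hπ e
  obtain ⟨f, rfl⟩ := hπ f
  refine ⟨e, f, fun a b hab => hef a b (by simpa using hab), ?_, ?_, ?_, ?_⟩
  · change (L 0).comap π = _
    rw [e0, Submodule.comap_sup_span_singleton]
  · change (L 1).comap π = _
    rw [e1, Submodule.comap_sup_span_singleton]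
  · change (L 2).comap π = _
    rw [e2, ← map_add, Submodule.comap_sup_span_singleton]
  · change (L 3).comap π = _
    rw [e3, ← map_smul, ← map_add, Submodule.comap_sup_span_singleton]

/-- Four complete flags that induce a plane configuration of cross-ratio `ω` in all the quotients
of the layer `∑ i, J i = n - 2`. -/
structure IsRegularTuple (ω : K) (n : ℕ) (F : Fin 4 → ℕ → Submodule K V) : Prop
    extends IsFlagTuple n F where
  regQuad : ∀ J : Fin 4 → ℕ, J 0 + J 1 + J 2 + J 3 + 2 = n →
    IsRegQuad ω (flagSup F J) (fun i => flagSup F (J + Pi.single i 1))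

theorem flagSup_eq (F : Fin 4 → ℕ → Submodule K V) (J : Fin 4 → ℕ) :
    flagSup F J = F 0 (J 0) ⊔ F 1 (J 1) ⊔ F 2 (J 2) ⊔ F 3 (J 3) := by
  refine le_antisymm (iSup_le fun i => ?_)
    (sup_le (sup_le (sup_le (le_flagSup F J 0) (le_flagSup F J 1)) (le_flagSup F J 2))
      (le_flagSup F J 3))
  fin_cases i
  · exact le_sup_of_le_left (le_sup_of_le_left le_sup_left)
  · exact le_sup_of_le_left (le_sup_of_le_left le_sup_right)
  · exact le_sup_of_le_left le_sup_right
  · exact le_sup_right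

variable {F G : Fin 4 → ℕ → Submodule K V} {n : ℕ} [FiniteDimensional K V]

theorem IsFlagTuple.zero_eq (hF : IsFlagTuple n F) (i : Fin 4) : F i 0 = ⊥ := by
  rw [← Submodule.finrank_eq_zero (R := K), hF.finrank_eq i 0 (Nat.zero_le _)]

theorem IsFlagTuple.top_eq (hF : IsFlagTuple n F) (hV : Module.finrank K V = n) (i : Fin 4) :
    F i n = ⊤ :=
  Submodule.eq_top_of_finrank_eq (by rw [hF.finrank_eq i n le_rfl, hV])

theorem IsFlagTuple.exists_vec (hF : IsFlagTuple n F) (i : Fin 4) {j : ℕ} (hj : j < n) :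
    ∃ w, F i (j + 1) = F i j ⊔ (K ∙ w) := by
  have hle : F i j ≤ F i (j + 1) := hF.mono i (Nat.le_succ j)
  have h1 := hF.finrank_eq i j hj.le
  have h2 := hF.finrank_eq i (j + 1) hj
  obtain ⟨w, hw, hw'⟩ := SetLike.exists_of_lt (lt_of_le_of_ne hle fun he => by
    rw [he] at h1; omega)
  refine ⟨w, (Submodule.eq_of_le_of_finrank_eq
    (sup_le hle ((Submodule.span_singleton_le_iff_mem _ _).mpr hw)) ?_).symm⟩
  rw [Submodule.finrank_sup_span_singleton hw', h1, h2]

omit [FiniteDimensional K V] in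
-- Spaces of B are peeled off one at a time: if x lies in H ⊔ B (j + 1) with a nonzero coefficient
-- of the last vector w, then x ∈ H ⊔ A (k + 1) ⊔ B j would put w there too, against transversality.
-- The purpose is to recover a space from its images modulo all F 0 a ⊔ F 1 b with a + b fixed.
theorem mem_of_forall_mem_sup {H : Submodule K V} {A B : ℕ → Submodule K V} {M : ℕ}
    (hA : A 0 = ⊥) (hB : B 0 = ⊥) (hB' : ∀ j < M, ∃ w, B (j + 1) = B j ⊔ (K ∙ w))
    (hAB : ∀ k j, k + 1 + j = M → ¬ B (j + 1) ≤ H ⊔ A (k + 1) ⊔ B j) {x : V}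
    (hx : ∀ a b, a + b = M → x ∈ H ⊔ A a ⊔ B b) : x ∈ H := by
  have key : ∀ k j, k + j = M → x ∈ H ⊔ B j := by
    intro k
    induction k with
    | zero =>
      intro j hj
      simpa [hA] using hx 0 j hj
    | succ k ih =>
      intro j hj
      obtain ⟨w, hw⟩ := hB' j (by omega)
      have h1 := ih (j + 1) (by omega)
      rw [hw, ← sup_assoc, Submodule.mem_sup_span_singleton_iff] at h1
      obtain ⟨c, hc⟩ := h1
      have hle : H ⊔ B j ≤ H ⊔ A (k + 1) ⊔ B j := sup_le_sup_right le_sup_left _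
      by_cases hc0 : c = 0
      · simpa [hc0] using hc
      · refine absurd ?_ (hAB k j hj)
        rw [hw]
        refine sup_le le_sup_right ((Submodule.span_singleton_le_iff_mem _ _).mpr ?_)
        have h2 := Submodule.sub_mem _ (hx (k + 1) j hj) (hle hc)
        rw [sub_sub_cancel] at h2
        exact (Submodule.smul_mem_iff _ hc0).mp h2
  simpa [hB] using key M 0 rfl

theorem IsRegularTuple.next_eq (hω : ω ≠ 0) (hV : Module.finrank K V = n)
    (hF : IsRegularTuple ω n F) (hG : IsRegularTuple ω n G)
    (h0 : ∀ j ≤ n, F 0 j = G 0 j) (h1 : ∀ j ≤ n, F 1 j = G 1 j) {p q : ℕ}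
    (hpq : p = 0 ∨ q = 0) (hpqn : p + q < n)
    (h2 : F 2 p = G 2 p) (h3 : F 3 q = G 3 q)
    (h23 : F 2 (p + 1) = G 2 (p + 1) ∨ F 3 (q + 1) = G 3 (q + 1)) :
    (q = 0 → F 2 (p + 1) = G 2 (p + 1)) ∧ (p = 0 → F 3 (q + 1) = G 3 (q + 1)) := by
  -- At the top no layer is left, and the next space is the whole of V.
  by_cases hn : p + q + 1 = n
  · refine ⟨?_, ?_⟩
    · rintro rfl
      have : p + 1 = n := by omega
      rw [this, hF.top_eq hV, hG.top_eq hV]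
    · rintro rfl
      have : q + 1 = n := by omega
      rw [this, hF.top_eq hV, hG.top_eq hV]
  obtain ⟨M, hM⟩ : ∃ M, M + (p + q) + 2 = n := ⟨n - 2 - (p + q), by omega⟩
  have hall : ∀ a b, a + b = M → (fun i => flagSup F (![a, b, p, q] + Pi.single i 1)) =
      fun i => flagSup G (![a, b, p, q] + Pi.single i 1) := by
    intro a b hab
    have hsum : ![a, b, p, q] 0 + ![a, b, p, q] 1 + ![a, b, p, q] 2 + ![a, b, p, q] 3 + 2 = n := by
      simp; omega
    have rF := hF.regQuad _ hsum
    have rG := hG.regQuad _ hsum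
    have hW : flagSup F ![a, b, p, q] = flagSup G ![a, b, p, q] := by
      rw [flagSup_eq, flagSup_eq]
      simp [h0 a (by omega), h1 b (by omega), h2, h3]
    rw [hW] at rF
    refine rF.eq_of_eq hω rG ?_ ?_ ?_
    · simp only [flagSup_eq]
      simp [h0 (a + 1) (by omega), h1 b (by omega), h2, h3]
    · simp only [flagSup_eq]
      simp [h0 a (by omega), h1 (b + 1) (by omega), h2, h3]
    · refine h23.imp (fun h => ?_) fun h => ?_
      · simp only [flagSup_eq]
        simp [h0 a (by omega), h1 b (by omega), h, h3]
      · simp only [flagSup_eq]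
        simp [h0 a (by omega), h1 b (by omega), h2, h]
  refine ⟨?_, ?_⟩
  · rintro rfl
    have hle : G 2 (p + 1) ≤ F 2 (p + 1) := by
      intro x hx
      refine mem_of_forall_mem_sup (hF.zero_eq 0) (hF.zero_eq 1)
        (fun j hj => hF.exists_vec 1 (show j < n by omega)) (M := M) ?_ ?_
      · intro k j hkj hle
        refine ((hF.regQuad ![k + 1, j, p, 0] (by simp; omega)).not_le hω).1 ?_
        simp only [flagSup_eq]
        simp only [Pi.add_apply, Matrix.cons_val_zero, Matrix.cons_val_one, Matrix.cons_val,
          Pi.single_apply]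
        simp only [Fin.isValue, Fin.reduceEq, if_true, if_false, add_zero, zero_ne_one,
          hF.zero_eq, sup_bot_eq]
        have e : F 0 (k + 1) ⊔ F 1 j ⊔ F 2 (p + 1) = F 2 (p + 1) ⊔ F 0 (k + 1) ⊔ F 1 j := by
          rw [sup_comm, sup_assoc]
        refine sup_le (sup_le ?_ ?_) ?_
        · exact le_sup_of_le_left le_sup_left
        · exact hle.trans e.ge
        · exact (hF.mono 2 (Nat.le_succ p)).trans le_sup_right
      · intro a b hab
        have := congrFun (hall a b hab) 2
        simp only [flagSup_eq] at this
        simp [hF.zero_eq, hG.zero_eq] at this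
        rw [sup_assoc, sup_comm, this]
        exact Submodule.mem_sup_right hx
    refine (Submodule.eq_of_le_of_finrank_eq hle ?_).symm
    rw [hF.finrank_eq _ _ (by omega), hG.finrank_eq _ _ (by omega)]
  · rintro rfl
    have hle : G 3 (q + 1) ≤ F 3 (q + 1) := by
      intro x hx
      refine mem_of_forall_mem_sup (hF.zero_eq 0) (hF.zero_eq 1)
        (fun j hj => hF.exists_vec 1 (show j < n by omega)) (M := M) ?_ ?_
      · intro k j hkj hle
        refine ((hF.regQuad ![k + 1, j, 0, q] (by simp; omega)).not_le hω).2.1 ?_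
        simp only [flagSup_eq]
        simp only [Pi.add_apply, Matrix.cons_val_zero, Matrix.cons_val_one, Matrix.cons_val,
          Pi.single_apply]
        simp only [Fin.isValue, Fin.reduceEq, if_true, if_false, add_zero, zero_ne_one,
          hF.zero_eq, sup_bot_eq]
        have e : F 0 (k + 1) ⊔ F 1 j ⊔ F 3 (q + 1) = F 3 (q + 1) ⊔ F 0 (k + 1) ⊔ F 1 j := by
          rw [sup_comm, sup_assoc]
        refine sup_le (sup_le ?_ ?_) ?_
        · exact le_sup_of_le_left le_sup_left
        · exact hle.trans e.ge
        · exact (hF.mono 3 (Nat.le_succ q)).trans le_sup_right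
      · intro a b hab
        have := congrFun (hall a b hab) 3
        simp only [flagSup_eq] at this
        simp [hF.zero_eq, hG.zero_eq] at this
        rw [sup_assoc, sup_comm, this]
        exact Submodule.mem_sup_right hx
    refine (Submodule.eq_of_le_of_finrank_eq hle ?_).symm
    rw [hF.finrank_eq _ _ (by omega), hG.finrank_eq _ _ (by omega)]

/-- A regular tuple of flags is determined by two of its flags and the line of a third one. -/
theorem IsRegularTuple.eq_of_eq (hω : ω ≠ 0) (hn : 2 ≤ n) (hV : Module.finrank K V = n)
    (hF : IsRegularTuple ω n F) (hG : IsRegularTuple ω n G)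
    (h0 : ∀ j ≤ n, F 0 j = G 0 j) (h1 : ∀ j ≤ n, F 1 j = G 1 j) (h2 : F 2 1 = G 2 1)
    (i : Fin 4) : ∀ j ≤ n, F i j = G i j := by
  have hz : ∀ i, F i 0 = G i 0 := fun i => by rw [hF.zero_eq, hG.zero_eq]
  -- The line of flag 2 yields the line of flag 3. Then flag 2 is climbed with the help of the line
  -- of flag 3, and flag 3 with the help of the line of flag 2.
  have h3 : F 3 1 = G 3 1 := (hF.next_eq hω hV hG h0 h1 (p := 0) (q := 0) (.inl rfl) (by omega)
    (hz 2) (hz 3) (.inl h2)).2 rfl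
  fin_cases i
  · exact h0
  · exact h1
  · intro j
    induction j with
    | zero => exact fun _ => hz 2
    | succ c ih =>
      intro hc
      exact (hF.next_eq hω hV hG h0 h1 (q := 0) (.inr rfl) (by omega) (ih (by omega)) (hz 3)
        (.inr h3)).1 rfl
  · intro j
    induction j with
    | zero => exact fun _ => hz 3
    | succ c ih =>
      intro hc
      exact (hF.next_eq hω hV hG h0 h1 (p := 0) (.inl rfl) (by omega) (hz 2) (ih (by omega))
        (.inl h2)).2 rfl

/-- On the layer a + b = n - 2 neighbouring sums have equal dimension, both being one less than that
of a common larger sum. The value at b = 0 is n - 2, and the quad at (a, b, 0, 0) adds the last two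
dimensions. -/
theorem IsRegularTuple.sup_eq_top (hV : Module.finrank K V = n) (hF : IsRegularTuple ω n F)
    {a b : ℕ} (hab : a + b = n) : F 0 a ⊔ F 1 b = ⊤ := by
  have hz := hF.zero_eq
  have hreg : ∀ a b, a + b + 2 = n →
      Module.finrank K ↥(F 0 (a + 1) ⊔ F 1 b) = Module.finrank K ↥(F 0 a ⊔ F 1 b) + 1 ∧
      Module.finrank K ↥(F 0 a ⊔ F 1 (b + 1)) = Module.finrank K ↥(F 0 a ⊔ F 1 b) + 1 ∧
      Module.finrank K ↥(F 0 (a + 1) ⊔ F 1 (b + 1)) = Module.finrank K ↥(F 0 a ⊔ F 1 b) + 2 := by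
    intro a b hab
    obtain ⟨h1, h2, h3⟩ := (hF.regQuad ![a, b, 0, 0] (by simpa using hab)).finrank_eq
    have eW : flagSup F ![a, b, 0, 0] = F 0 a ⊔ F 1 b := by
      rw [flagSup_eq]; simp [hz]
    have e0 : flagSup F (![a, b, 0, 0] + Pi.single 0 1) = F 0 (a + 1) ⊔ F 1 b := by
      rw [flagSup_eq]; simp [hz]
    have e1 : flagSup F (![a, b, 0, 0] + Pi.single 1 1) = F 0 a ⊔ F 1 (b + 1) := by
      rw [flagSup_eq]; simp [hz]
    rw [e0, eW] at h1
    rw [e1, eW] at h2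
    rw [e0, e1, eW] at h3
    refine ⟨h1, h2, ?_⟩
    have e : F 0 (a + 1) ⊔ F 1 (b + 1) = F 0 (a + 1) ⊔ F 1 b ⊔ (F 0 a ⊔ F 1 (b + 1)) :=
      le_antisymm (sup_le (le_sup_of_le_left le_sup_left) (le_sup_of_le_right le_sup_right))
        (sup_le (sup_le_sup_left (hF.mono 1 (Nat.le_succ b)) _)
          (sup_le_sup_right (hF.mono 0 (Nat.le_succ a)) _))
    rw [e, h3]
  have hD : ∀ b a, a + b + 2 = n → Module.finrank K ↥(F 0 a ⊔ F 1 b) = a + b := by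
    intro b
    induction b with
    | zero =>
      intro a ha
      rw [hz, sup_bot_eq, hF.finrank_eq 0 a (by omega), add_zero]
    | succ b ih =>
      intro a ha
      have h1 := (hreg a (b + 1) ha).1
      have h2 := (hreg (a + 1) b (by omega)).2.1
      have h3 := ih (a + 1) (by omega)
      omega
  rcases Nat.eq_zero_or_pos a with rfl | ha
  · rw [show b = n by omega, hF.top_eq hV, sup_top_eq]
  rcases Nat.eq_zero_or_pos b with rfl | hb
  · rw [show a = n by omega, hF.top_eq hV, top_sup_eq]
  obtain ⟨a, rfl⟩ := Nat.exists_eq_add_one_of_ne_zero ha.ne'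
  obtain ⟨b, rfl⟩ := Nat.exists_eq_add_one_of_ne_zero hb.ne'
  refine Submodule.eq_top_of_finrank_eq ?_
  have h1 := (hreg a b (by omega)).2.2
  have h2 := hD b a (by omega)
  omega

theorem IsRegularTuple.not_le_sup (hω : ω ≠ 0) (hn : 2 ≤ n) (hF : IsRegularTuple ω n F)
    {a b : ℕ} (hab : a + b + 1 = n) : ¬ F 2 1 ≤ F 0 a ⊔ F 1 b := by
  have hz := hF.zero_eq
  intro hle
  rcases Nat.eq_zero_or_pos a with rfl | ha
  · obtain ⟨b, rfl⟩ := Nat.exists_eq_succ_of_ne_zero (show b ≠ 0 by omega)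
    refine ((hF.regQuad ![0, b, 0, 0] (by simp; omega)).not_le hω).2.2.2 ?_
    simp only [flagSup_eq]
    simp [hz]
    exact ⟨hF.mono 1 (Nat.le_succ b), by simpa [hz] using hle⟩
  · obtain ⟨a, rfl⟩ := Nat.exists_eq_succ_of_ne_zero ha.ne'
    refine ((hF.regQuad ![a, b, 0, 0] (by simp; omega)).not_le hω).2.2.1 ?_
    simp only [flagSup_eq]
    simp [hz]
    exact ⟨le_sup_of_le_left (hF.mono 0 (Nat.le_succ a)), by simpa [hz] using hle⟩

/-- A basis adapted to three flags of a regular tuple. -/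
theorem IsRegularTuple.exists_basis (hω : ω ≠ 0) (hn : 2 ≤ n) (hV : Module.finrank K V = n)
    (hF : IsRegularTuple ω n F) : ∃ b : Module.Basis (Fin n) K V,
      (∀ j ≤ n, F 0 j = Submodule.span K (b '' {i | (i : ℕ) < j})) ∧
      (∀ j ≤ n, F 1 j = Submodule.span K (b '' {i | n ≤ (i : ℕ) + j})) ∧
      F 2 1 = (K ∙ ∑ i, b i) := by
  obtain ⟨u, hu⟩ := hF.exists_vec 2 (show 0 < n by omega)
  rw [hF.zero_eq, bot_sup_eq, zero_add] at hu
  -- Split u along F 0 j and F 1 (n - j). Differences of consecutive first components lie in both F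
  -- 0 (j + 1) and F 1 (n - j) and telescope to u; they form the basis.
  have hx : ∀ j, ∃ x, j ≤ n → x ∈ F 0 j ∧ u - x ∈ F 1 (n - j) := by
    intro j
    by_cases hj : j ≤ n
    · have hmem : u ∈ F 0 j ⊔ F 1 (n - j) := by
        rw [hF.sup_eq_top hV (by omega)]; trivial
      obtain ⟨x, hx, y, hy, hxy⟩ := Submodule.mem_sup.mp hmem
      exact ⟨x, fun _ => ⟨hx, by rwa [← hxy, add_sub_cancel_left]⟩⟩
    · exact ⟨0, fun h => absurd h hj⟩
  choose x hx using hx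
  have hx0 : x 0 = 0 := by
    have := (hx 0 (by omega)).1
    rwa [hF.zero_eq, Submodule.mem_bot] at this
  have hxn : x n = u := by
    have := (hx n le_rfl).2
    rw [Nat.sub_self, hF.zero_eq, Submodule.mem_bot, sub_eq_zero] at this
    exact this.symm
  let e : ℕ → V := fun j => x (j + 1) - x j
  have he0 : ∀ j < n, e j ∈ F 0 (j + 1) := fun j hj =>
    Submodule.sub_mem _ (hx _ hj).1 (hF.mono 0 (Nat.le_succ j) (hx _ hj.le).1)
  have he1 : ∀ j < n, e j ∈ F 1 (n - j) := fun j hj => by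
    have h1 := (hx _ hj.le).2
    have h2 := hF.mono 1 (show n - (j + 1) ≤ n - j by omega) (hx _ hj).2
    have := Submodule.sub_mem _ h1 h2
    rwa [sub_sub_sub_cancel_left] at this
  -- Otherwise u would lie in F 0 j ⊔ F 1 (n - j - 1), against general position.
  have he : ∀ j < n, e j ∉ F 0 j := by
    intro j hj hmem
    refine hF.not_le_sup hω hn (a := j) (b := n - (j + 1)) (by omega) ?_
    rw [hu, Submodule.span_singleton_le_iff_mem]
    refine Submodule.mem_sup.mpr ⟨x (j + 1), ?_, u - x (j + 1), (hx _ hj).2, by abel⟩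
    have := Submodule.add_mem _ hmem (hx _ hj.le).1
    rwa [sub_add_cancel] at this
  have hspan : ∀ j ≤ n, F 0 j ≤ Submodule.span K (Set.range fun i : Fin n => e i) := by
    intro j
    induction j with
    | zero => intro _; rw [hF.zero_eq]; exact bot_le
    | succ j ih =>
      intro hj
      have heq : F 0 j ⊔ (K ∙ e j) = F 0 (j + 1) := by
        refine Submodule.eq_of_le_of_finrank_eq (sup_le (hF.mono 0 (Nat.le_succ j))
          ((Submodule.span_singleton_le_iff_mem _ _).mpr (he0 j hj))) ?_
        rw [Submodule.finrank_sup_span_singleton (he j hj), hF.finrank_eq _ _ (by omega),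
          hF.finrank_eq _ _ hj]
      rw [← heq]
      refine sup_le (ih (by omega)) ((Submodule.span_singleton_le_iff_mem _ _).mpr ?_)
      exact Submodule.subset_span ⟨⟨j, hj⟩, rfl⟩
  have htop : ⊤ ≤ Submodule.span K (Set.range fun i : Fin n => e i) := by
    rw [← hF.top_eq hV 0]; exact hspan n le_rfl
  let b : Module.Basis (Fin n) K V := basisOfTopLeSpanOfCardEqFinrank _ htop (by simp [hV])
  have hb : ∀ i, b i = e i := fun i => by
    simp only [b, coe_basisOfTopLeSpanOfCardEqFinrank]
  have hcard : ∀ s : Finset (Fin n),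
      Module.finrank K (Submodule.span K (b '' (s : Set (Fin n)))) = s.card := by
    intro s
    have h := finrank_span_eq_card
      (b.linearIndependent.comp (Subtype.val : s → Fin n) Subtype.val_injective)
    rw [Set.range_comp, Subtype.range_coe_subtype, Fintype.card_coe] at h
    exact h
  refine ⟨b, fun j hj => ?_, fun j hj => ?_, ?_⟩
  · refine (Submodule.eq_of_le_of_finrank_eq (Submodule.span_le.mpr ?_) ?_).symm
    · rintro _ ⟨i, hi, rfl⟩
      rw [hb]
      exact hF.mono 0 (show (i : ℕ) + 1 ≤ j from hi) (he0 i i.2)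
    · rw [hF.finrank_eq _ _ hj]
      have := hcard (Finset.univ.filter fun i : Fin n => (i : ℕ) < j)
      rw [Finset.coe_filter_univ] at this
      rw [this, Fin.card_filter_val_lt, min_eq_right hj]
  · refine (Submodule.eq_of_le_of_finrank_eq (Submodule.span_le.mpr ?_) ?_).symm
    · rintro _ ⟨i, hi, rfl⟩
      rw [hb]
      have hi : n ≤ (i : ℕ) + j := hi
      exact hF.mono 1 (show n - (i : ℕ) ≤ j by omega) (he1 i i.2)
    · rw [hF.finrank_eq _ _ hj]
      have := hcard (Finset.univ.filter fun i : Fin n => n ≤ (i : ℕ) + j)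
      rw [Finset.coe_filter_univ] at this
      rw [this]
      have h1 := Finset.card_filter_add_card_filter_not (s := (Finset.univ : Finset (Fin n)))
        (fun i : Fin n => (i : ℕ) < n - j)
      rw [Fin.card_filter_val_lt, Finset.card_univ, Fintype.card_fin] at h1
      have h2 : (Finset.univ.filter fun i : Fin n => n ≤ (i : ℕ) + j) =
          Finset.univ.filter fun i : Fin n => ¬ (i : ℕ) < n - j := by
        ext i; simp
      rw [h2]
      omega
  · rw [hu]
    congr 2
    simp only [hb]
    rw [Fin.sum_univ_eq_sum_range (fun i => x (i + 1) - x i) n, Finset.sum_range_sub, hx0, hxn,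
      sub_zero]

omit [FiniteDimensional K V] in
theorem flagSup_map (g : V ≃ₗ[K] V) (J : Fin 4 → ℕ) :
    flagSup (fun i j => (F i j).map g.toLinearMap) J = (flagSup F J).map g.toLinearMap := by
  simp only [flagSup, Submodule.map_iSup]

omit [FiniteDimensional K V] in
theorem IsRegularTuple.map (hF : IsRegularTuple ω n F) (g : V ≃ₗ[K] V) :
    IsRegularTuple ω n (fun i j => (F i j).map g.toLinearMap) where
  mono i _ _ h := Submodule.map_mono (hF.mono i h)
  finrank_eq i j hj := by
    rw [LinearEquiv.finrank_map_eq]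
    exact hF.finrank_eq i j hj
  regQuad J hJ := by
    have := (hF.regQuad J hJ).comap (π := g.symm.toLinearMap) g.symm.surjective
    simp only [flagSup_map]
    simpa only [Submodule.map_equiv_eq_comap_symm] using this

omit [FiniteDimensional K V] in
theorem span_image_map {ι : Type*} (g : V →ₗ[K] V) (b b' : ι → V) (h : ∀ i, g (b i) = b' i)
    (s : Set ι) : (Submodule.span K (b '' s)).map g = Submodule.span K (b' '' s) := by
  rw [Submodule.map_span, Set.image_image]
  simp only [h]

/-- Regular tuples are unique up to linear automorphisms. -/
theorem IsRegularTuple.exists_linearEquiv (hω : ω ≠ 0) (hn : 2 ≤ n) (hV : Module.finrank K V = n)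
    (hF : IsRegularTuple ω n F) (hG : IsRegularTuple ω n G) :
    ∃ g : V ≃ₗ[K] V, ∀ i, ∀ j ≤ n, (F i j).map g.toLinearMap = G i j := by
  obtain ⟨b, b0, b1, b2⟩ := hF.exists_basis hω hn hV
  obtain ⟨c, c0, c1, c2⟩ := hG.exists_basis hω hn hV
  let g : V ≃ₗ[K] V := b.equiv c (Equiv.refl _)
  have hg : ∀ i, g.toLinearMap (b i) = c i := fun i => by simp [g]
  refine ⟨g, (hF.map g).eq_of_eq hω hn hV hG ?_ ?_ ?_⟩
  · intro j hj
    rw [b0 j hj, c0 j hj, span_image_map _ _ _ hg]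
  · intro j hj
    rw [b1 j hj, c1 j hj, span_image_map _ _ _ hg]
  · rw [b2, c2, Submodule.map_span, Set.image_singleton, map_sum]
    simp only [hg]

/-- An automorphism that fixes three flags of a regular tuple is a scalar. -/
theorem IsRegularTuple.exists_smul (hω : ω ≠ 0) (hn : 2 ≤ n) (hV : Module.finrank K V = n)
    (hF : IsRegularTuple ω n F) (g : V ≃ₗ[K] V)
    (hg : ∀ i : Fin 4, i ≠ 3 → ∀ j ≤ n, (F i j).map g.toLinearMap = F i j) :
    ∃ c : K, c ≠ 0 ∧ ∀ v, g v = c • v := by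
  obtain ⟨b, b0, b1, b2⟩ := hF.exists_basis hω hn hV
  have hmem : ∀ i : Fin 4, i ≠ 3 → ∀ j ≤ n, ∀ v ∈ F i j, g v ∈ F i j := fun i hi j hj v hv => by
    rw [← hg i hi j hj]
    exact ⟨v, hv, rfl⟩
  -- The vector b i spans the intersection of F 0 (i + 1) and F 1 (n - i), so g is diagonal in b;
  -- invariance of the line of ∑ b i then equates the entries.
  have hdiag : ∀ i k, k ≠ i → b.repr (g (b i)) k = 0 := by
    intro i k hk
    by_contra hne
    rcases lt_or_gt_of_ne hk with h | h
    · have h1 : b i ∈ F 1 (n - i) := by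
        rw [b1 _ (by omega)]
        exact Submodule.subset_span ⟨i, show n ≤ (i : ℕ) + (n - i) by omega, rfl⟩
      have h2 := hmem 1 (by decide) _ (by omega) _ h1
      rw [b1 _ (by omega), Module.Basis.mem_span_image] at h2
      have h3 : n ≤ (k : ℕ) + (n - i) := h2 (Finsupp.mem_support_iff.mpr hne)
      have : (k : ℕ) < i := h
      omega
    · have h1 : b i ∈ F 0 (i + 1) := by
        rw [b0 _ (by omega)]
        exact Submodule.subset_span ⟨i, show (i : ℕ) < i + 1 by omega, rfl⟩
      have h2 := hmem 0 (by decide) _ (by omega) _ h1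
      rw [b0 _ (by omega), Module.Basis.mem_span_image] at h2
      have h3 : (k : ℕ) < i + 1 := h2 (Finsupp.mem_support_iff.mpr hne)
      have : (i : ℕ) < k := h
      omega
  have hgb : ∀ i, g (b i) = b.repr (g (b i)) i • b i := fun i => by
    conv_lhs => rw [← b.sum_repr (g (b i))]
    exact Finset.sum_eq_single i (fun k _ hk => by rw [hdiag i k hk, zero_smul]) (by simp)
  have hu : (∑ i, b i) ∈ F 2 1 := by
    rw [b2]; exact Submodule.mem_span_singleton_self _
  have hu := hmem 2 (by decide) 1 (by omega) _ hu
  rw [b2] at hu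
  obtain ⟨c, hc⟩ := Submodule.mem_span_singleton.mp hu
  have hci : ∀ i, b.repr (g (b i)) i = c := by
    intro i
    rw [map_sum, Finset.smul_sum] at hc
    have := congrArg (fun v => b.repr v i) (hc.trans (Finset.sum_congr rfl fun k _ => hgb k))
    simpa [Finsupp.single_apply] using this.symm
  have hgv : ∀ v, g v = c • v := by
    intro v
    have : g.toLinearMap = c • LinearMap.id := b.ext fun i => by
      simpa [hci i] using hgb i
    exact LinearMap.congr_fun this v
  refine ⟨c, ?_, hgv⟩
  rintro rfl
  have : b ⟨0, by omega⟩ = 0 := g.injective (by rw [hgv, map_zero, zero_smul])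
  exact b.ne_zero _ this

end Rigidity

/-! ### Veronese flags as binary forms divisible by powers of a linear form -/

section Veronese

/-- The derivation `s ∂/∂X + t ∂/∂Y` from binary forms of degree `n` to forms of degree `n - 1`,
in terms of the coefficients of `X ^ (n - l) * Y ^ l`. -/
noncomputable def formDeriv (n : ℕ) (s t : ℂ) : (Fin (n + 1) → ℂ) →ₗ[ℂ] (Fin n → ℂ) :=
  LinearMap.pi fun l => (s * ((n : ℂ) - l)) • LinearMap.proj l.castSucc +
    (t * ((l : ℂ) + 1)) • LinearMap.proj l.succ

theorem formDeriv_apply (n : ℕ) (s t : ℂ) (p : Fin (n + 1) → ℂ) (l : Fin n) :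
    formDeriv n s t p l = s * ((n : ℂ) - l) * p l.castSucc + t * ((l : ℂ) + 1) * p l.succ := by
  simp [formDeriv]

/-- For i + k ≤ n the vector stands for the form X ^ (n - i - k) Y ^ k ℓ ^ i with ℓ = v₀ X + v₁ Y,
and the three terms are those of the Leibniz rule. -/
theorem formDeriv_veroneseVec (n : ℕ) (s t : ℂ) (v : Fin 2 → ℂ) (i k : ℕ) :
    formDeriv n s t (veroneseVec (n + 1) v i k) =
      (i * (v 0 * s + v 1 * t)) • veroneseVec n v (i - 1) k +
      (s * ((n : ℂ) - i - k)) • veroneseVec n v i k + (t * k) • veroneseVec n v i (k - 1) := by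
  induction i generalizing k with
  | zero =>
    ext l
    rw [formDeriv_apply]
    simp only [veroneseVec, Pi.add_apply, Pi.smul_apply, smul_eq_mul, Nat.cast_zero, zero_mul,
      Fin.val_castSucc, Fin.val_succ, sub_zero, zero_add, zero_tsub, pow_zero, mul_one]
    have key : ∀ a b : ℕ, (if a ≤ b then ((Nat.choose 0 (b - a) : ℕ) : ℂ) * v 1 ^ (b - a) else 0) =
        if b = a then 1 else 0 := by
      intro a b
      rcases lt_trichotomy b a with h | h | h
      · rw [if_neg (by omega), if_neg (by omega)]
      · simp [h]
      · rw [if_pos h.le, if_neg (by omega), Nat.choose_eq_zero_of_lt (by omega)]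
        simp
    rw [key, key, key]
    by_cases h1 : (l : ℕ) = k
    · rw [if_pos h1, if_neg (by omega)]
      rcases Nat.eq_zero_or_pos k with rfl | hk
      · simp [h1]
      · rw [if_neg (by omega), ← h1]; ring
    · rw [if_neg h1]
      rcases Nat.eq_zero_or_pos k with rfl | hk
      · rw [if_neg (by omega)]; simp
      · by_cases h2 : (l : ℕ) + 1 = k
        · rw [if_pos h2, if_pos (by omega), ← h2]; push_cast; ring
        · rw [if_neg h2, if_neg (by omega)]; ring
  | succ i ih =>
    rw [veroneseVec_succ, map_add, map_smul, map_smul, ih, ih, Nat.add_sub_cancel,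
      Nat.add_sub_cancel]
    have h1 : (i * (v 0 * s + v 1 * t)) • veroneseVec n v i k =
        (i * (v 0 * s + v 1 * t)) • (v 0 • veroneseVec n v (i - 1) k +
          v 1 • veroneseVec n v (i - 1) (k + 1)) := by
      rcases Nat.eq_zero_or_pos i with rfl | hi
      · simp
      · obtain ⟨i, rfl⟩ := Nat.exists_eq_add_one_of_ne_zero hi.ne'
        rw [veroneseVec_succ, Nat.add_sub_cancel]
    have h2 : (t * k) • veroneseVec n v (i + 1) (k - 1) =
        (t * k) • (v 0 • veroneseVec n v i (k - 1) + v 1 • veroneseVec n v i k) := by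
      rcases Nat.eq_zero_or_pos k with rfl | hk
      · simp
      · obtain ⟨k, rfl⟩ := Nat.exists_eq_add_one_of_ne_zero hk.ne'
        rw [veroneseVec_succ, Nat.add_sub_cancel]
    have h3 : ((i + 1 : ℕ) * (v 0 * s + v 1 * t)) • veroneseVec n v i k =
        (i * (v 0 * s + v 1 * t)) • veroneseVec n v i k +
          (v 0 * s + v 1 * t) • veroneseVec n v i k := by
      rw [← add_smul]; push_cast; ring_nf
    rw [h3, h1, h2, veroneseVec_succ]
    push_cast
    module

/-- The kernel is given by a two-term recursion with nonzero coefficients in one direction, so one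
extreme coefficient determines a form in it. -/
theorem formDeriv_ker_finrank_le (n : ℕ) {s t : ℂ} (hst : s ≠ 0 ∨ t ≠ 0) :
    Module.finrank ℂ (LinearMap.ker (formDeriv n s t)) ≤ 1 := by
  have key : ∃ l : Fin (n + 1), ∀ p ∈ LinearMap.ker (formDeriv n s t), p l = 0 → p = 0 := by
    have hp : ∀ p ∈ LinearMap.ker (formDeriv n s t), ∀ l : Fin n,
        s * ((n : ℂ) - l) * p l.castSucc + t * ((l : ℂ) + 1) * p l.succ = 0 := by
      intro p hp l
      rw [← formDeriv_apply, LinearMap.mem_ker.mp hp, Pi.zero_apply]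
    rcases hst with hs | ht
    · refine ⟨Fin.last n, fun p hpk h0 => funext fun l => ?_⟩
      induction l using Fin.reverseInduction with
      | last => exact h0
      | cast l ih =>
        have := hp p hpk l
        rw [ih, Pi.zero_apply, mul_zero, add_zero, mul_eq_zero, mul_eq_zero] at this
        refine this.resolve_left (not_or.mpr ⟨hs, ?_⟩)
        rw [sub_eq_zero, Nat.cast_inj]
        omega
    · refine ⟨0, fun p hpk h0 => funext fun l => ?_⟩
      induction l using Fin.induction with
      | zero => exact h0
      | succ l ih =>
        have := hp p hpk l
        rw [ih, Pi.zero_apply, mul_zero, zero_add, mul_eq_zero, mul_eq_zero] at this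
        exact this.resolve_left (not_or.mpr ⟨ht, Nat.cast_add_one_ne_zero _⟩)
  obtain ⟨l, hl⟩ := key
  let f : LinearMap.ker (formDeriv n s t) →ₗ[ℂ] ℂ :=
    (LinearMap.proj l).comp (LinearMap.ker (formDeriv n s t)).subtype
  have hf : Function.Injective f := by
    rw [injective_iff_map_eq_zero]
    intro p hp0
    exact Subtype.ext (hl p p.2 hp0)
  simpa using LinearMap.finrank_le_finrank_of_injective hf

/-- The derivation that kills the linear form `v`. -/
noncomputable def polarDeriv (n : ℕ) (v : Fin 2 → ℂ) : (Fin (n + 1) → ℂ) →ₗ[ℂ] (Fin n → ℂ) :=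
  formDeriv n (v 1) (-v 0)

theorem vec2_ne_zero_or {v : Fin 2 → ℂ} (hv : v ≠ 0) : v 1 ≠ 0 ∨ -v 0 ≠ 0 := by
  by_contra! h
  exact hv (by ext l; fin_cases l <;> simp [h.1, neg_eq_zero.mp h.2])

/-- This derivation treats ℓ as a constant: the power of ℓ survives while the degree drops by one.
-/
theorem map_polarDeriv_self_le (n : ℕ) (v : Fin 2 → ℂ) {m : ℕ} (hm : m ≤ n) :
    (veroneseSpace (n + 1) v (m + 1)).map (polarDeriv n v) ≤ veroneseSpace n v m := by
  rw [veroneseSpace, Submodule.map_span_le]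
  rintro _ ⟨k, rfl⟩
  have hk := k.2
  rw [polarDeriv, formDeriv_veroneseVec, show v 0 * v 1 + v 1 * -v 0 = 0 by ring, mul_zero,
    zero_smul, zero_add, show n + 1 - (m + 1) = n - m by omega]
  refine Submodule.add_mem _ ?_ ?_
  · rcases Nat.lt_or_ge k m with h | h
    · exact Submodule.smul_mem _ _ (Submodule.subset_span ⟨⟨k, h⟩, rfl⟩)
    -- The generator with k = m has no counterpart in the smaller span, but its coefficient
    -- vanishes.
    · have : (n : ℂ) - (n - m : ℕ) - (k : ℕ) = 0 := by
        rw [show (k : ℕ) = m by omega]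
        push_cast [hm]; ring
      rw [this]; simp
  · rcases Nat.eq_zero_or_pos (k : ℕ) with h | h
    · rw [h]; simp
    · exact Submodule.smul_mem _ _ (Submodule.subset_span ⟨⟨k - 1, by omega⟩, rfl⟩)

/-- An arbitrary derivation loses at most one power of ℓ together with one degree, which leaves the
flag index m unchanged. -/
theorem map_formDeriv_le (n : ℕ) (s t : ℂ) (v : Fin 2 → ℂ) {m : ℕ} (hm : m ≤ n) :
    (veroneseSpace (n + 1) v m).map (formDeriv n s t) ≤ veroneseSpace n v m := by
  rcases Nat.eq_zero_or_pos m with rfl | hm0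
  · simp [veroneseSpace]
  obtain ⟨m, rfl⟩ := Nat.exists_eq_add_one_of_ne_zero hm0.ne'
  have hle := veroneseSpace_mono n v m (m + 1) (Nat.le_succ m) hm
  have hmem : ∀ k < m, veroneseVec n v (n - m) k ∈ veroneseSpace n v (m + 1) := fun k hk =>
    hle (Submodule.subset_span ⟨⟨k, hk⟩, rfl⟩)
  rw [veroneseSpace, Submodule.map_span_le]
  rintro _ ⟨k, rfl⟩
  have hk := k.2
  rw [formDeriv_veroneseVec, show n + 1 - (m + 1) = n - m by omega]
  refine Submodule.add_mem _ (Submodule.add_mem _ ?_ ?_) ?_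
  · refine Submodule.smul_mem _ _ (Submodule.subset_span ⟨k, ?_⟩)
    rw [show n - (m + 1) = n - m - 1 by omega]
  · rcases Nat.lt_or_ge k m with h | h
    · exact Submodule.smul_mem _ _ (hmem k h)
    · have : (n : ℂ) - (n - m : ℕ) - (k : ℕ) = 0 := by
        rw [show (k : ℕ) = m by omega]
        push_cast [show m ≤ n by omega]; ring
      rw [this]; simp
  · rcases Nat.eq_zero_or_pos (k : ℕ) with h | h
    · rw [h]; simp
    · exact Submodule.smul_mem _ _ (hmem _ (by omega))

theorem ker_polarDeriv (n : ℕ) {v : Fin 2 → ℂ} (hv : v ≠ 0) :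
    LinearMap.ker (polarDeriv n v) = veroneseSpace (n + 1) v 1 := by
  have hle : veroneseSpace (n + 1) v 1 ≤ LinearMap.ker (polarDeriv n v) := by
    rw [LinearMap.le_ker_iff_map, eq_bot_iff]
    refine (map_polarDeriv_self_le n v (Nat.zero_le n)).trans ?_
    simp [veroneseSpace]
  refine (Submodule.eq_of_le_of_finrank_le hle ?_).symm
  rw [finrank_veroneseSpace (n + 1) v hv 1 (by omega)]
  exact formDeriv_ker_finrank_le n (vec2_ne_zero_or hv)

theorem polarDeriv_surjective (n : ℕ) {v : Fin 2 → ℂ} (hv : v ≠ 0) :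
    Function.Surjective (polarDeriv n v) := by
  have h := LinearMap.finrank_range_add_finrank_ker (polarDeriv n v)
  have h1 := formDeriv_ker_finrank_le n (vec2_ne_zero_or hv)
  rw [← LinearMap.range_eq_top]
  refine Submodule.eq_top_of_finrank_eq (le_antisymm (Submodule.finrank_le _) ?_)
  simp only [Module.finrank_fin_fun] at h ⊢
  change Module.finrank ℂ (LinearMap.ker (polarDeriv n v)) ≤ 1 at h1
  omega

/-- Evaluation of a binary form of degree `n` at `(s, t)`. -/
noncomputable def formEval (n : ℕ) (s t : ℂ) : (Fin (n + 1) → ℂ) →ₗ[ℂ] ℂ :=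
  ∑ l : Fin (n + 1), (s ^ (n - l : ℕ) * t ^ (l : ℕ)) • LinearMap.proj l

theorem formEval_veroneseVec (n : ℕ) (s t : ℂ) (v : Fin 2 → ℂ) (i k : ℕ) (hik : i + k ≤ n) :
    formEval n s t (veroneseVec (n + 1) v i k) =
      s ^ (n - i - k) * t ^ k * (s * v 0 + t * v 1) ^ i := by
  induction i generalizing k with
  | zero =>
    simp only [formEval, LinearMap.sum_apply, LinearMap.smul_apply, LinearMap.proj_apply,
      smul_eq_mul]
    rw [Finset.sum_eq_single ⟨k, by omega⟩]
    · simp [veroneseVec]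
    · intro l _ hl
      have hl : (l : ℕ) ≠ k := fun h => hl (Fin.ext h)
      simp only [veroneseVec]
      split_ifs with h
      · rw [Nat.choose_eq_zero_of_lt (by omega)]; simp
      · simp
    · simp
  | succ i ih =>
    rw [veroneseVec_succ, map_add, map_smul, map_smul, ih k (by omega), ih (k + 1) (by omega),
      show n - i - k = n - (i + 1) - k + 1 by omega,
      show n - i - (k + 1) = n - (i + 1) - k by omega]
    simp only [smul_eq_mul]
    ring

/-- A nonzero multiple of the n-th power of the linear form of v does not vanish at (w₁, -w₀), the
zero of the linear form of w. -/
theorem disjoint_ker_polarDeriv (n : ℕ) {v w : Fin 2 → ℂ} (hvw : v 0 * w 1 - v 1 * w 0 ≠ 0)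
    {m : ℕ} (hm : m ≤ n) :
    Disjoint (veroneseSpace (n + 1) w m) (veroneseSpace (n + 1) v 1) := by
  rw [Submodule.disjoint_def]
  intro p hp hp'
  have h1 : formEval n (w 1) (-w 0) p = 0 := by
    have : veroneseSpace (n + 1) w m ≤ LinearMap.ker (formEval n (w 1) (-w 0)) := by
      rw [veroneseSpace, Submodule.span_le]
      rintro _ ⟨k, rfl⟩
      have hk := k.2
      rw [SetLike.mem_coe, LinearMap.mem_ker, formEval_veroneseVec _ _ _ _ _ _ (by omega),
        show w 1 * w 0 + -w 0 * w 1 = 0 by ring, zero_pow (by omega), mul_zero]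
    exact this hp
  have h2 : veroneseSpace (n + 1) v 1 = ℂ ∙ veroneseVec (n + 1) v n 0 := by
    rw [veroneseSpace, Nat.add_sub_cancel, Set.range_unique]
    rfl
  rw [h2] at hp'
  obtain ⟨c, rfl⟩ := Submodule.mem_span_singleton.mp hp'
  rw [map_smul, formEval_veroneseVec _ _ _ _ _ _ (by omega), smul_eq_mul, Nat.sub_self,
    Nat.sub_zero, pow_zero, pow_zero, one_mul, one_mul, mul_eq_zero] at h1
  rcases h1 with h1 | h1
  · rw [h1, zero_smul]
  · exact absurd h1 (pow_ne_zero _ fun h => hvw (by rw [← h]; ring))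

theorem finrank_map_add_finrank_inf_ker {V V' : Type*} [AddCommGroup V] [Module ℂ V]
    [FiniteDimensional ℂ V] [AddCommGroup V'] [Module ℂ V'] (f : V →ₗ[ℂ] V')
    (W : Submodule ℂ V) :
    Module.finrank ℂ (W.map f) + Module.finrank ℂ ↥(W ⊓ LinearMap.ker f) =
      Module.finrank ℂ W := by
  have h := LinearMap.finrank_range_add_finrank_ker (f.domRestrict W)
  rw [LinearMap.range_domRestrict] at h
  rw [← h]
  congr 1
  rw [LinearMap.ker_domRestrict, ← Submodule.map_comap_subtype]
  exact (Submodule.equivMapOfInjective W.subtype W.subtype_injective _).finrank_eq.symm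

theorem map_polarDeriv_self (n : ℕ) {v : Fin 2 → ℂ} (hv : v ≠ 0) {m : ℕ} (hm : m ≤ n) :
    (veroneseSpace (n + 1) v (m + 1)).map (polarDeriv n v) = veroneseSpace n v m := by
  refine Submodule.eq_of_le_of_finrank_le (map_polarDeriv_self_le n v hm) ?_
  have h := finrank_map_add_finrank_inf_ker (polarDeriv n v) (veroneseSpace (n + 1) v (m + 1))
  rw [ker_polarDeriv n hv, inf_eq_right.mpr (veroneseSpace_mono _ v 1 (m + 1) (by omega) (by omega)),
    finrank_veroneseSpace _ v hv _ (by omega), finrank_veroneseSpace _ v hv _ (by omega)] at h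
  rw [finrank_veroneseSpace _ v hv _ hm]
  omega

theorem map_polarDeriv (n : ℕ) {v w : Fin 2 → ℂ} (hv : v ≠ 0) (hw : w ≠ 0)
    (hvw : v 0 * w 1 - v 1 * w 0 ≠ 0) {m : ℕ} (hm : m ≤ n) :
    (veroneseSpace (n + 1) w m).map (polarDeriv n v) = veroneseSpace n w m := by
  refine Submodule.eq_of_le_of_finrank_le (map_formDeriv_le n _ _ w hm) ?_
  have h := finrank_map_add_finrank_inf_ker (polarDeriv n v) (veroneseSpace (n + 1) w m)
  rw [ker_polarDeriv n hv, (disjoint_ker_polarDeriv n hvw hm).eq_bot, finrank_bot,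
    finrank_veroneseSpace _ w hw _ (by omega)] at h
  rw [finrank_veroneseSpace _ w hw _ hm]
  omega

/-- The Veronese flags of four vectors, as a tuple of flags indexed by `ℕ`. -/
noncomputable def veroneseTuple (n : ℕ) (v : Fin 4 → Fin 2 → ℂ) :
    Fin 4 → ℕ → Submodule ℂ (Fin n → ℂ) := fun i j => veroneseSpace n (v i) (min j n)

theorem isFlagTuple_veroneseTuple (n : ℕ) {v : Fin 4 → Fin 2 → ℂ} (hv : ∀ i, v i ≠ 0) :
    IsFlagTuple n (veroneseTuple n v) where
  mono i _ _ h := veroneseSpace_mono n (v i) _ _ (min_le_min_right n h) (min_le_right _ _)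
  finrank_eq i j hj := by
    rw [veroneseTuple, finrank_veroneseSpace n (v i) (hv i) _ (min_le_right _ _), min_eq_left hj]

/-- The derivation is the projection from the line of the i-th flag: it lowers the index of that
flag by one and keeps those of the others. The left side contains the kernel, so it is the preimage
of its image. -/
theorem flagSup_veroneseTuple_succ (n : ℕ) {v : Fin 4 → Fin 2 → ℂ} (hv : ∀ i, v i ≠ 0)
    (hvv : ∀ i k, i ≠ k → v i 0 * v k 1 - v i 1 * v k 0 ≠ 0) (i : Fin 4) {J : Fin 4 → ℕ}
    (hJ : ∀ k, J k ≤ n) :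
    flagSup (veroneseTuple (n + 1) v) (J + Pi.single i 1) =
      (flagSup (veroneseTuple n v) J).comap (polarDeriv n (v i)) := by
  have hmap : (flagSup (veroneseTuple (n + 1) v) (J + Pi.single i 1)).map (polarDeriv n (v i)) =
      flagSup (veroneseTuple n v) J := by
    rw [flagSup, Submodule.map_iSup]
    refine iSup_congr fun k => ?_
    have hJk := hJ k
    by_cases hk : k = i
    · subst hk
      rw [Pi.add_apply, Pi.single_eq_same, veroneseTuple, veroneseTuple,
        min_eq_left (by omega), min_eq_left hJk, map_polarDeriv_self n (hv k) hJk]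
    · rw [Pi.add_apply, Pi.single_eq_of_ne hk, add_zero, veroneseTuple, veroneseTuple,
        min_eq_left (by omega), min_eq_left hJk,
        map_polarDeriv n (hv i) (hv k) (hvv i k (Ne.symm hk)) hJk]
  rw [← hmap, Submodule.comap_map_eq, ker_polarDeriv n (hv i), left_eq_sup]
  refine le_trans ?_ (le_flagSup _ _ i)
  have hJi := hJ i
  rw [Pi.add_apply, Pi.single_eq_same]
  exact veroneseSpace_mono _ _ _ _ (by omega) (min_le_right _ _)

/-- Four vectors of the plane with cross-ratio `ω`. -/
def crossRatioVec (ω : ℂ) (x y : Fin 2 → ℂ) : Fin 4 → Fin 2 → ℂ := ![x, y, x + y, ω • x + y]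

theorem crossRatioVec_det {ω : ℂ} (hω : ω ≠ 0) (hω1 : ω ≠ 1) {x y : Fin 2 → ℂ}
    (hxy : x 0 * y 1 - x 1 * y 0 ≠ 0) (i k : Fin 4) (hik : i ≠ k) :
    crossRatioVec ω x y i 0 * crossRatioVec ω x y k 1 -
      crossRatioVec ω x y i 1 * crossRatioVec ω x y k 0 ≠ 0 := by
  suffices h : ∃ c : ℂ, c ≠ 0 ∧ crossRatioVec ω x y i 0 * crossRatioVec ω x y k 1 -
      crossRatioVec ω x y i 1 * crossRatioVec ω x y k 0 = c * (x 0 * y 1 - x 1 * y 0) by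
    obtain ⟨c, hc, h⟩ := h
    rw [h]
    exact mul_ne_zero hc hxy
  have h1 : 1 - ω ≠ 0 := sub_ne_zero.mpr hω1.symm
  have h2 : ω - 1 ≠ 0 := sub_ne_zero.mpr hω1
  fin_cases i <;> fin_cases k <;> first
    | exact absurd rfl hik
    | skip
  · exact ⟨1, one_ne_zero, by simp [crossRatioVec]⟩
  · exact ⟨1, one_ne_zero, by simp [crossRatioVec]; ring⟩
  · exact ⟨1, one_ne_zero, by simp [crossRatioVec]; ring⟩
  · exact ⟨-1, by simp, by simp [crossRatioVec]; ring⟩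
  · exact ⟨-1, by simp, by simp [crossRatioVec]; ring⟩
  · exact ⟨-ω, by simpa, by simp [crossRatioVec]; ring⟩
  · exact ⟨-1, by simp, by simp [crossRatioVec]; ring⟩
  · exact ⟨1, by simp, by simp [crossRatioVec]; ring⟩
  · exact ⟨1 - ω, h1, by simp [crossRatioVec]; ring⟩
  · exact ⟨-1, by simp, by simp [crossRatioVec]; ring⟩
  · exact ⟨ω, hω, by simp [crossRatioVec]; ring⟩
  · exact ⟨ω - 1, h2, by simp [crossRatioVec]; ring⟩

theorem crossRatioVec_ne_zero {ω : ℂ} (hω : ω ≠ 0) (hω1 : ω ≠ 1) {x y : Fin 2 → ℂ}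
    (hxy : x 0 * y 1 - x 1 * y 0 ≠ 0) (i : Fin 4) : crossRatioVec ω x y i ≠ 0 := by
  intro h
  obtain ⟨k, hk⟩ := exists_ne i
  exact crossRatioVec_det hω hω1 hxy i k hk.symm (by simp [h])

theorem veroneseSpace_two_one (v : Fin 2 → ℂ) : veroneseSpace 2 v 1 = ℂ ∙ v := by
  rw [veroneseSpace, Set.range_unique]
  congr 2
  ext l
  fin_cases l <;> simp [veroneseVec]

/-- Induction on n: above n = 2 the layer has J i > 0 for some i, and projecting from the line of
the i-th flag lowers both n and J i by one. For n = 2 the quad consists of the four lines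
themselves. -/
theorem isRegularTuple_veroneseTuple {ω : ℂ} (hω : ω ≠ 0) (hω1 : ω ≠ 1) {x y : Fin 2 → ℂ}
    (hxy : x 0 * y 1 - x 1 * y 0 ≠ 0) (n : ℕ) (hn : 2 ≤ n) :
    IsRegularTuple ω n (veroneseTuple n (crossRatioVec ω x y)) where
  toIsFlagTuple := isFlagTuple_veroneseTuple n (crossRatioVec_ne_zero hω hω1 hxy)
  regQuad := by
    have hv := crossRatioVec_ne_zero hω hω1 hxy
    induction n, hn using Nat.le_induction with
    | base =>
      intro J hJ
      have hJ0 : J = 0 := by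
        ext i
        fin_cases i <;> simp <;> omega
      have hz := (isFlagTuple_veroneseTuple 2 hv).zero_eq
      subst hJ0
      have hsup : ∀ i, flagSup (veroneseTuple 2 (crossRatioVec ω x y)) (0 + Pi.single i 1) =
          ⊥ ⊔ (ℂ ∙ crossRatioVec ω x y i) := by
        intro i
        rw [← veroneseSpace_two_one, zero_add, bot_sup_eq]
        refine le_antisymm (iSup_le fun k => ?_) ?_
        · by_cases hk : k = i
          · subst hk
            rw [Pi.single_eq_same]
            exact le_rfl
          · rw [Pi.single_eq_of_ne hk, hz]
            exact bot_le
        · have := le_flagSup (veroneseTuple 2 (crossRatioVec ω x y)) (Pi.single i 1) i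
          rwa [Pi.single_eq_same] at this
      have h0 : flagSup (veroneseTuple 2 (crossRatioVec ω x y)) 0 = ⊥ := by
        simp only [flagSup, Pi.zero_apply, hz, iSup_bot]
      simp only [hsup, h0]
      refine ⟨x, y, fun a b hab => ?_, rfl, rfl, rfl, rfl⟩
      rw [Submodule.mem_bot] at hab
      have e0 := congrFun hab 0
      have e1 := congrFun hab 1
      simp only [Pi.add_apply, Pi.smul_apply, smul_eq_mul, Pi.zero_apply] at e0 e1
      constructor
      · refine (mul_eq_zero.mp (show a * (x 0 * y 1 - x 1 * y 0) = 0 from ?_)).resolve_right hxy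
        linear_combination y 1 * e0 - y 0 * e1
      · refine (mul_eq_zero.mp (show b * (x 0 * y 1 - x 1 * y 0) = 0 from ?_)).resolve_right hxy
        linear_combination x 0 * e1 - x 1 * e0
    | succ n hn ih =>
      intro J hJ
      obtain ⟨i, hi⟩ : ∃ i, 0 < J i := by
        by_contra! h
        have h0 := h 0
        have h1 := h 1
        have h2 := h 2
        have h3 := h 3
        omega
      obtain ⟨J, rfl⟩ : ∃ L, J = L + Pi.single i 1 := by
        refine ⟨J - Pi.single i 1, (tsub_add_cancel_of_le fun k => ?_).symm⟩
        by_cases hk : k = i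
        · subst hk
          simpa using Nat.succ_le_of_lt hi
        · simp [hk]
      have hsum : J 0 + J 1 + J 2 + J 3 + 2 = n := by
        have h := Finset.sum_add_distrib (s := Finset.univ) (f := J)
          (g := (Pi.single i 1 : Fin 4 → ℕ))
        rw [Fin.sum_univ_four, Fin.sum_univ_four, Finset.sum_pi_single'] at h
        simp only [Pi.add_apply] at hJ
        simp at h
        omega
      have hJk : ∀ k, J k + 1 ≤ n := by
        intro k
        fin_cases k <;> simp <;> omega
      have := (ih J hsum).comap (polarDeriv_surjective n (hv i))
      have hdet := crossRatioVec_det hω hω1 hxy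
      rw [← flagSup_veroneseTuple_succ n hv hdet i fun k => (Nat.le_succ _).trans (hJk k)] at this
      convert this using 2 with k
      rw [add_right_comm, flagSup_veroneseTuple_succ n hv hdet i]
      intro l
      refine le_trans ?_ (hJk l)
      by_cases hl : l = k
      · subst hl; simp
      · simp [hl]

end Veronese

/-! ### From maximal to regular tuples of flags -/

section FlagsLink

theorem card_piAntidiag_four (n : ℕ) (hn : 2 ≤ n) :
    ((Finset.piAntidiag (Finset.univ : Finset (Fin 4)) (n - 2)).card : ℝ) =
      (n : ℝ) * ((n : ℝ) ^ 2 - 1) / 6 := by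
  obtain ⟨m, rfl⟩ := Nat.exists_eq_add_of_le hn
  rw [Nat.add_sub_cancel_left, ← Finset.map_sym_eq_piAntidiag, Finset.card_map, Finset.sym_univ,
    Finset.card_univ, Sym.card_sym_eq_choose, Fintype.card_fin,
    show 4 + m - 1 = m + 3 by omega, Nat.choose_symm_add]
  induction m with
  | zero => norm_num
  | succ m ih =>
    have h1 : (m + 1 + 3).choose 3 = (m + 3).choose 2 + (m + 3).choose 3 :=
      Nat.choose_succ_succ (m + 3) 2
    have h2 : (((m + 3).choose 2 : ℕ) : ℝ) = (m + 3 : ℝ) * (m + 2) / 2 := by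
      rw [Nat.cast_choose_two]; push_cast; ring
    rw [h1, Nat.cast_add, ih (by omega), h2]
    push_cast
    ring

/-- The spaces of a complete flag, indexed by `ℕ`. -/
def CompleteFlag.natSpace {n : ℕ} (F : CompleteFlag n) (j : ℕ) : Submodule ℂ (Fin n → ℂ) :=
  F.space ⟨min j n, Nat.lt_succ_of_le (min_le_right j n)⟩

theorem CompleteFlag.natSpace_val {n : ℕ} (F : CompleteFlag n) (j : Fin (n + 1)) :
    F.natSpace j = F.space j := by
  unfold natSpace
  congr
  exact min_eq_left (Nat.le_of_lt_succ j.2)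

theorem isFlagTuple_natSpace {n : ℕ} (F : Fin 4 → CompleteFlag n) :
    IsFlagTuple n fun i => (F i).natSpace where
  mono i _ _ h := (F i).mono (Fin.mk_le_mk.mpr (min_le_min_right n h))
  finrank_eq i j hj := by
    rw [CompleteFlag.natSpace, CompleteFlag.finrank_space]
    exact min_eq_left hj

/-- Positive volume makes the product of four of the determinants non-real, so these are nonzero;
were d01 d23 zero, Plücker's relation would make that product real. -/
theorem det_ne_zero_of_volH3_pos {v : Fin 4 → Fin 2 → ℂ} (hv : ∀ i, v i ≠ 0)
    (h : 0 < volH3 fun i => Projectivization.mk ℂ (v i) (hv i)) {i k : Fin 4} (hik : i ≠ k) :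
    v i 0 * v k 1 - v i 1 * v k 0 ≠ 0 := by
  have hne : ((v 0 0 * v 2 1 - v 0 1 * v 2 0) * (v 1 0 * v 3 1 - v 1 1 * v 3 0) *
      star ((v 0 0 * v 3 1 - v 0 1 * v 3 0) * (v 1 0 * v 2 1 - v 1 1 * v 2 0))).im ≠ 0 := by
    intro h0
    rw [volH3_mk, h0] at h
    simp at h
  have h02 : v 0 0 * v 2 1 - v 0 1 * v 2 0 ≠ 0 := fun h => hne (by simp [h])
  have h13 : v 1 0 * v 3 1 - v 1 1 * v 3 0 ≠ 0 := fun h => hne (by simp [h])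
  have h03 : v 0 0 * v 3 1 - v 0 1 * v 3 0 ≠ 0 := fun h => hne (by simp [h])
  have h12 : v 1 0 * v 2 1 - v 1 1 * v 2 0 ≠ 0 := fun h => hne (by simp [h])
  have hpl : (v 0 0 * v 1 1 - v 0 1 * v 1 0) * (v 2 0 * v 3 1 - v 2 1 * v 3 0) ≠ 0 := by
    intro h
    apply hne
    rw [show (v 0 0 * v 2 1 - v 0 1 * v 2 0) * (v 1 0 * v 3 1 - v 1 1 * v 3 0) =
      (v 0 0 * v 3 1 - v 0 1 * v 3 0) * (v 1 0 * v 2 1 - v 1 1 * v 2 0) by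
        linear_combination h, RCLike.star_def, Complex.mul_conj]
    exact Complex.ofReal_im _
  have h01 := left_ne_zero_of_mul hpl
  have h23 := right_ne_zero_of_mul hpl
  have hsymm : ∀ {i k : Fin 4}, v i 0 * v k 1 - v i 1 * v k 0 ≠ 0 →
      v k 0 * v i 1 - v k 1 * v i 0 ≠ 0 := fun h h' => h (by linear_combination -h')
  fin_cases i <;> fin_cases k <;> first
    | exact absurd rfl hik
    | assumption
    | (apply hsymm; assumption)

/-- Composing the chosen identification with the quotient map replaces the quotient by a map on U
that vanishes exactly on W. -/
theorem exists_linearMap_of_volConf_pos {V : Type*} [AddCommGroup V] [Module ℂ V]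
    [FiniteDimensional ℂ V] {W U : Submodule ℂ V} {v : Fin 4 → V} (hv : ∀ i, v i ∈ U)
    (h : 0 < volConf (U ⧸ W.submoduleOf U) fun i => Submodule.Quotient.mk ⟨v i, hv i⟩) :
    ∃ (ψ : U →ₗ[ℂ] (Fin 2 → ℂ)) (hne : ∀ i, ψ ⟨v i, hv i⟩ ≠ 0), (∀ u, ψ u = 0 ↔ (u : V) ∈ W) ∧
      volConf (U ⧸ W.submoduleOf U) (fun i => Submodule.Quotient.mk ⟨v i, hv i⟩) =
        volH3 fun i => Projectivization.mk ℂ (ψ ⟨v i, hv i⟩) (hne i) := by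
  by_cases hc : Module.finrank ℂ (U ⧸ W.submoduleOf U) = 2 ∧
      ∀ i, (Submodule.Quotient.mk ⟨v i, hv i⟩ : U ⧸ W.submoduleOf U) ≠ 0
  · refine ⟨(LinearEquiv.ofFinrankEq (R := ℂ) (U ⧸ W.submoduleOf U) (Fin 2 → ℂ)
      (by simpa using hc.1)).toLinearMap ∘ₗ (W.submoduleOf U).mkQ,
      fun i => (LinearEquiv.map_ne_zero_iff _).mpr (hc.2 i), fun u => ?_, ?_⟩
    · rw [LinearMap.comp_apply, LinearEquiv.coe_coe, LinearEquiv.map_eq_zero_iff,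
        Submodule.mkQ_apply, Submodule.Quotient.mk_eq_zero]
      rfl
    · rw [volConf, dif_pos hc]
      rfl
  · rw [volConf, dif_neg hc] at h
    exact absurd h (lt_irrefl 0)

theorem volConf_le_v3 (V : Type*) [AddCommGroup V] [Module ℂ V] [FiniteDimensional ℂ V]
    (x : Fin 4 → V) : volConf V x ≤ v3 := by
  rw [volConf]
  split_ifs with h
  · exact volH3_le_v3 _
  · exact v3_pos.le

/-- The term of index `J` in `affineB A`. -/
noncomputable def affineVol {n : ℕ} (A : Fin 4 → AffineFlag n) (J : Fin 4 → Fin n) : ℝ :=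
  volConf
    ((⨆ i, (A i).space (J i).succ : Submodule ℂ (Fin n → ℂ)) ⧸
      (⨆ i, (A i).space (J i).castSucc : Submodule ℂ (Fin n → ℂ)).submoduleOf
        (⨆ i, (A i).space (J i).succ))
    (fun i => Submodule.Quotient.mk
      ⟨(A i).vec (J i), Submodule.mem_iSup_of_mem i ((A i).vec_mem (J i))⟩)

variable {n : ℕ} (A : Fin 4 → AffineFlag n) (J : Fin 4 → Fin n)

theorem flagSup_natSpace : flagSup (fun i => (A i).natSpace) (fun i => (J i : ℕ)) =
    ⨆ i, (A i).space (J i).castSucc :=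
  iSup_congr fun i => (A i).natSpace_val (J i).castSucc

theorem natSpace_succ (i : Fin 4) : (A i).natSpace ((J i : ℕ) + 1) =
    (ℂ ∙ (A i).vec (J i)) ⊔ (A i).natSpace (J i) := by
  have h1 := (A i).natSpace_val (J i).succ
  have h2 := (A i).natSpace_val (J i).castSucc
  rw [Fin.val_succ] at h1
  rw [Fin.val_castSucc] at h2
  rw [h1, h2, (A i).space_succ]

theorem flagSup_add_single {K V : Type*} [Field K] [AddCommGroup V] [Module K V]
    {F : Fin 4 → ℕ → Submodule K V} (hF : ∀ i, Monotone (F i)) (L : Fin 4 → ℕ) (k : Fin 4) :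
    flagSup F (L + Pi.single k 1) = flagSup F L ⊔ F k (L k + 1) := by
  refine le_antisymm (iSup_le fun i => ?_) (sup_le (flagSup_mono hF
    (le_add_of_nonneg_right zero_le)) ?_)
  · by_cases hi : i = k
    · subst hi
      simp
    · simp only [Pi.add_apply, Pi.single_eq_of_ne hi, add_zero]
      exact (le_flagSup F L i).trans le_sup_left
  · have := le_flagSup F (L + Pi.single k 1) k
    rwa [Pi.add_apply, Pi.single_eq_same] at this

theorem flagSup_natSpace_add_single (k : Fin 4) :
    flagSup (fun i => (A i).natSpace) ((fun i => (J i : ℕ)) + Pi.single k 1) =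
      (⨆ i, (A i).space (J i).castSucc) ⊔ (ℂ ∙ (A k).vec (J k)) := by
  have hF := isFlagTuple_natSpace fun i => (A i).toCompleteFlag
  rw [flagSup_add_single hF.mono, natSpace_succ, flagSup_natSpace, sup_comm (ℂ ∙ _), ← sup_assoc]
  congr 1
  rw [sup_eq_left, ← flagSup_natSpace]
  exact le_flagSup (fun i => (A i).natSpace) (fun i => (J i : ℕ)) k

theorem exists_linearMap_of_affineVol_pos (h : 0 < affineVol A J) :
    ∃ (ψ : (⨆ i, (A i).space (J i).succ : Submodule ℂ (Fin n → ℂ)) →ₗ[ℂ] (Fin 2 → ℂ))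
      (hne : ∀ i, ψ ⟨(A i).vec (J i), Submodule.mem_iSup_of_mem i ((A i).vec_mem (J i))⟩ ≠ 0),
      (∀ u, ψ u = 0 ↔ (u : Fin n → ℂ) ∈ ⨆ i, (A i).space (J i).castSucc) ∧
      affineVol A J = volH3 fun i => Projectivization.mk ℂ
        (ψ ⟨(A i).vec (J i), Submodule.mem_iSup_of_mem i ((A i).vec_mem (J i))⟩) (hne i) :=
  exists_linearMap_of_volConf_pos _ h

theorem isGoodIndex_of_affineVol_pos (h : 0 < affineVol A J) :
    IsGoodIndex (fun i => (A i).natSpace) (fun i => (J i : ℕ)) := by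
  have hF := isFlagTuple_natSpace fun i => (A i).toCompleteFlag
  obtain ⟨ψ, hne, hker, hvol⟩ := exists_linearMap_of_affineVol_pos A J h
  rw [hvol] at h
  have hdet := fun {i k : Fin 4} => det_ne_zero_of_volH3_pos hne h (i := i) (k := k)
  have hvec : ∀ i, (A i).vec (J i) ∈ ⨆ i, (A i).space (J i).succ := fun i =>
    Submodule.mem_iSup_of_mem i ((A i).vec_mem (J i))
  refine ⟨fun i k hik hle => ?_, fun i k l hik => ?_⟩
  · rw [flagSup_natSpace_add_single] at hle
    have hmem : (A i).vec (J i) ∈ (A i).natSpace ((J i : ℕ) + 1) := by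
      rw [natSpace_succ]
      exact Submodule.mem_sup_left (Submodule.mem_span_singleton_self _)
    obtain ⟨c, hc⟩ := Submodule.mem_sup_span_singleton_iff.mp (hle hmem)
    have h0 := (hker (⟨_, hvec i⟩ - c • ⟨_, hvec k⟩)).mpr hc
    rw [map_sub, map_smul, sub_eq_zero] at h0
    refine hdet hik ?_
    rw [h0]
    simp only [Pi.smul_apply, smul_eq_mul]
    ring
  · have hd := hdet hik
    have hsup : flagSup (fun i => (A i).natSpace)
        ((fun i => (J i : ℕ)) + Pi.single i 1 + Pi.single k 1) =
        (⨆ i, (A i).space (J i).castSucc) ⊔ (ℂ ∙ (A i).vec (J i)) ⊔ (ℂ ∙ (A k).vec (J k)) := by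
      rw [flagSup_add_single hF.mono, flagSup_natSpace_add_single]
      rw [Pi.add_apply, Pi.single_eq_of_ne hik.symm, add_zero, natSpace_succ,
        sup_comm (ℂ ∙ (A k).vec (J k)), ← sup_assoc]
      congr 1
      rw [sup_eq_left, ← flagSup_natSpace]
      exact (le_flagSup (fun i => (A i).natSpace) (fun i => (J i : ℕ)) k).trans le_sup_left
    rw [hsup]
    change (A l).natSpace ((J l : ℕ) + 1) ≤ _
    rw [natSpace_succ]
    refine sup_le ((Submodule.span_singleton_le_iff_mem _ _).mpr ?_) ?_
    · rw [Submodule.mem_sup_span_singleton_iff]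
      set yi := ψ ⟨_, hvec i⟩ with hyi
      set yk := ψ ⟨_, hvec k⟩ with hyk
      set yl := ψ ⟨_, hvec l⟩ with hyl
      have hd : yi 0 * yk 1 - yi 1 * yk 0 ≠ 0 := hd
      -- Cramer's rule: yl = a yk + b yi.
      obtain ⟨a, ha⟩ : ∃ a, a = (yi 0 * yl 1 - yi 1 * yl 0) / (yi 0 * yk 1 - yi 1 * yk 0) :=
        ⟨_, rfl⟩
      obtain ⟨b, hb⟩ : ∃ b, b = (yl 0 * yk 1 - yl 1 * yk 0) / (yi 0 * yk 1 - yi 1 * yk 0) :=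
        ⟨_, rfl⟩
      refine ⟨a, Submodule.mem_sup_span_singleton_iff.mpr ⟨b, ?_⟩⟩
      refine (hker (⟨_, hvec l⟩ - a • ⟨_, hvec k⟩ - b • ⟨_, hvec i⟩)).mp ?_
      rw [map_sub, map_sub, map_smul, map_smul, ← hyi, ← hyk, ← hyl, ha, hb]
      ext m
      fin_cases m
      · simp
        field_simp
        ring
      · simp
        field_simp
        ring
    · refine le_sup_of_le_left (le_sup_of_le_left ?_)
      rw [← flagSup_natSpace]
      exact le_flagSup (fun i => (A i).natSpace) (fun i => (J i : ℕ)) l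

/-- The vectors x, y of `exists_basis_of_volH3_eq_v3` lift to multiples of v 0 and v 1, and the
relations between the four vectors hold modulo W. -/
theorem isRegQuad_of_volH3_eq {V : Type*} [AddCommGroup V] [Module ℂ V] {W U : Submodule ℂ V}
    (v : Fin 4 → U) (ψ : U →ₗ[ℂ] (Fin 2 → ℂ)) (hne : ∀ i, ψ (v i) ≠ 0)
    (hker : ∀ u, ψ u = 0 ↔ (u : V) ∈ W)
    (h : volH3 (fun i => Projectivization.mk ℂ (ψ (v i)) (hne i)) = v3) :
    IsRegQuad hexRoot W (fun i => W ⊔ (ℂ ∙ (v i : V))) := by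
  obtain ⟨c, x, y, hc, hxy, h0, h1, h2, h3⟩ := exists_basis_of_volH3_eq_v3 _ hne h
  obtain ⟨e, he'⟩ : ∃ e, e = (c 0)⁻¹ • v 0 := ⟨_, rfl⟩
  obtain ⟨f, hf'⟩ : ∃ f, f = (c 1)⁻¹ • v 1 := ⟨_, rfl⟩
  have he : ψ e = x := by
    rw [he', map_smul, h0, smul_smul, inv_mul_cancel₀ (hc 0), one_smul]
  have hf : ψ f = y := by
    rw [hf', map_smul, h1, smul_smul, inv_mul_cancel₀ (hc 1), one_smul]
  have key : ∀ i u, ψ (v i) = c i • ψ u → W ⊔ (ℂ ∙ (v i : V)) = W ⊔ (ℂ ∙ (u : V)) :=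
    fun i u hu => Submodule.sup_span_singleton_eq_of_sub_mem (hc i) ((hker (v i - c i • u)).mp
      (by rw [map_sub, map_smul, hu, sub_self]))
  refine ⟨e, f, fun a b hab => ?_, key 0 e (by rw [h0, he]), key 1 f (by rw [h1, hf]),
    key 2 (e + f) (by rw [h2, map_add, he, hf]),
    key 3 (hexRoot • e + f) (by rw [h3, map_add, map_smul, he, hf])⟩
  have h := (hker (a • e + b • f)).mpr hab
  rw [map_add, map_smul, map_smul, he, hf] at h
  have e0 := congrFun h 0
  have e1 := congrFun h 1
  simp only [Pi.add_apply, Pi.smul_apply, smul_eq_mul, Pi.zero_apply] at e0 e1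
  constructor
  · refine (mul_eq_zero.mp (show a * (x 0 * y 1 - x 1 * y 0) = 0 from ?_)).resolve_right hxy
    linear_combination y 1 * e0 - y 0 * e1
  · refine (mul_eq_zero.mp (show b * (x 0 * y 1 - x 1 * y 0) = 0 from ?_)).resolve_right hxy
    linear_combination x 0 * e1 - x 1 * e0

theorem isRegQuad_of_affineVol_eq (h : affineVol A J = v3) :
    IsRegQuad hexRoot (flagSup (fun i => (A i).natSpace) fun i => (J i : ℕ))
      (fun k => flagSup (fun i => (A i).natSpace) ((fun i => (J i : ℕ)) + Pi.single k 1)) := by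
  obtain ⟨ψ, hne, hker, hvol⟩ := exists_linearMap_of_affineVol_pos A J (by rw [h]; exact v3_pos)
  rw [hvol] at h
  have := isRegQuad_of_volH3_eq (fun i => ⟨(A i).vec (J i),
    Submodule.mem_iSup_of_mem i ((A i).vec_mem (J i))⟩) ψ hne hker h
  rw [flagSup_natSpace]
  convert this using 2 with k
  exact flagSup_natSpace_add_single A J k

/-- Maximal tuples of flags are regular. -/
theorem isRegularTuple_of_affineB_eq (hn : 2 ≤ n)
    (h : affineB A = (n : ℝ) * ((n : ℝ) ^ 2 - 1) / 6 * v3) :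
    IsRegularTuple hexRoot n fun i => (A i).natSpace := by
  classical
  have hF := isFlagTuple_natSpace fun i => (A i).toCompleteFlag
  have hV : Module.finrank ℂ (Fin n → ℂ) = n := Module.finrank_fin_fun ℂ
  set N := (Finset.piAntidiag (Finset.univ : Finset (Fin 4)) (n - 2)).card with hN
  have hle : ∀ J, affineVol A J ≤ v3 := fun J => volConf_le_v3 _ _
  let T : Finset (Fin 4 → Fin n) := Finset.univ.filter fun J => 0 < affineVol A J
  -- Squeeze: the positive terms sum to at least N v₃, each is at most v₃, and the count of good
  -- indices allows at most N of them; so there are exactly N, all equal to v₃.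
  have hsum : (N : ℝ) * v3 ≤ ∑ J ∈ T, affineVol A J := by
    rw [hN, card_piAntidiag_four n hn, ← h]
    change ∑ J, affineVol A J ≤ _
    rw [← Finset.sum_filter_add_sum_filter_not Finset.univ (fun J => 0 < affineVol A J)]
    refine add_le_of_nonpos_right (Finset.sum_nonpos fun J hJ => ?_)
    exact not_lt.mp (Finset.mem_filter.mp hJ).2
  have hinj : Function.Injective fun (J : Fin 4 → Fin n) (i : Fin 4) => (J i : ℕ) := by
    intro J J' hJ
    funext i
    exact Fin.ext (congrFun hJ i)
  have hsub : T.image (fun (J : Fin 4 → Fin n) (i : Fin 4) => (J i : ℕ)) ⊆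
      goodIndices n fun i => (A i).natSpace := by
    intro L hL
    obtain ⟨J, hJ, rfl⟩ := Finset.mem_image.mp hL
    exact mem_goodIndices.mpr ⟨fun i => (J i).2,
      isGoodIndex_of_affineVol_pos A J (Finset.mem_filter.mp hJ).2⟩
  have hTcard : T.card ≤ (goodIndices n fun i => (A i).natSpace).card := by
    rw [← Finset.card_image_of_injective T hinj]
    exact Finset.card_le_card hsub
  have hgood := card_goodIndices_le hF hV
  have hT : ∑ J ∈ T, affineVol A J ≤ (T.card : ℝ) * v3 := by
    rw [← nsmul_eq_mul]
    exact Finset.sum_le_card_nsmul _ _ _ fun J _ => hle J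
  have hNT : N ≤ T.card := by
    have := le_of_mul_le_mul_right (hsum.trans hT) v3_pos
    exact_mod_cast this
  have hTN : T.card = N := le_antisymm (hTcard.trans hgood) hNT
  have heq := goodIndices_eq hF hV (hNT.trans hTcard)
  have himg : T.image (fun (J : Fin 4 → Fin n) (i : Fin 4) => (J i : ℕ)) =
      Finset.piAntidiag (Finset.univ : Finset (Fin 4)) (n - 2) := by
    rw [← heq]
    refine Finset.eq_of_subset_of_card_le hsub ?_
    rw [Finset.card_image_of_injective T hinj, hTN]
    exact hgood
  have hv3 : ∀ J ∈ T, affineVol A J = v3 := by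
    refine (Finset.sum_eq_sum_iff_of_le fun J _ => hle J).mp (le_antisymm
      (Finset.sum_le_sum fun J _ => hle J) ?_)
    rw [Finset.sum_const, nsmul_eq_mul, hTN]
    exact hsum
  refine ⟨hF, fun L hL => ?_⟩
  have hmem : L ∈ Finset.piAntidiag (Finset.univ : Finset (Fin 4)) (n - 2) := by
    rw [Finset.mem_piAntidiag, Fin.sum_univ_four]
    exact ⟨by omega, fun _ _ => Finset.mem_univ _⟩
  rw [← himg] at hmem
  obtain ⟨J, hJ, rfl⟩ := Finset.mem_image.mp hmem
  exact isRegQuad_of_affineVol_eq A J (hv3 J hJ)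

theorem IsMaximalFlags.isRegularTuple (hn : 2 ≤ n) {F : Fin 4 → CompleteFlag n}
    (h : IsMaximalFlags F) : IsRegularTuple hexRoot n fun i => (F i).natSpace := by
  have := isRegularTuple_of_affineB_eq (fun i => (F i).exists_affineFlag.choose) hn h
  simpa only [fun i => (F i).exists_affineFlag.choose_spec] using this

end FlagsLink

/-! ### The walk through triangular lattices -/

section Walk

/-- The image of a flag under a linear automorphism. -/
def CompleteFlag.mapEquiv {n : ℕ} (F : CompleteFlag n) (h : (Fin n → ℂ) ≃ₗ[ℂ] (Fin n → ℂ)) :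
    CompleteFlag n where
  space j := (F.space j).map h.toLinearMap
  mono _ _ hj := Submodule.map_mono (F.mono hj)
  finrank_space j := by
    rw [LinearEquiv.finrank_map_eq]
    exact F.finrank_space j

theorem CompleteFlag.ext_natSpace {n : ℕ} {F G : CompleteFlag n}
    (h : ∀ j ≤ n, F.natSpace j = G.natSpace j) : F = G := by
  refine CompleteFlag.ext (funext fun j => ?_)
  rw [← F.natSpace_val, ← G.natSpace_val]
  exact h j (Nat.le_of_lt_succ j.2)

theorem CompleteFlag.mapEquiv_trans {n : ℕ} (F : CompleteFlag n)
    (h h' : (Fin n → ℂ) ≃ₗ[ℂ] (Fin n → ℂ)) :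
    F.mapEquiv (h.trans h') = (F.mapEquiv h).mapEquiv h' :=
  CompleteFlag.ext (funext fun j => Submodule.map_comp h.toLinearMap h'.toLinearMap (F.space j))

theorem CompleteFlag.mapEquiv_eq_self {n : ℕ} (F : CompleteFlag n)
    {h : (Fin n → ℂ) ≃ₗ[ℂ] (Fin n → ℂ)} {c : ℂ} (hh : ∀ v, h v = c • v) :
    F.mapEquiv h = F := by
  refine CompleteFlag.ext (funext fun j => ?_)
  refine Submodule.eq_of_le_of_finrank_eq ?_ (LinearEquiv.finrank_map_eq h _)
  rintro _ ⟨v, hv, rfl⟩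
  change h v ∈ _
  rw [hh]
  exact Submodule.smul_mem _ _ hv

/-- The point of `P(ℂ²)` missed by the affine chart. -/
noncomputable def PC2.infty : PC2 :=
  Projectivization.mk ℂ ![1, 0] (fun h => one_ne_zero (congrFun h 0))

/-- The vertices of a positively oriented regular ideal simplex, one of which is `∞`. -/
noncomputable def regularQuad (a r : ℂ) : Fin 4 → PC2 :=
  ![PC2.infty, PC2.chart a, PC2.chart (a + r), PC2.chart (a + hexRoot * r)]

theorem hexRoot_ne_zero : hexRoot ≠ 0 := fun h => by
  have := hexRoot_sq
  rw [h] at this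
  norm_num at this

theorem hexRoot_ne_one : hexRoot ≠ 1 := fun h => by
  have := hexRoot_im_pos
  rw [h] at this
  simp at this

theorem affine_det_ne_zero (a : ℂ) {r : ℂ} (hr : r ≠ 0) :
    (![r, 0] : Fin 2 → ℂ) 0 * (![a, 1] : Fin 2 → ℂ) 1 -
      (![r, 0] : Fin 2 → ℂ) 1 * (![a, 1] : Fin 2 → ℂ) 0 ≠ 0 := by
  simpa using hr

theorem mk_crossRatioVec (a : ℂ) {r : ℂ} (hr : r ≠ 0) (i : Fin 4) :
    Projectivization.mk ℂ (crossRatioVec hexRoot ![r, 0] ![a, 1] i)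
      (crossRatioVec_ne_zero hexRoot_ne_zero hexRoot_ne_one (affine_det_ne_zero a hr) i) =
      regularQuad a r i := by
  fin_cases i
  · refine (Projectivization.mk_eq_mk_iff' ℂ _ _ _ _).mpr ⟨r, ?_⟩
    simp [crossRatioVec]
  · rfl
  · refine (Projectivization.mk_eq_mk_iff' ℂ _ _ _ _).mpr ⟨1, ?_⟩
    simp [crossRatioVec, add_comm]
  · refine (Projectivization.mk_eq_mk_iff' ℂ _ _ _ _).mpr ⟨1, ?_⟩
    simp [crossRatioVec, add_comm]

theorem isMaximalPoints_regularQuad (a : ℂ) {r : ℂ} (hr : r ≠ 0) :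
    IsMaximalPoints (regularQuad a r) := by
  rw [IsMaximalPoints, ← funext (mk_crossRatioVec a hr), v3_eq,
    volH3_mk_eq_sideVolume (crossRatioVec hexRoot ![r, 0] ![a, 1]) _ (d01 := r) (d02 := r)
      (d03 := r) (d12 := -r) (d13 := -(hexRoot * r)) (z := hexRoot) (h23 := rfl),
    norm_hexRoot,
    norm_one_sub_hexRoot]
  all_goals simp [crossRatioVec, hr]
  all_goals ring

variable {n : ℕ}

theorem isRegularTuple_veronese (hn : 2 ≤ n) {x y : Fin 2 → ℂ} (hxy : x 0 * y 1 - x 1 * y 0 ≠ 0) :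
    IsRegularTuple hexRoot n fun i => (veronese n (Projectivization.mk ℂ
      (crossRatioVec hexRoot x y i)
      (crossRatioVec_ne_zero hexRoot_ne_zero hexRoot_ne_one hxy i))).natSpace :=
  isRegularTuple_veroneseTuple hexRoot_ne_zero hexRoot_ne_one hxy n hn

theorem isRegularTuple_regularQuad (hn : 2 ≤ n) (a : ℂ) {r : ℂ} (hr : r ≠ 0) :
    IsRegularTuple hexRoot n fun i => (veronese n (regularQuad a r i)).natSpace := by
  have := isRegularTuple_veronese hn (affine_det_ne_zero a hr)
  simpa only [mk_crossRatioVec a hr] using this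

theorem exists_mapEquiv_of_isRegularTuple (hn : 2 ≤ n) {F : Fin 4 → CompleteFlag n}
    (hF : IsRegularTuple hexRoot n fun i => (F i).natSpace) (a : ℂ) {r : ℂ} (hr : r ≠ 0) :
    ∃ h, ∀ i, F i = (veronese n (regularQuad a r i)).mapEquiv h := by
  obtain ⟨h, hh⟩ := (isRegularTuple_regularQuad hn a hr).exists_linearEquiv hexRoot_ne_zero hn
    (Module.finrank_fin_fun ℂ) hF
  exact ⟨h, fun i => CompleteFlag.ext_natSpace fun j hj => (hh i j hj).symm⟩

/-- h⁻¹ ∘ h' fixes three flags of a regular tuple, so it is a scalar and acts trivially on every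
flag. -/
theorem mapEquiv_eq_of_regularQuad (hn : 2 ≤ n) {a r : ℂ} (hr : r ≠ 0)
    {h h' : (Fin n → ℂ) ≃ₗ[ℂ] (Fin n → ℂ)}
    (hh : ∀ i : Fin 4, i ≠ 3 → (veronese n (regularQuad a r i)).mapEquiv h =
      (veronese n (regularQuad a r i)).mapEquiv h') (G : CompleteFlag n) :
    G.mapEquiv h = G.mapEquiv h' := by
  have hself : ∀ F : CompleteFlag n, (F.mapEquiv h).mapEquiv h.symm = F := fun F => by
    rw [← CompleteFlag.mapEquiv_trans, LinearEquiv.self_trans_symm]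
    exact F.mapEquiv_eq_self (c := 1) (fun v => by simp)
  have hself' : ∀ F : CompleteFlag n, (F.mapEquiv h.symm).mapEquiv h = F := fun F => by
    rw [← CompleteFlag.mapEquiv_trans, LinearEquiv.symm_trans_self]
    exact F.mapEquiv_eq_self (c := 1) (fun v => by simp)
  obtain ⟨c, -, hcv⟩ := (isRegularTuple_regularQuad hn a hr).exists_smul hexRoot_ne_zero hn
    (Module.finrank_fin_fun ℂ) (h'.trans h.symm) (fun i hi j hj => by
      have h1 : ((veronese n (regularQuad a r i)).mapEquiv (h'.trans h.symm)) =
          veronese n (regularQuad a r i) := by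
        rw [CompleteFlag.mapEquiv_trans, ← hh i hi, hself]
      exact congrArg (fun F => CompleteFlag.natSpace F j) h1)
  have h2 := G.mapEquiv_eq_self hcv
  rw [CompleteFlag.mapEquiv_trans] at h2
  have h3 := congrArg (fun F => CompleteFlag.mapEquiv F h) h2
  simp only [hself'] at h3
  exact h3.symm

/-- The countable dense field `ℚ(ω)`, as a set. -/
def hexField : Set ℂ := Set.range fun q : ℚ × ℚ => (q.1 : ℂ) + q.2 * hexRoot

theorem hexField_add {x y : ℂ} (hx : x ∈ hexField) (hy : y ∈ hexField) : x + y ∈ hexField := by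
  obtain ⟨q, rfl⟩ := hx
  obtain ⟨q', rfl⟩ := hy
  refine ⟨(q.1 + q'.1, q.2 + q'.2), ?_⟩
  push_cast
  ring

theorem hexField_rat_mul (c : ℚ) {x : ℂ} (hx : x ∈ hexField) : (c : ℂ) * x ∈ hexField := by
  obtain ⟨q, rfl⟩ := hx
  refine ⟨(c * q.1, c * q.2), ?_⟩
  push_cast
  ring

theorem hexField_hexRoot_mul {x : ℂ} (hx : x ∈ hexField) : hexRoot * x ∈ hexField := by
  obtain ⟨q, rfl⟩ := hx
  refine ⟨(-q.2, q.1 + q.2), ?_⟩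
  push_cast
  linear_combination -(q.2 : ℂ) * hexRoot_sq

theorem one_mem_hexField : (1 : ℂ) ∈ hexField := ⟨(1, 0), by simp⟩

theorem rat_mem_hexField (c : ℚ) : (c : ℂ) ∈ hexField := ⟨(c, 0), by simp⟩

theorem neg_mem_hexField {x : ℂ} (hx : x ∈ hexField) : -x ∈ hexField := by
  have := hexField_rat_mul (-1) hx
  simpa using this

/-- A set of points that is closed under the completion of oriented equilateral triangles contains,
with two neighbours of a triangular lattice, the lattice. -/
theorem mem_of_triangle_closed {P : ℂ → Prop}
    (hP : ∀ p ∈ hexField, ∀ d ∈ hexField, d ≠ 0 → P p → P (p + d) → P (p + hexRoot * d))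
    {p d : ℂ} (hp : p ∈ hexField) (hd : d ∈ hexField) (hd0 : d ≠ 0) (h0 : P p) (h1 : P (p + d))
    (m k : ℤ) : P (p + (m + k * hexRoot) * d) := by
  have w2 := hexRoot_sq
  -- Iterating the closure property turns an edge by multiples of 60 degrees about its endpoint, and
  -- three turns reverse it.
  have w3 : hexRoot ^ 3 = -1 := by linear_combination (hexRoot + 1) * w2
  have hmemk : ∀ (j : ℕ) {e : ℂ}, e ∈ hexField → hexRoot ^ j * e ∈ hexField := by
    intro j
    induction j with
    | zero => intro e he; simpa using he
    | succ j ih =>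
      intro e he
      rw [pow_succ', mul_assoc]
      exact hexField_hexRoot_mul (ih he)
  have hrot : ∀ (j : ℕ) {q e : ℂ}, q ∈ hexField → e ∈ hexField → e ≠ 0 → P q → P (q + e) →
      P (q + hexRoot ^ j * e) := by
    intro j
    induction j with
    | zero => intro q e _ _ _ _ h; simpa using h
    | succ j ih =>
      intro q e hq he he0 h h'
      rw [pow_succ', mul_assoc]
      exact hP q hq _ (hmemk j he) (mul_ne_zero (pow_ne_zero _ hexRoot_ne_zero) he0) h
        (ih hq he he0 h h')
  have hmem : ∀ m k : ℤ, p + (m + k * hexRoot) * d ∈ hexField := by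
    intro m k
    have h1 := hexField_rat_mul (m : ℚ) hd
    have h2 := hexField_rat_mul (k : ℚ) (hexField_hexRoot_mul hd)
    have := hexField_add hp (hexField_add h1 h2)
    convert this using 1
    push_cast
    ring
  have hneg : ∀ {q : ℂ}, q ∈ hexField → P q → P (q + d) → P (q - d) := by
    intro q hq h h'
    have := hrot 3 hq hd hd0 h h'
    rwa [w3, neg_one_mul, ← sub_eq_add_neg] at this
  have hright : ∀ {q : ℂ}, q ∈ hexField → P q → P (q + d) → P (q + d + d) := by
    intro q hq h h'
    have := hrot 3 (hexField_add hq hd) (neg_mem_hexField hd) (neg_ne_zero.mpr hd0) h'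
      (by rwa [add_neg_cancel_right])
    rwa [w3, neg_one_mul, neg_neg] at this
  have hup : ∀ {q : ℂ}, q ∈ hexField → P q → P (q + d) →
      P (q + hexRoot * d) ∧ P (q + hexRoot * d + d) := by
    intro q hq h h'
    refine ⟨hP q hq d hd hd0 h h', ?_⟩
    have := hrot 2 (hexField_add hq hd) (hmemk 2 hd)
      (mul_ne_zero (pow_ne_zero _ hexRoot_ne_zero) hd0) h' (by
        convert hP q hq d hd hd0 h h' using 1; rw [w2]; ring)
    have := hrot 3 (hexField_add hq hd) (hmemk 2 (hmemk 2 hd))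
      (mul_ne_zero (pow_ne_zero _ hexRoot_ne_zero)
        (mul_ne_zero (pow_ne_zero _ hexRoot_ne_zero) hd0)) h' this
    convert this using 1
    linear_combination (-hexRoot * hexRoot ^ 3 + hexRoot) * d * w3
  have hdown : ∀ {q : ℂ}, q ∈ hexField → P q → P (q + d) →
      P (q - hexRoot * d) ∧ P (q - hexRoot * d + d) := by
    intro q hq h h'
    have h4 := hrot 4 hq hd hd0 h h'
    have h5 := hrot 5 hq hd hd0 h h'
    constructor
    · convert h4 using 1
      linear_combination -(hexRoot * d) * w3
    · convert h5 using 1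
      linear_combination -(hexRoot ^ 2 * d) * w3 + d * w2
  -- The induction carries an edge rather than a point, since both endpoints are needed to reach the
  -- adjacent row.
  have hrow : ∀ k : ℤ, P (p + (k * hexRoot) * d) ∧ P (p + (k * hexRoot) * d + d) := by
    intro k
    induction k using Int.induction_on with
    | zero => simpa using ⟨h0, h1⟩
    | succ k ih =>
      have := hup (by simpa using hmem 0 k) ih.1 ih.2
      push_cast at this ⊢
      refine ⟨?_, ?_⟩
      · convert this.1 using 1; ring
      · convert this.2 using 1; ring
    | pred k ih =>
      have := hdown (by simpa using hmem 0 (-k)) ih.1 ih.2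
      push_cast at this ⊢
      refine ⟨?_, ?_⟩
      · convert this.1 using 1; ring
      · convert this.2 using 1; ring
  have hall : ∀ m : ℤ, P (p + (m + k * hexRoot) * d) ∧ P (p + (m + k * hexRoot) * d + d) := by
    intro m
    induction m using Int.induction_on with
    | zero => simpa using hrow k
    | succ m ih =>
      have := hright (hmem m k) ih.1 ih.2
      push_cast at this ih ⊢
      refine ⟨?_, ?_⟩
      · convert ih.2 using 1; ring
      · convert this using 1; ring
    | pred m ih =>
      have := hneg (hmem (-m) k) ih.1 ih.2
      push_cast at this ih ⊢
      refine ⟨?_, ?_⟩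
      · convert this using 1; ring
      · convert ih.1 using 1; ring
  exact (hall m).1

/-- If a family of flags indexed by `ℚ(ω) ∪ {∞}` sends the vertices of regular simplices to regular
tuples, then it is a Veronese family. -/
theorem exists_mapEquiv_of_forall_isRegularTuple (hn : 2 ≤ n) (t : ℂ) (Ψ : ℂ → CompleteFlag n)
    (Ψ0 : CompleteFlag n)
    (hΨ : ∀ p ∈ hexField, ∀ r ∈ hexField, r ≠ 0 → IsRegularTuple hexRoot n fun i =>
      ((![Ψ0, Ψ (t + p), Ψ (t + p + r), Ψ (t + p + hexRoot * r)] : Fin 4 → CompleteFlag n)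
        i).natSpace) :
    ∃ h, ∀ p ∈ hexField, Ψ (t + p) = (veronese n (PC2.chart (t + p))).mapEquiv h := by
  -- A single triangle together with ∞ already yields an automorphism; what remains is to compare
  -- these.
  have hex : ∀ p ∈ hexField, ∀ r ∈ hexField, r ≠ 0 → ∃ h,
      Ψ0 = (veronese n PC2.infty).mapEquiv h ∧
      Ψ (t + p) = (veronese n (PC2.chart (t + p))).mapEquiv h ∧
      Ψ (t + p + r) = (veronese n (PC2.chart (t + p + r))).mapEquiv h ∧
      Ψ (t + p + hexRoot * r) = (veronese n (PC2.chart (t + p + hexRoot * r))).mapEquiv h := by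
    intro p hp r hr hr0
    obtain ⟨h, hh⟩ := exists_mapEquiv_of_isRegularTuple hn (hΨ p hp r hr hr0) (t + p) hr0
    exact ⟨h, hh 0, hh 1, hh 2, hh 3⟩
  -- Simplices sharing ∞ and an edge share three flags, which fixes the action of the automorphism
  -- on all flags.
  have huniq : ∀ {h h' : (Fin n → ℂ) ≃ₗ[ℂ] (Fin n → ℂ)} {a r : ℂ}, r ≠ 0 →
      Ψ0 = (veronese n PC2.infty).mapEquiv h → Ψ0 = (veronese n PC2.infty).mapEquiv h' →
      Ψ a = (veronese n (PC2.chart a)).mapEquiv h →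
      Ψ a = (veronese n (PC2.chart a)).mapEquiv h' →
      Ψ (a + r) = (veronese n (PC2.chart (a + r))).mapEquiv h →
      Ψ (a + r) = (veronese n (PC2.chart (a + r))).mapEquiv h' →
      ∀ G : CompleteFlag n, G.mapEquiv h = G.mapEquiv h' := by
    intro h h' a r hr e0 e0' e1 e1' e2 e2'
    refine mapEquiv_eq_of_regularQuad hn (a := a) hr fun i hi => ?_
    fin_cases i
    · exact e0.symm.trans e0'
    · exact e1.symm.trans e1'
    · exact e2.symm.trans e2'
    · exact absurd rfl hi
  have hlat : ∀ {h : (Fin n → ℂ) ≃ₗ[ℂ] (Fin n → ℂ)} {d : ℂ}, d ∈ hexField → d ≠ 0 →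
      Ψ0 = (veronese n PC2.infty).mapEquiv h → Ψ t = (veronese n (PC2.chart t)).mapEquiv h →
      Ψ (t + d) = (veronese n (PC2.chart (t + d))).mapEquiv h → ∀ m k : ℤ,
      Ψ (t + (m + k * hexRoot) * d) =
        (veronese n (PC2.chart (t + (m + k * hexRoot) * d))).mapEquiv h := by
    intro h d hd hd0 e0 e1 e2 m k
    have := mem_of_triangle_closed
      (P := fun p => Ψ (t + p) = (veronese n (PC2.chart (t + p))).mapEquiv h) ?_
      (rat_mem_hexField 0) hd hd0 (by simpa using e1) (by simpa using e2) m k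
    · simpa using this
    · intro p hp r hr hr0 f1 f2
      obtain ⟨h', g0, g1, g2, g3⟩ := hex p hp r hr hr0
      have := huniq hr0 e0 g0 f1 g1 (by rw [add_assoc]; exact f2) g2
      rw [this, ← add_assoc]
      exact g3
  obtain ⟨h, e0, e1, e2, -⟩ := hex 0 (by simpa using rat_mem_hexField 0) 1 one_mem_hexField
    one_ne_zero
  rw [add_zero] at e1 e2
  refine ⟨h, ?_⟩
  rintro _ ⟨q, rfl⟩
  -- A common denominator places the point in a lattice of mesh 1/N. This lattice also contains the
  -- edge from t to t + 1, so its automorphism acts on flags as the reference h.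
  have hN : ∃ N : ℕ, N ≠ 0 ∧ ∃ m k : ℤ, (q.1 : ℂ) + q.2 * hexRoot =
      (m + k * hexRoot) * ((N : ℚ)⁻¹ : ℚ) := by
    refine ⟨q.1.den * q.2.den, mul_ne_zero q.1.den_ne_zero q.2.den_ne_zero,
      q.1.num * q.2.den, q.2.num * q.1.den, ?_⟩
    have h1 : (q.1.den : ℂ) ≠ 0 := Nat.cast_ne_zero.mpr q.1.den_ne_zero
    have h2 : (q.2.den : ℂ) ≠ 0 := Nat.cast_ne_zero.mpr q.2.den_ne_zero
    rw [Rat.cast_def q.1, Rat.cast_def q.2]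
    push_cast
    field_simp
  obtain ⟨N, hN0, m, k, hmk⟩ := hN
  have hN0' : (((N : ℚ)⁻¹ : ℚ) : ℂ) ≠ 0 := by
    push_cast
    exact inv_ne_zero (Nat.cast_ne_zero.mpr hN0)
  obtain ⟨h', g0, g1, g2, -⟩ := hex 0 (by simpa using rat_mem_hexField 0) _
    (rat_mem_hexField ((N : ℚ)⁻¹)) hN0'
  rw [add_zero] at g1 g2
  have hall := hlat (rat_mem_hexField _) hN0' g0 g1 g2
  have g2' := hall N 0
  have e : t + (((N : ℤ) : ℂ) + ((0 : ℤ) : ℂ) * hexRoot) * (((N : ℚ)⁻¹ : ℚ) : ℂ) = t + 1 := by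
    have : (N : ℂ) ≠ 0 := Nat.cast_ne_zero.mpr hN0
    push_cast
    field_simp
    ring
  rw [e] at g2'
  have := huniq one_ne_zero e0 g0 e1 g1 e2 g2'
  rw [this]
  beta_reduce
  rw [hmk]
  exact hall m k

end Walk

/-! ### From a countable dense set to almost every point -/

section Density

theorem countable_hexField : hexField.Countable := Set.countable_range _

theorem dense_hexField : Dense hexField := by
  have hc : Continuous fun q : ℝ × ℝ => (q.1 : ℂ) + q.2 * hexRoot := by fun_prop
  have hs : Function.Surjective fun q : ℝ × ℝ => (q.1 : ℂ) + q.2 * hexRoot := by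
    intro z
    have hi := hexRoot_im_pos.ne'
    refine ⟨(z.re - z.im / hexRoot.im * hexRoot.re, z.im / hexRoot.im), ?_⟩
    apply Complex.ext
    · simp
    · simp
      field_simp
  have hd : DenseRange (Prod.map ((↑) : ℚ → ℝ) ((↑) : ℚ → ℝ)) :=
    Rat.denseRange_cast.prodMap Rat.denseRange_cast
  have e : hexField = Set.range ((fun q : ℝ × ℝ => (q.1 : ℂ) + q.2 * hexRoot) ∘
      Prod.map ((↑) : ℚ → ℝ) ((↑) : ℚ → ℝ)) :=
    congrArg Set.range (funext fun q => by simp)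
  rw [e]
  exact hs.denseRange.comp hd hc

/-- Translates by a dense countable set of almost every point meet a set of positive measure. -/
theorem ae_exists_add_mem {A : Set ℂ} (hA : MeasurableSet A) (hA0 : volume A ≠ 0) {D : Set ℂ}
    (hD : D.Countable) (hD' : Dense D) : ∀ᵐ t : ℂ, ∃ p ∈ D, t + p ∈ A := by
  set B : Set ℂ := {t | ¬ ∃ p ∈ D, t + p ∈ A} with hB
  have hBm : MeasurableSet B := by
    have : B = (⋃ p ∈ D, (fun t => t + p) ⁻¹' A)ᶜ := by
      ext t; simp [hB]
    rw [this]
    exact (MeasurableSet.biUnion hD fun p _ => (measurable_add_const p) hA).compl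
  change volume B = 0
  by_contra hB0
  -- If all translates of A met B in null sets, Fubini and the measure-preserving shear would give B
  -- × A measure zero.
  obtain ⟨x, hx⟩ : ∃ x : ℂ, volume {t | t ∈ B ∧ t + x ∈ A} ≠ 0 := by
    by_contra! h
    have hmp := measurePreserving_prod_add_swap (volume : Measure ℂ) (volume : Measure ℂ)
    have h1 := hmp.measure_preimage (hBm.prod hA).nullMeasurableSet
    have h2 : ((volume : Measure ℂ).prod volume)
        ((fun z : ℂ × ℂ => (z.2, z.2 + z.1)) ⁻¹' (B ×ˢ A)) = 0 := by
      rw [Measure.measure_prod_null (hmp.measurable (hBm.prod hA))]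
      exact Filter.Eventually.of_forall h
    rw [h2, Measure.prod_prod] at h1
    exact (mul_ne_zero hB0 hA0) h1.symm
  have hEm : MeasurableSet {t | t ∈ B ∧ t + x ∈ A} := hBm.inter ((measurable_add_const x) hA)
  -- Steinhaus: the difference set is a neighbourhood of 0, so some p in D near x satisfies e₁ + p =
  -- e₂ + x ∈ A with e₁ in B, which is absurd.
  have hnhds := Measure.sub_mem_nhds_zero_of_addHaar_pos volume _ hEm (pos_iff_ne_zero.mpr hx)
  obtain ⟨p, hpD, hp⟩ := hD'.inter_nhds_nonempty
    (show (fun p => p - x) ⁻¹' ({t | t ∈ B ∧ t + x ∈ A} - {t | t ∈ B ∧ t + x ∈ A}) ∈ nhds x from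
      (continuous_id.sub continuous_const).continuousAt (by simpa using hnhds))
  obtain ⟨e2, he2, e1, he1, he⟩ := Set.mem_sub.mp hp
  refine he1.1 ⟨p, hpD, ?_⟩
  have : e1 + p = e2 + x := by linear_combination -he
  rw [this]
  exact he2.2

/-- Almost every s avoids the countably many basic open preimages of measure zero, and for almost
every t the translate t + D meets all the others. -/
theorem ae_ae_mem_closure {X : Type*} [TopologicalSpace X] [SecondCountableTopology X]
    [MeasurableSpace X] [OpensMeasurableSpace X] {Γ : ℂ → X} (hΓ : Measurable Γ) {D : Set ℂ}
    (hD : D.Countable) (hD' : Dense D) :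
    ∀ᵐ t : ℂ, ∀ᵐ s : ℂ, Γ s ∈ closure ((fun p => Γ (t + p)) '' D) := by
  have hb := TopologicalSpace.isBasis_countableBasis X
  have hbc := TopologicalSpace.countable_countableBasis X
  have h1 : ∀ᵐ t : ℂ, ∀ U ∈ TopologicalSpace.countableBasis X, volume (Γ ⁻¹' U) ≠ 0 →
      ∃ p ∈ D, t + p ∈ Γ ⁻¹' U := by
    rw [ae_ball_iff hbc]
    intro U hU
    by_cases h0 : volume (Γ ⁻¹' U) = 0
    · exact Filter.Eventually.of_forall fun _ h => absurd h0 h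
    · filter_upwards [ae_exists_add_mem (hΓ (hb.isOpen hU).measurableSet) h0 hD hD'] with t ht _
      exact ht
  have h2 : ∀ᵐ s : ℂ, ∀ U ∈ TopologicalSpace.countableBasis X, volume (Γ ⁻¹' U) = 0 →
      s ∉ Γ ⁻¹' U := by
    rw [ae_ball_iff hbc]
    intro U hU
    by_cases h0 : volume (Γ ⁻¹' U) = 0
    · filter_upwards [measure_eq_zero_iff_ae_notMem.mp h0] with s hs _
      exact hs
    · exact Filter.Eventually.of_forall fun _ h => absurd h h0
  filter_upwards [h1] with t ht
  filter_upwards [h2] with s hs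
  rw [hb.mem_closure_iff]
  intro U hU hsU
  obtain ⟨p, hp, hpU⟩ := ht U hU fun h0 => hs U hU h0 hsU
  exact ⟨_, hpU, p, hp, rfl⟩

instance CompleteFlag.instSecondCountableTopology (n : ℕ) :
    SecondCountableTopology (CompleteFlag n) :=
  TopologicalSpace.secondCountableTopology_induced _ _ CompleteFlag.proj

theorem CompleteFlag.continuous_proj (n : ℕ) :
    Continuous (CompleteFlag.proj : CompleteFlag n → _) := continuous_induced_dom

theorem CompleteFlag.proj_eq_self_iff {n : ℕ} (F : CompleteFlag n) (j : Fin (n + 1))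
    (v : EuclideanSpace ℂ (Fin n)) :
    F.proj j v = v ↔ WithLp.ofLp v ∈ F.space j := by
  rw [CompleteFlag.proj, Submodule.starProjection_eq_self_iff]
  rfl

theorem continuous_veroneseVec (n i k : ℕ) :
    Continuous fun s : ℂ => veroneseVec n ![s, 1] i k := by
  refine continuous_pi fun l => ?_
  simp only [veroneseVec]
  split_ifs
  · simp only [Matrix.cons_val_zero, Matrix.cons_val_one]
    fun_prop
  · exact continuous_const

/-- The graph of `s ↦ h (φ_n [s : 1])` is closed. -/
theorem isClosed_veronese_graph (n : ℕ) (h : (Fin n → ℂ) ≃ₗ[ℂ] (Fin n → ℂ)) :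
    IsClosed {x : ℂ × CompleteFlag n | x.2 = (veronese n (PC2.chart x.1)).mapEquiv h} := by
  -- Lying in a space of the flag means being fixed by its orthogonal projection, a closed
  -- condition; testing the spanning vectors suffices because the dimensions agree.
  have heq : {x : ℂ × CompleteFlag n | x.2 = (veronese n (PC2.chart x.1)).mapEquiv h} =
      ⋂ (j : Fin (n + 1)) (k : Fin j), {x : ℂ × CompleteFlag n |
        x.2.proj j (WithLp.toLp 2 (h (veroneseVec n ![x.1, 1] (n - j) k))) =
          WithLp.toLp 2 (h (veroneseVec n ![x.1, 1] (n - j) k))} := by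
    ext x
    simp only [Set.mem_iInter, Set.mem_ofPred_eq, CompleteFlag.proj_eq_self_iff]
    constructor
    · intro hx j k
      rw [hx]
      exact ⟨_, Submodule.subset_span ⟨k, rfl⟩, rfl⟩
    · intro hx
      refine CompleteFlag.ext (funext fun j => (Submodule.eq_of_le_of_finrank_eq ?_ ?_).symm)
      · change (veroneseSpace n ![x.1, 1] j).map h.toLinearMap ≤ _
        rw [veroneseSpace, Submodule.map_span_le]
        rintro _ ⟨k, rfl⟩
        exact hx j k
      · rw [CompleteFlag.finrank_space, CompleteFlag.finrank_space]
  rw [heq]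
  refine isClosed_iInter fun j => isClosed_iInter fun k => ?_
  have hw : Continuous fun s : ℂ => WithLp.toLp 2 (h (veroneseVec n ![s, 1] (n - j) k)) :=
    (PiLp.continuous_toLp 2 _).comp
      ((LinearMap.continuous_of_finiteDimensional h.toLinearMap).comp (continuous_veroneseVec _ _ _))
  have hp : Continuous fun F : CompleteFlag n => F.proj j :=
    (continuous_apply j).comp (CompleteFlag.continuous_proj n)
  exact isClosed_eq ((hp.comp continuous_snd).clm_apply (hw.comp continuous_fst))
    (hw.comp continuous_fst)

/-- A measurable family of flags that sends almost all regular simplices with a vertex at `∞` and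
edges in `ℚ(ω)` to regular tuples is a Veronese family almost everywhere. -/
theorem exists_ae_eq_veronese {n : ℕ} (hn : 2 ≤ n) {Ψ : ℂ → CompleteFlag n} (hΨ : Measurable Ψ)
    (Ψ0 : CompleteFlag n)
    (h : ∀ᵐ t : ℂ, ∀ p ∈ hexField, ∀ r ∈ hexField, r ≠ 0 → IsRegularTuple hexRoot n fun i =>
      ((![Ψ0, Ψ (t + p), Ψ (t + p + r), Ψ (t + p + hexRoot * r)] : Fin 4 → CompleteFlag n)
        i).natSpace) :
    ∃ g, ∀ᵐ s : ℂ, Ψ s = (veronese n (PC2.chart s)).mapEquiv g := by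
  -- Applied to the graph map s ↦ (s, Ψ s), since it is the Veronese graph that is closed.
  have hcl := ae_ae_mem_closure (measurable_id.prodMk hΨ) countable_hexField dense_hexField
  obtain ⟨t, ht, ht'⟩ := (h.and hcl).exists
  obtain ⟨g, hg⟩ := exists_mapEquiv_of_forall_isRegularTuple hn t Ψ Ψ0 ht
  refine ⟨g, ?_⟩
  filter_upwards [ht'] with s hs
  refine closure_minimal ?_ (isClosed_veronese_graph n g) hs
  rintro _ ⟨p, hp, rfl⟩
  exact hg p hp

end Density

/-! ### Fubini, equivariance and conclusion -/

section MainTheorem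

theorem SL2_smul_mk (g : Matrix.SpecialLinearGroup (Fin 2) ℂ) {v : Fin 2 → ℂ} (hv : v ≠ 0) :
    ∃ hv' : g.1.mulVec v ≠ 0,
      g • Projectivization.mk ℂ v hv = Projectivization.mk ℂ (g.1.mulVec v) hv' :=
  ⟨_, Projectivization.smul_mk g hv⟩

instance SL2C.instSecondCountableTopology :
    SecondCountableTopology (Matrix.SpecialLinearGroup (Fin 2) ℂ) := by
  have : SecondCountableTopology (Matrix (Fin 2) (Fin 2) ℂ) :=
    inferInstanceAs (SecondCountableTopology (Fin 2 → Fin 2 → ℂ))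
  exact Matrix.SpecialLinearGroup.isClosedEmbedding_val.isEmbedding.secondCountableTopology

/-- The translation `z ↦ z + t` of the projective line. -/
noncomputable def PC2.translation (t : ℂ) : Matrix.SpecialLinearGroup (Fin 2) ℂ :=
  ⟨!![1, t; 0, 1], by simp⟩

theorem PC2.continuous_translation : Continuous PC2.translation := by
  refine Continuous.subtype_mk (continuous_matrix fun i j => ?_) _
  fin_cases i <;> fin_cases j <;> simp <;> fun_prop

theorem PC2.translation_smul_infty (t : ℂ) : PC2.translation t • PC2.infty = PC2.infty := by
  obtain ⟨h, e⟩ := SL2_smul_mk (PC2.translation t) (v := ![1, 0])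
    (fun h => one_ne_zero (congrFun h 0))
  refine e.trans ((Projectivization.mk_eq_mk_iff' ℂ _ _ _ _).mpr ⟨1, ?_⟩)
  ext i
  fin_cases i <;> simp [PC2.translation, Matrix.mulVec, dotProduct]

theorem PC2.translation_smul_chart (t s : ℂ) :
    PC2.translation t • PC2.chart s = PC2.chart (t + s) := by
  obtain ⟨h, e⟩ := SL2_smul_mk (PC2.translation t) (v := ![s, 1])
    (fun h => one_ne_zero (congrFun h 1))
  refine e.trans ((Projectivization.mk_eq_mk_iff' ℂ _ _ _ _).mpr ⟨1, ?_⟩)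
  ext i
  fin_cases i <;> simp [PC2.translation, Matrix.mulVec, dotProduct, add_comm]

theorem translation_smul_regularQuad (t a r : ℂ) (i : Fin 4) :
    PC2.translation t • regularQuad a r i = regularQuad (t + a) r i := by
  fin_cases i
  · exact PC2.translation_smul_infty t
  · exact PC2.translation_smul_chart t a
  · exact (PC2.translation_smul_chart t _).trans (congrArg PC2.chart (add_assoc _ _ _).symm)
  · exact (PC2.translation_smul_chart t _).trans (congrArg PC2.chart (add_assoc _ _ _).symm)

theorem PC2.continuous_smul (g : Matrix.SpecialLinearGroup (Fin 2) ℂ) :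
    Continuous fun ξ : PC2 => g • ξ := by
  refine continuous_coinduced_dom.mpr ?_
  have h : Continuous fun v : {v : Fin 2 → ℂ // v ≠ 0} =>
      (⟨g.1.mulVec v.1, (SL2_smul_mk g v.2).choose⟩ : {v : Fin 2 → ℂ // v ≠ 0}) :=
    Continuous.subtype_mk (Continuous.matrix_mulVec continuous_const continuous_subtype_val) _
  exact continuous_coinduced_rng.comp h

variable {n : ℕ}

/-- Almost all translates of a property of almost all regular simplices. -/
theorem AlmostEveryMaximal.exists_ae {P : (Fin 4 → PC2) → Prop} (hP : AlmostEveryMaximal P) :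
    ∃ g : Matrix.SpecialLinearGroup (Fin 2) ℂ, ∀ᵐ t : ℂ, ∀ p ∈ hexField, ∀ r ∈ hexField, r ≠ 0 →
      P fun i => g • regularQuad (t + p) r i := by
  let μ : Measure (Matrix.SpecialLinearGroup (Fin 2) ℂ) := Measure.haar
  -- Right multiplication by a translation preserves the class of Haar measure, so null sets of
  -- SL(2, ℂ) pull back to null sets in (g, t); Fubini then allows fixing g.
  have hq : Measure.QuasiMeasurePreserving
      (fun z : Matrix.SpecialLinearGroup (Fin 2) ℂ × ℂ => z.1 * PC2.translation z.2)
      (μ.prod volume) μ := by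
    refine QuasiMeasurePreserving.prod_of_left ?_ (Filter.Eventually.of_forall fun t =>
      quasiMeasurePreserving_mul_right μ (PC2.translation t))
    exact (continuous_fst.mul (PC2.continuous_translation.comp continuous_snd)).measurable
  have hall : ∀ᵐ z ∂(μ.prod (volume : Measure ℂ)), ∀ p ∈ hexField, ∀ r ∈ hexField, r ≠ 0 →
      P fun i => z.1 • regularQuad (z.2 + p) r i := by
    refine (ae_ball_iff countable_hexField).mpr fun p _ =>
      (ae_ball_iff countable_hexField).mpr fun r _ => ?_
    by_cases hr : r = 0
    · exact Filter.Eventually.of_forall fun _ h => absurd hr h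
    · filter_upwards [hq.ae (hP _ (isMaximalPoints_regularQuad p hr))] with z hz _
      simpa only [mul_smul, translation_smul_regularQuad] using hz
  exact (Measure.ae_ae_of_ae_prod hall).exists

theorem mulVec_crossRatioVec (g : Matrix (Fin 2) (Fin 2) ℂ) (ω : ℂ) (x y : Fin 2 → ℂ) (i : Fin 4) :
    g.mulVec (crossRatioVec ω x y i) = crossRatioVec ω (g.mulVec x) (g.mulVec y) i := by
  fin_cases i
  · rfl
  · rfl
  · exact Matrix.mulVec_add _ _ _
  · exact (Matrix.mulVec_add _ _ _).trans (by rw [Matrix.mulVec_smul]; rfl)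

/-- g is linear with nonzero determinant, so it carries x, y, x + y, ω x + y to vectors of the same
form. -/
theorem isRegularTuple_smul_regularQuad (hn : 2 ≤ n) (g : Matrix.SpecialLinearGroup (Fin 2) ℂ)
    (a : ℂ) {r : ℂ} (hr : r ≠ 0) :
    IsRegularTuple hexRoot n fun i => (veronese n (g • regularQuad a r i)).natSpace := by
  have hdet : (g.1.mulVec ![r, 0]) 0 * (g.1.mulVec ![a, 1]) 1 -
      (g.1.mulVec ![r, 0]) 1 * (g.1.mulVec ![a, 1]) 0 ≠ 0 := by
    have h1 := g.2
    rw [Matrix.det_fin_two] at h1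
    have : (g.1.mulVec ![r, 0]) 0 * (g.1.mulVec ![a, 1]) 1 -
        (g.1.mulVec ![r, 0]) 1 * (g.1.mulVec ![a, 1]) 0 = r := by
      simp [Matrix.mulVec, dotProduct]
      linear_combination r * h1
    rwa [this]
  have := isRegularTuple_veronese hn hdet
  convert this using 3 with i
  obtain ⟨h, e⟩ := SL2_smul_mk g
    (crossRatioVec_ne_zero hexRoot_ne_zero hexRoot_ne_one (affine_det_ne_zero a hr) i)
  rw [← mk_crossRatioVec a hr, e]
  simp only [mulVec_crossRatioVec]

/-- The condition that a vector lies in the span of independent vectors is closed. -/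
theorem mem_span_of_dense {ι : Type*} [Finite ι] {X E : Type*} [TopologicalSpace X]
    [NormedAddCommGroup E] [NormedSpace ℂ E] {w : X → E} {b : X → ι → E}
    (hw : Continuous w) (hb : Continuous b) (hli : ∀ x, LinearIndependent ℂ (b x)) {D : Set X}
    (hD : Dense D) (h : ∀ x ∈ D, w x ∈ Submodule.span ℂ (Set.range (b x))) (x : X) :
    w x ∈ Submodule.span ℂ (Set.range (b x)) := by
  by_contra hx
  have hopen : IsOpen {x : X | LinearIndependent ℂ fun o : Option ι => o.elim (w x) (b x)} := by
    refine (isOpen_setOfPred_linearIndependent (𝕜 := ℂ) (E := E) (ι := Option ι)).preimage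
      (continuous_pi fun o => ?_)
    cases o with
    | none => exact hw
    | some i => exact (continuous_apply i).comp hb
  have hmem : ∀ x, LinearIndependent ℂ (fun o : Option ι => o.elim (w x) (b x)) ↔
      w x ∉ Submodule.span ℂ (Set.range (b x)) := fun x => by
    rw [linearIndependent_option]
    exact ⟨fun h => h.2, fun h => ⟨hli x, h⟩⟩
  obtain ⟨y, hy, hyD⟩ := hD.inter_open_nonempty _ hopen ⟨x, (hmem x).mpr hx⟩
  exact (hmem y).mp hy (h y hyD)

theorem linearIndependent_veroneseVec (n : ℕ) {v : Fin 2 → ℂ} (hv : v ≠ 0) {m : ℕ} (hm : m ≤ n) :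
    LinearIndependent ℂ fun k : Fin m => veroneseVec n v (n - m) k := by
  rw [linearIndependent_iff_card_eq_finrank_span, Fintype.card_fin]
  exact (finrank_veroneseSpace n v hv m hm).symm

theorem continuous_veroneseVec_mulVec (g : Matrix (Fin 2) (Fin 2) ℂ) (n i k : ℕ) :
    Continuous fun s : ℂ => veroneseVec n (g.mulVec ![s, 1]) i k := by
  refine continuous_pi fun l => ?_
  simp only [veroneseVec]
  split_ifs
  · simp only [Matrix.mulVec, dotProduct, Fin.sum_univ_two, Matrix.cons_val_zero,
      Matrix.cons_val_one]
    fun_prop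
  · exact continuous_const

/-- The Veronese embedding is equivariant. -/
theorem exists_veronese_smul (hn : 2 ≤ n) (g : Matrix.SpecialLinearGroup (Fin 2) ℂ) :
    ∃ h, ∀ s, veronese n (g • PC2.chart s) = (veronese n (PC2.chart s)).mapEquiv h := by
  -- Rigidity applied to the family s ↦ φ_n(g s) gives h on ℚ(ω); continuity and density extend the
  -- identity to all s.
  obtain ⟨h, hh⟩ := exists_mapEquiv_of_forall_isRegularTuple hn 0
    (fun s => veronese n (g • PC2.chart s)) (veronese n (g • PC2.infty)) (fun p _ r _ hr => by
      convert isRegularTuple_smul_regularQuad hn g (0 + p) hr using 3 with i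
      fin_cases i <;> rfl)
  refine ⟨h, fun s => ?_⟩
  have hchart : ∀ s, ∃ hs : g.1.mulVec ![s, 1] ≠ 0,
      g • PC2.chart s = Projectivization.mk ℂ (g.1.mulVec ![s, 1]) hs := fun s =>
    SL2_smul_mk g (v := ![s, 1]) (fun h => one_ne_zero (congrFun h 1))
  have hspace : ∀ s (j : Fin (n + 1)), (veronese n (g • PC2.chart s)).space j =
      veroneseSpace n (g.1.mulVec ![s, 1]) j := fun s j => by
    obtain ⟨hs, e⟩ := hchart s
    rw [e]
    rfl
  refine CompleteFlag.ext (funext fun j => (Submodule.eq_of_le_of_finrank_eq ?_ ?_).symm)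
  · change (veroneseSpace n ![s, 1] j).map h.toLinearMap ≤ _
    rw [hspace, veroneseSpace, Submodule.map_span_le]
    rintro _ ⟨k, rfl⟩
    refine mem_span_of_dense (w := fun s => h (veroneseVec n ![s, 1] (n - j) k))
      (b := fun s (k : Fin j) => veroneseVec n (g.1.mulVec ![s, 1]) (n - j) k)
      ((LinearMap.continuous_of_finiteDimensional h.toLinearMap).comp
        (continuous_veroneseVec _ _ _))
      (continuous_pi fun k => continuous_veroneseVec_mulVec _ _ _ _)
      (fun s => linearIndependent_veroneseVec n (hchart s).choose (Nat.le_of_lt_succ j.2))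
      dense_hexField (fun p hp => ?_) s
    have h1 := hh p hp
    rw [zero_add] at h1
    change _ ∈ veroneseSpace n (g.1.mulVec ![p, 1]) j
    rw [← hspace, h1]
    exact ⟨_, Submodule.subset_span ⟨k, rfl⟩, rfl⟩
  · rw [CompleteFlag.finrank_space, CompleteFlag.finrank_space]

theorem PC2.chart_injective : Function.Injective PC2.chart := by
  intro s t h
  obtain ⟨c, hc⟩ := (Projectivization.mk_eq_mk_iff' ℂ _ _ _ _).mp h
  have h0 := congrFun hc 0
  have h1 := congrFun hc 1
  simp at h0 h1
  rw [h1, one_mul] at h0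
  exact h0.symm

theorem PC2.chart_eq_mk {v : Fin 2 → ℂ} (hv : v ≠ 0) (h1 : v 1 ≠ 0) :
    Projectivization.mk ℂ v hv = PC2.chart (v 0 / v 1) := by
  refine (Projectivization.mk_eq_mk_iff' ℂ _ _ _ _).mpr ⟨v 1, ?_⟩
  ext i
  fin_cases i
  · simp [mul_div_cancel₀ _ h1]
  · simp

theorem PC2.isOpenEmbedding_chart : Topology.IsOpenEmbedding PC2.chart := by
  refine .of_continuous_injective_isOpenMap PC2.continuous_chart PC2.chart_injective fun U hU => ?_
  refine isOpen_coinduced.mpr ?_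
  have h : Projectivization.mk' ℂ ⁻¹' (PC2.chart '' U) =
      {v : {v : Fin 2 → ℂ // v ≠ 0} | v.1 1 ≠ 0 ∧ v.1 0 / v.1 1 ∈ U} := by
    ext v
    constructor
    · rintro ⟨s, hs, e⟩
      obtain ⟨c, hc⟩ := (Projectivization.mk_eq_mk_iff' ℂ _ _ _ _).mp e.symm
      have e0 := congrFun hc 0
      have e1 := congrFun hc 1
      simp at e0 e1
      have hc0 : c ≠ 0 := by
        rintro rfl
        exact v.2 (by rw [← hc, zero_smul])
      refine ⟨by rwa [← e1], ?_⟩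
      rwa [← e0, ← e1, mul_div_cancel_left₀ _ hc0]
    · rintro ⟨h1, h⟩
      exact ⟨_, h, (PC2.chart_eq_mk v.2 h1).symm⟩
  rw [h]
  have hc : ∀ i, Continuous fun v : {v : Fin 2 → ℂ // v ≠ 0} => v.1 i := fun i =>
    (continuous_apply i).comp continuous_subtype_val
  have hV : IsOpen {v : {v : Fin 2 → ℂ // v ≠ 0} | v.1 1 ≠ 0} := isOpen_ne.preimage (hc 1)
  exact (((hc 0).continuousOn.div (hc 1).continuousOn fun _ h => h).isOpen_inter_preimage hV hU)

/-- Möbius transformations preserve null sets. -/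
theorem ae_chart_of_ae_smul_chart (g : Matrix.SpecialLinearGroup (Fin 2) ℂ) {P : PC2 → Prop}
    (h : ∀ᵐ s : ℂ, P (g • PC2.chart s)) : ∀ᵐ s : ℂ, P (PC2.chart s) := by
  obtain ⟨a, ha⟩ : ∃ a, a = (g⁻¹).1 0 0 := ⟨_, rfl⟩
  obtain ⟨b, hb⟩ : ∃ b, b = (g⁻¹).1 0 1 := ⟨_, rfl⟩
  obtain ⟨c, hc⟩ : ∃ c, c = (g⁻¹).1 1 0 := ⟨_, rfl⟩
  obtain ⟨d, hd⟩ : ∃ d, d = (g⁻¹).1 1 1 := ⟨_, rfl⟩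
  have hdet : a * d - b * c = 1 := by
    have := (g⁻¹).2
    rw [Matrix.det_fin_two] at this
    rw [ha, hb, hc, hd, this]
  have h1 : volume {s : ℂ | c * s + d = 0} = 0 := by
    refine Set.Subsingleton.measure_zero (fun s hs t ht => ?_) _
    have hs : c * s + d = 0 := hs
    have ht : c * t + d = 0 := ht
    have hc0 : c ≠ 0 := by
      rintro rfl
      rw [zero_mul, zero_add] at hs
      rw [hs] at hdet
      simp at hdet
    exact mul_left_cancel₀ hc0 (by linear_combination hs - ht)
  -- The entries a, b, c, d are those of g⁻¹, so this map is g in the affine chart; being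
  -- differentiable, it sends null sets to null sets.
  have h2 : volume ((fun u : ℂ => (d * u - b) / (a - c * u)) ''
      {u | a - c * u ≠ 0 ∧ ¬ P (g • PC2.chart u)}) = 0 := by
    refine addHaar_image_eq_zero_of_differentiableOn_of_addHaar_eq_zero volume ?_
      (measure_mono_null (fun u hu => hu.2) (ae_iff.mp h))
    have : DifferentiableOn ℂ (fun u : ℂ => (d * u - b) / (a - c * u))
        {u | a - c * u ≠ 0 ∧ ¬ P (g • PC2.chart u)} :=
      DifferentiableOn.div (by fun_prop) (by fun_prop) fun u hu => hu.1
    exact this.restrictScalars ℝ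
  filter_upwards [measure_eq_zero_iff_ae_notMem.mp h1, measure_eq_zero_iff_ae_notMem.mp h2]
    with s hs1 hs2
  obtain ⟨D, hD⟩ : ∃ D, D = c * s + d := ⟨_, rfl⟩
  have hD0 : D ≠ 0 := fun h => hs1 (hD.symm.trans h)
  have h3 : a - c * ((a * s + b) / D) = 1 / D := by
    field_simp
    linear_combination hdet + a * hD
  have h4 : d * ((a * s + b) / D) - b = s / D := by
    field_simp
    linear_combination s * hdet - b * hD
  by_contra hP
  refine hs2 ⟨(a * s + b) / D, ⟨?_, ?_⟩, ?_⟩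
  · rw [h3]
    exact one_div_ne_zero hD0
  · have : PC2.chart ((a * s + b) / D) = g⁻¹ • PC2.chart s := by
      obtain ⟨hv, e⟩ := SL2_smul_mk g⁻¹ (v := ![s, 1]) (fun h => one_ne_zero (congrFun h 1))
      have e0 : ((g⁻¹).1.mulVec ![s, 1]) 0 = a * s + b := by
        simp [Matrix.mulVec, dotProduct, ha, hb]
      have e1 : ((g⁻¹).1.mulVec ![s, 1]) 1 = D := by
        rw [hD]
        simp [Matrix.mulVec, dotProduct, hc, hd]
      refine Eq.symm (e.trans ((PC2.chart_eq_mk hv (by rwa [e1])).trans ?_))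
      rw [e0, e1]
    rw [this, smul_inv_smul]
    exact hP
  · change (d * ((a * s + b) / D) - b) / (a - c * ((a * s + b) / D)) = s
    rw [h3, h4, div_div_div_cancel_right₀ hD0, div_one]

/-- The action of a linear automorphism on flags is that of an element of `PSL(n, ℂ)`. -/
theorem exists_PSL_smul_eq_mapEquiv (hn : 0 < n) (h : (Fin n → ℂ) ≃ₗ[ℂ] (Fin n → ℂ)) :
    ∃ g : Matrix.ProjectiveSpecialLinearGroup (Fin n) ℂ,
      ∀ F : CompleteFlag n, g • F = F.mapEquiv h := by
  have hdet : (LinearMap.toMatrix' h.toLinearMap).det ≠ 0 := by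
    rw [LinearMap.det_toMatrix']
    exact (LinearEquiv.isUnit_det' h).ne_zero
  -- With c an n-th root of the inverse determinant, c h has determinant 1 and acts on flags as h
  -- does.
  obtain ⟨c, hc⟩ := IsAlgClosed.exists_pow_nat_eq (LinearMap.toMatrix' h.toLinearMap).det⁻¹ hn
  let g : Matrix.SpecialLinearGroup (Fin n) ℂ := ⟨c • LinearMap.toMatrix' h.toLinearMap, by
    rw [Matrix.det_smul, Fintype.card_fin, hc, inv_mul_cancel₀ hdet]⟩
  have hg : ∀ v, (Matrix.SpecialLinearGroup.toLin' g).toLinearMap v = c • h v := by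
    intro v
    change (c • LinearMap.toMatrix' h.toLinearMap).mulVec v = _
    rw [Matrix.smul_mulVec, LinearMap.toMatrix'_mulVec]
    rfl
  refine ⟨g, fun F => ?_⟩
  rw [CompleteFlag.coe_smul]
  refine CompleteFlag.ext (funext fun j => Submodule.eq_of_le_of_finrank_eq ?_ ?_)
  · rintro _ ⟨v, hv, rfl⟩
    rw [hg]
    exact Submodule.smul_mem _ _ ⟨v, hv, rfl⟩
  · rw [CompleteFlag.finrank_space, CompleteFlag.finrank_space]

end MainTheorem

theorem mainTheorem7 (n : ℕ) (hn : 2 ≤ n) (φ : PC2 → CompleteFlag n) (hφ : Measurable φ)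
    (hmax : AlmostEveryMaximal fun ξ => IsMaximalFlags fun i => φ (ξ i)) :
    ∃ g : Matrix.ProjectiveSpecialLinearGroup (Fin n) ℂ,
      ∀ᵐ ξ ∂PC2.measure, φ ξ = g • veronese n ξ := by
  obtain ⟨g, hg⟩ := hmax.exists_ae
  obtain ⟨h1, hh1⟩ := exists_ae_eq_veronese hn (Ψ := fun s => φ (g • PC2.chart s))
    (hφ.comp ((PC2.continuous_smul g).comp PC2.continuous_chart).measurable)
    (φ (g • PC2.infty)) (by
      filter_upwards [hg] with t ht p hp r hr hr0
      convert (ht p hp r hr hr0).isRegularTuple hn using 3 with i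
      fin_cases i <;> rfl)
  obtain ⟨h2, hh2⟩ := exists_veronese_smul hn g
  -- From φ ∘ g = h1 φ_n almost everywhere and φ_n ∘ g = h2 φ_n on the chart, φ = h1 h2⁻¹ φ_n almost
  -- everywhere.
  obtain ⟨k, hk⟩ := exists_PSL_smul_eq_mapEquiv (by omega) (h2.symm.trans h1)
  refine ⟨k, ?_⟩
  rw [PC2.measure, PC2.isOpenEmbedding_chart.measurableEmbedding.ae_map_iff]
  refine ae_chart_of_ae_smul_chart g (P := fun ξ => φ ξ = k • veronese n ξ) ?_
  filter_upwards [hh1] with s hs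
  rw [hs, hk, hh2 s, ← CompleteFlag.mapEquiv_trans, ← LinearEquiv.trans_assoc,
    LinearEquiv.self_trans_symm, LinearEquiv.refl_trans]
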